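/- Let $\Lambda\subset\mathbb C$ be a lattice and $\mathbb T^2=\mathbb C/\Lambda$ the corresponding flat torus, with its standard orientation. Let $G$ be a finite graph (loops and multiple edges allowed) embedded in $\mathbb T^2$, with vertex set $V(G)$ and edge set $E(G)$, whose edges are straight segments or, more generally, polygonal arcs, and all of whose faces (the connected components of the complement) are open topological discs. Let $G^*$ be a dual graph of $G$ with edges of the same kind, embedded in the same torus: $G^*$ has exactly one vertex in each face of $G$ and one edge $e^*$ for each edge $e$ of $G$; the edge $e^*$ crosses $e$ transversally in exactly one point, interior to a segment of each, and meets $G$ nowhere else; and the cyclic order of the dual edges around a vertex of $G^*$ is the order of the corresponding edges along the boundary of the corresponding face of $G$. For an oriented edge $e$, let $o(e)$, $t(e)$ and $\bar e$ denote its origin, its terminus and the same edge with the opposite orientation. If $t(e)=o(e')$ and $e'\ne\bar e$, let $\alpha(e,e')\in\mathbb R$ be the total rotation angle of the velocity along $e$ and then from $e$ to $e'$ at $t(e)$, i.e. the sum of the turning angles in $(-\pi,\pi)$ at the intermediate corners of $e$ (there are none if $e$ is straight) and of the angle in $(-\pi,\pi)$ from the final direction of $e$ to the initial direction of $e'$.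 Let $\varphi\in \mathrm{Hom}(\pi_1(\mathbb T^2),\mathbb C^*)=H^1(\mathbb T^2;\mathbb C^*)$, and represent it by a cocycle on $G$, that is, by nonzero complex numbers $\varphi(e)$ with $\varphi(\bar e)=\varphi(e)^{-1}$, whose product along each closed path in $G$ is the value of $\varphi$ on the class of this path. For real weights $x=(x_e)_{e\in E(G)}$ (with $x_{\bar e}=x_e$), let $T^\varphi$ be the matrix indexed by the oriented edges of $G$ with $$T^\varphi_{e,e'}=\begin{cases}\varphi(e)\exp\left(\tfrac i2\alpha(e,e')\right)x_e&\text{if } t(e)=o(e') \text{ and } e'\neq\bar e,\\ 0&\text{otherwise,}\end{cases}$$ and let $P^\varphi(G,x)=\det(I-T^\varphi)$ be the Kac–Ward determinant. Define $P^\varphi(G^*,\cdot)$ in the same way, with a cocycle on $G^*$ that represents the same class $\varphi$. Let $x\in(0,1)^{E(G)}$, and let $x^*$ be the dual weights, defined by $x_e+x^*_e+x_ex^*_e=1$ for all $e\in E(G)$; regard $x^*_e$ as the weight of $e^*$. Then, for every $\varphi\in H^1(\mathbb T^2;\mathbb C^*)$ and for every choice of the representing cocycles on $G$ and on $G^*$,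 $$2^{|V(G)|}\prod_{e\in E(G)}(1+x_e)^{-1}\,P^\varphi(G,x)=2^{|V(G^*)|}\prod_{e\in E(G)}(1+x^*_e)^{-1}\,P^\varphi(G^*,x^*).$$ -/

import Mathlib

/-- Oriented edges of a graph with edge set `E`: an edge with its reference orientation
(`true`) or with the opposite one (`false`). -/
abbrev ODart (E : Type*) := E × Bool

namespace ODart

/-- The same edge with the opposite orientation. -/
def rev {E : Type*} (d : ODart E) : ODart E := (d.1, !d.2)

end ODart

/-- A graph with vertex set `V` and edge set `E` (loops and multiple edges are allowed), embedded
in the flat torus `ℂ ⧸ Λ`, whose edges are simple polygonal arcs. The edge `e` is the image of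
the polygonal path in `ℂ` with successive corners `corner e 0, …, corner e (len e)`; the value of
`corner e k` for `k > len e` is irrelevant. A straight edge is one with `len e = 1`. -/
structure TorusGraph (Λ : Submodule ℤ ℂ) (V E : Type*) where
  /-- the position of a vertex in the torus -/
  pos : V → ℂ ⧸ Λ
  /-- the origin of an edge, for its reference orientation -/
  source : E → V
  /-- the terminus of an edge, for its reference orientation -/
  target : E → V
  /-- the number of segments of an edge -/
  len : E → ℕ
  /-- the successive corners of a lift of the edge to the universal cover `ℂ` -/
  corner : E → ℕ → ℂ
  len_pos : ∀ e, 0 < len e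
  corner_zero : ∀ e, Λ.mkQ (corner e 0) = pos (source e)
  corner_len : ∀ e, Λ.mkQ (corner e (len e)) = pos (target e)
  /-- distinct vertices are distinct points -/
  pos_injective : Function.Injective pos
  /-- no vertex lies in the interior of an edge -/
  avoid : ∀ (e : E) (k : ℕ) (t : ℝ), k < len e → t ∈ Set.Ico (0 : ℝ) 1 → (k ≠ 0 ∨ t ≠ 0) →
    ∀ v, Λ.mkQ (AffineMap.lineMap (corner e k) (corner e (k + 1)) t) ≠ pos v
  /-- the interiors of the edges are simple arcs, and they are pairwise disjoint -/
  simple : ∀ (e e' : E) (k k' : ℕ) (t t' : ℝ),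
    k < len e → t ∈ Set.Ico (0 : ℝ) 1 → (k ≠ 0 ∨ t ≠ 0) →
    k' < len e' → t' ∈ Set.Ico (0 : ℝ) 1 → (k' ≠ 0 ∨ t' ≠ 0) →
    Λ.mkQ (AffineMap.lineMap (corner e k) (corner e (k + 1)) t) =
      Λ.mkQ (AffineMap.lineMap (corner e' k') (corner e' (k' + 1)) t') →
    e = e' ∧ k = k' ∧ t = t'

/-- The counterclockwise angle in `(0, 2π]` from the direction `u` to the direction `v`. -/
noncomputable def ccwAngle (u v : ℂ) : ℝ :=
  toIocMod Real.two_pi_pos 0 (Complex.arg (v / u))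

namespace TorusGraph

variable {Λ : Submodule ℤ ℂ} {V F E : Type*}

/-- The point at parameter `t ∈ [0, 1]` of the `k`-th segment of the edge `e`, in the torus. -/
noncomputable def point (G : TorusGraph Λ V E) (e : E) (k : ℕ) (t : ℝ) : ℂ ⧸ Λ :=
  Λ.mkQ (AffineMap.lineMap (G.corner e k) (G.corner e (k + 1)) t)

/-- The closed edge `e`, as a subset of the torus. -/
def edgeSet (G : TorusGraph Λ V E) (e : E) : Set (ℂ ⧸ Λ) :=
  {q | ∃ k < G.len e, ∃ t ∈ Set.Icc (0 : ℝ) 1, q = G.point e k t}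

/-- The embedded graph, as a subset of the torus. -/
def support (G : TorusGraph Λ V E) : Set (ℂ ⧸ Λ) :=
  Set.range G.pos ∪ ⋃ e, G.edgeSet e

/-- The face containing the point `p`: the connected component of `p` in the complement of the
graph (for `p` in that complement). -/
def face (G : TorusGraph Λ V E) (p : ℂ ⧸ Λ) : Set (ℂ ⧸ Λ) :=
  connectedComponentIn G.supportᶜ p

/-- All faces are open topological discs. -/
def IsCellular (G : TorusGraph Λ V E) : Prop :=
  ∀ p ∈ G.supportᶜ, Nonempty (G.face p ≃ₜ Metric.ball (0 : ℂ) 1)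

/-- The origin of an oriented edge. -/
def origin (G : TorusGraph Λ V E) (d : ODart E) : V :=
  if d.2 then G.source d.1 else G.target d.1

/-- The terminus of an oriented edge. -/
def terminus (G : TorusGraph Λ V E) (d : ODart E) : V :=
  if d.2 then G.target d.1 else G.source d.1

/-- The successive corners of (a lift of) an oriented edge, from its origin to its terminus. -/
def dartCorner (G : TorusGraph Λ V E) (d : ODart E) (k : ℕ) : ℂ :=
  if d.2 then G.corner d.1 k else G.corner d.1 (G.len d.1 - k)

/-- The displacement in the universal cover along an oriented edge. -/
def disp (G : TorusGraph Λ V E) (d : ODart E) : ℂ :=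
  G.dartCorner d (G.len d.1) - G.dartCorner d 0

/-- The direction in which an oriented edge leaves its origin. -/
def startDir (G : TorusGraph Λ V E) (d : ODart E) : ℂ :=
  G.dartCorner d 1 - G.dartCorner d 0

/-- The direction in which an oriented edge arrives at its terminus. -/
def endDir (G : TorusGraph Λ V E) (d : ODart E) : ℂ :=
  G.dartCorner d (G.len d.1) - G.dartCorner d (G.len d.1 - 1)

/-- The total rotation of the velocity along an oriented edge: the sum of the turning angles,
each in `(-π, π)`, at its intermediate corners. It is `0` for a straight edge. -/
noncomputable def bend (G : TorusGraph Λ V E) (d : ODart E) : ℝ :=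
  ∑ k ∈ Finset.range (G.len d.1 - 1),
    Complex.arg ((G.dartCorner d (k + 2) - G.dartCorner d (k + 1)) /
      (G.dartCorner d (k + 1) - G.dartCorner d k))

/-- The angle `α(d, d')` from `d` to `d'`: the total rotation of the velocity along `d` and then
at the terminus of `d`, up to the initial direction of `d'`. For straight edges this is just the
angle in `(-π, π)` between the two directions. -/
noncomputable def turn (G : TorusGraph Λ V E) (d d' : ODart E) : ℝ :=
  G.bend d + Complex.arg (G.startDir d' / G.endDir d)

/-- The matrix `T^φ`, indexed by the oriented edges, for a 1-cochain `φ` and weights `x`. -/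
noncomputable def kwT (G : TorusGraph Λ V E) (φ : ODart E → ℂˣ) (x : E → ℝ) :
    Matrix (ODart E) (ODart E) ℂ :=
  open Classical in
  Matrix.of fun d d' =>
    if G.terminus d = G.origin d' ∧ d' ≠ d.rev then
      (φ d : ℂ) * Complex.exp (Complex.I / 2 * (G.turn d d' : ℂ)) * (x d.1 : ℂ)
    else 0

/-- The Kac-Ward determinant `det (I - T^φ)`. -/
noncomputable def kwDet [Fintype E] [DecidableEq E] (G : TorusGraph Λ V E)
    (φ : ODart E → ℂˣ) (x : E → ℝ) : ℂ :=
  (1 - G.kwT φ x).det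

/-- `G.IsWalk u l v`: the list `l` of oriented edges is a path in `G` from `u` to `v`. -/
def IsWalk (G : TorusGraph Λ V E) : V → List (ODart E) → V → Prop
  | u, [], v => u = v
  | u, d :: l, v => G.origin d = u ∧ G.IsWalk (G.terminus d) l v

/-- The 1-cochain `φ` on `G` is a 1-cocycle representing the class
`χ ∈ Hom(π₁(ℂ ⧸ Λ), ℂˣ) = H¹(ℂ ⧸ Λ; ℂˣ)`, where `π₁(ℂ ⧸ Λ) = Λ`: on each closed path in `G`, the
product of the values of `φ` is the value of `χ` on the class of this path, which is the total
displacement of a lift to the universal cover. -/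
def Represents (G : TorusGraph Λ V E) (χ : Multiplicative Λ →* ℂˣ) (φ : ODart E → ℂˣ) : Prop :=
  (∀ d, φ d.rev = (φ d)⁻¹) ∧
  ∀ (v : V) (l : List (ODart E)), G.IsWalk v l v →
    ∀ c : Λ, (c : ℂ) = (l.map G.disp).sum → (l.map φ).prod = χ (Multiplicative.ofAdd c)

/-- `d'` follows `d` in the counterclockwise cyclic order of the oriented edges with the same
origin as `d` (with `d' = d` if there is no other one). -/
def IsNext (G : TorusGraph Λ V E) (d d' : ODart E) : Prop :=
  G.origin d' = G.origin d ∧ ∀ d'', G.origin d'' = G.origin d →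
    ccwAngle (G.startDir d) (G.startDir d') ≤ ccwAngle (G.startDir d) (G.startDir d'')

/-- `H` is a dual graph of `G`, drawn in the same torus. The dual edge of `e` is the edge of `H`
with the same name, with reference orientation such that it crosses `e` from left to right. -/
structure IsDual (G : TorusGraph Λ V E) (H : TorusGraph Λ F E) : Prop where
  /-- the vertices of `H` do not lie on `G` -/
  vertex_notMem : ∀ f, H.pos f ∉ G.support
  /-- each face of `G` contains exactly one vertex of `H` -/
  existsUnique_vertex : ∀ p ∈ G.supportᶜ, ∃! f, H.pos f ∈ G.face p
  /-- an edge and its dual meet in exactly one point, where they cross transversally -/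
  cross : ∀ e, ∃ k < G.len e, ∃ t ∈ Set.Ioo (0 : ℝ) 1, ∃ l < H.len e, ∃ s ∈ Set.Ioo (0 : ℝ) 1,
    G.point e k t = H.point e l s ∧
    ((H.corner e (l + 1) - H.corner e l) / (G.corner e (k + 1) - G.corner e k)).im < 0 ∧
    G.edgeSet e ∩ H.edgeSet e = {G.point e k t}
  /-- an edge is disjoint from the duals of the other edges -/
  disjoint : ∀ e e', e ≠ e' → Disjoint (G.edgeSet e) (H.edgeSet e')
  /-- the counterclockwise order of the dual edges around a vertex of `H` is the order of the
  edges along the boundary of the corresponding face of `G`: this boundary, traversed with the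
  face on the left, passes from `d'.rev` to `d` exactly when `d'` follows `d` around their common
  origin -/
  order : ∀ d d', G.IsNext d d' → H.IsNext d'.rev d

end TorusGraph

/-! Write T = X U K, where X is the diagonal matrix of the weights, U reverses an oriented edge with
its holonomy and half its bending as weight, and K collects the half-angle turns at the vertices.
Let R be the sparse matrix that only turns from an oriented edge to the next one counterclockwise,
with weight exp(i/2 · angle). Around a vertex these weights multiply to exp(iπ) = -1. Hence K is the
Cayley transform -i(1 + R)(1 - R)⁻¹, and det(1 - R) = 2^|V|. With J = iU, so that J² = -1, this
gives 2^|V| det(1 - T) = det((1 + XJ) - (1 - XJ)R) (`vertexMatrix_mul`, `det_one_sub_turnMatrix`,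
`det_cayley`).

The dual weights are themselves a Cayley transform, Y = (1 - X)(1 + X)⁻¹. Turning around a dual
vertex amounts to following the boundary of a face, so after a change of gauge the dual turn matrix
R' satisfies R'R = J. Multiplying the dual expression by 1 + X on the left and by R on the right
then yields the original expression times -(1 + J) (`det_dual`). The determinants of 1 + X and 1 + J
are ∏(1 + x)² and 2^|E|, and (1 + x)(1 + x*) = 2 turns them into the stated normalization.

The geometry enters only in R'R = J, which is one scalar identity for each corner of a face, between
consecutive oriented edges d and d'. Such a corner is bounded by a quadrilateral made of halves of
d, of d' and of their duals. The values of φ cancel because the quadrilateral closes up in the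
universal cover (`CrossingData.shift_eq`): faces are discs, so they lift, and a component of the
complement of the lifted graph contains at most one lift of each dual vertex. The half-angles give
the right sign because the quadrilateral is a simple closed polygon, whose total rotation is an odd
multiple of 2π (`rotation_closed_polygon`, `rotation_corner`). -/

section Matrices

/-! ### Half-angle matrices of a rotation system -/

open Matrix

/-- The oriented edges of a surface graph, each at its origin, with the counterclockwise angles in
`(0, 2π]` between those with the same origin, and with the resulting cyclic permutations. -/
structure AngularRotation (D V : Type*) where
  origin : D → V
  angle : D → D → ℝ
  next : Equiv.Perm D
  origin_next : ∀ d, origin (next d) = origin d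
  angle_pos : ∀ a b, 0 < angle a b
  angle_le : ∀ a b, angle a b ≤ 2 * Real.pi
  angle_self : ∀ a, angle a a = 2 * Real.pi
  angle_add_swap : ∀ a b, origin a = origin b → a ≠ b → angle a b + angle b a = 2 * Real.pi
  angle_cocycle : ∀ a b c, ∃ m : ℤ, angle a b + angle b c = angle a c + m * (2 * Real.pi)
  angle_next_le : ∀ a b, origin b = origin a → angle a (next a) ≤ angle a b

namespace AngularRotation

variable {D V : Type*} (S : AngularRotation D V)

theorem angle_add_eq {a b c : D} (h : S.angle a b + S.angle b c ≤ 2 * Real.pi) :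
    S.angle a b + S.angle b c = S.angle a c := by
  obtain ⟨m, hm⟩ := S.angle_cocycle a b c
  have h1 := S.angle_pos a b
  have h2 := S.angle_pos b c
  have h3 := S.angle_pos a c
  have h4 := S.angle_le a c
  have hpi := Real.pi_pos
  have hm0 : m = 0 := by
    have l1 : (m : ℝ) < 1 := by nlinarith
    have l2 : (-1 : ℝ) < m := by nlinarith
    have l1' : m < 1 := by exact_mod_cast l1
    have l2' : -1 < m := by exact_mod_cast l2
    omega
  subst hm0
  simpa using hm

/-- No oriented edge lies strictly between `b` and `S.next b`, so the sweep from `a` through `b` to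
`S.next b` does not pass `a` again. If it ends at `a`, both sides are a full turn. -/
theorem angle_add_next {a b : D} (hab : S.origin a = S.origin b) (hne : a ≠ b) :
    S.angle a b + S.angle b (S.next b) = S.angle a (S.next b) := by
  apply S.angle_add_eq
  have := S.angle_add_swap a b hab hne
  have := S.angle_next_le b a hab
  linarith

variable [Fintype D] [DecidableEq D]

/-- The weighted permutation matrix of the turn to the next oriented edge. -/
noncomputable def turnMatrix : Matrix D D ℂ :=
  Matrix.of fun d d' => if d' = S.next d then Complex.exp (Complex.I / 2 * (S.angle d d' : ℂ)) else 0

open Classical in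
/-- The matrix of all the turns at the vertices that do not go straight back. -/
noncomputable def vertexMatrix : Matrix D D ℂ :=
  Matrix.of fun d d' => if S.origin d = S.origin d' ∧ d ≠ d' then
    Complex.exp (Complex.I / 2 * ((S.angle d d' : ℂ) - Real.pi)) else 0

theorem mul_turnMatrix_apply (M : Matrix D D ℂ) (a b : D) :
    (M * S.turnMatrix) a (S.next b) =
      M a b * Complex.exp (Complex.I / 2 * (S.angle b (S.next b) : ℂ)) := by
  rw [Matrix.mul_apply, Finset.sum_eq_single b]
  · simp [turnMatrix]
  · intro c _ hc
    have : ¬ b = c := fun h => hc h.symm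
    simp [turnMatrix, this]
  · simp

theorem exp_half_two_pi (z : ℂ) (h : z = 2 * Real.pi) : Complex.exp (Complex.I / 2 * z) = -1 := by
  rw [h, ← Complex.exp_pi_mul_I]; congr 1; ring

theorem exp_half_pi (z : ℂ) (h : z = Real.pi) : Complex.exp (Complex.I / 2 * z) = Complex.I := by
  rw [h, show Complex.I / 2 * (Real.pi : ℂ) = Real.pi / 2 * Complex.I by ring,
    Complex.exp_pi_div_two_mul_I]

theorem exp_half_sub_pi (z : ℂ) : Complex.exp (Complex.I / 2 * (z - Real.pi)) =
    -Complex.I * Complex.exp (Complex.I / 2 * z) := by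
  rw [mul_sub, Complex.exp_sub, exp_half_pi _ rfl, Complex.div_I]; ring

/-- In the column of `S.next b`, the product is a difference of two half-angle exponentials that
cancel by additivity of the angles. They fail to cancel only when one of them is missing from the
diagonal of the vertex matrix: `a = b` leaves the entry of `S.turnMatrix`, and `a = S.next b` leaves
the full turn exp(iπ) = -1, hence the identity matrix. -/
theorem vertexMatrix_mul : S.vertexMatrix * (1 - S.turnMatrix) =
    -Complex.I • (1 + S.turnMatrix) := by
  ext a b
  obtain ⟨b, rfl⟩ := S.next.surjective b
  rw [Matrix.mul_sub, Matrix.mul_one, Matrix.sub_apply, mul_turnMatrix_apply, Matrix.smul_apply,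
    Matrix.add_apply, Matrix.one_apply]
  by_cases ho : S.origin a = S.origin b
  · have ho' : S.origin a = S.origin (S.next b) := by rw [S.origin_next, ho]
    by_cases hab : a = b
    · subst hab
      by_cases han : a = S.next a
      -- At a vertex with a single oriented edge both terms are missing, and the right side vanishes
      -- since the full turn has weight -1.
      · simp only [vertexMatrix, turnMatrix, Matrix.of_apply, ← han]
        rw [exp_half_two_pi (S.angle a a : ℂ) (by rw [S.angle_self]; push_cast; ring)]
        simp
      · simp only [vertexMatrix, turnMatrix, Matrix.of_apply]
        rw [if_pos ⟨ho', han⟩, if_neg (by simp), if_neg han, exp_half_sub_pi]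
        simp
    · have hnab : ¬ S.next b = S.next a := fun h => hab (S.next.injective h).symm
      by_cases han : a = S.next b
      · have h1 := S.angle_add_next ho hab
        rw [← han, S.angle_self] at h1
        simp only [vertexMatrix, turnMatrix, Matrix.of_apply]
        rw [if_neg (by simp [han]), if_pos ⟨ho, hab⟩, if_pos han, if_neg hnab, exp_half_sub_pi,
          mul_assoc, ← Complex.exp_add, ← mul_add, ← han,
          exp_half_two_pi ((S.angle a b : ℂ) + S.angle b a) (by exact_mod_cast h1)]
        simp
      · have h1 := S.angle_add_next ho hab
        simp only [vertexMatrix, turnMatrix, Matrix.of_apply]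
        rw [if_pos ⟨ho', han⟩, if_pos ⟨ho, hab⟩, if_neg han, if_neg hnab, exp_half_sub_pi,
          exp_half_sub_pi, mul_assoc, ← Complex.exp_add, ← mul_add, ← h1]
        simp
  · have ho' : ¬ S.origin a = S.origin (S.next b) := by rwa [S.origin_next]
    have h1 : a ≠ b := fun h => ho (by rw [h])
    have h2 : a ≠ S.next b := fun h => ho' (by rw [← h])
    have h3 : S.next b ≠ S.next a := fun h => h1 (S.next.injective h).symm
    simp [vertexMatrix, turnMatrix, ho, ho', h2, h3]

theorem turnMatrix_mul_conjTranspose : S.turnMatrix * S.turnMatrixᴴ = 1 := by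
  ext a b
  rw [Matrix.mul_apply, Finset.sum_eq_single (S.next a)]
  · by_cases hab : a = b
    · subst hab
      simp only [turnMatrix, Matrix.of_apply, Matrix.conjTranspose_apply, if_true,
        Matrix.one_apply_eq, RCLike.star_def, ← Complex.exp_conj, ← Complex.exp_add]
      rw [Complex.exp_eq_one_iff]
      refine ⟨0, ?_⟩
      simp [map_ofNat]
      ring
    · have : ¬ S.next a = S.next b := fun h => hab (S.next.injective h)
      simp [turnMatrix, hab, this]
  · intro c _ hc
    simp [turnMatrix, hc]
  · simp

end AngularRotation

/-- The matrix is block triangular for the levels of `κ`. Ties are harmless: inside a level all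
off-diagonal entries vanish. -/
theorem Matrix.det_eq_prod_diag_of_key {D : Type*} [Fintype D] [DecidableEq D] (M : Matrix D D ℂ)
    (κ : D → ℝ) (h : ∀ a b, a ≠ b → M a b ≠ 0 → κ a < κ b) : M.det = ∏ a, M a a := by
  have hM : M.BlockTriangular κ := by
    intro a b hab
    by_contra hne
    rcases eq_or_ne a b with rfl | h'
    · exact lt_irrefl _ hab
    · exact lt_asymm hab (h a b h' hne)
  rw [hM.det]
  have : ∀ k, (M.toSquareBlock κ k).det = ∏ a : {a // κ a = k}, M a a := by
    intro k
    have : M.toSquareBlock κ k = Matrix.diagonal fun a : {a // κ a = k} => M a a := by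
      ext a b
      rcases eq_or_ne a b with rfl | hab
      · simp [Matrix.toSquareBlock_def]
      · rw [Matrix.diagonal_apply_ne _ hab]
        by_contra hne
        have h1 := h a b (fun h => hab (Subtype.ext h)) hne
        rw [a.2, b.2] at h1
        exact lt_irrefl _ h1
    rw [this, Matrix.det_diagonal]
  simp_rw [this]
  rw [← Finset.prod_fiberwise_of_maps_to (s := Finset.univ) (t := Finset.univ.image κ) (g := κ)
    (fun a _ => Finset.mem_image_of_mem _ (Finset.mem_univ a))]
  refine Finset.prod_congr rfl fun k _ => ?_
  exact (Finset.prod_subtype _ (by simp) fun a => M a a).symm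

namespace AngularRotation

variable {D V : Type*} (S : AngularRotation D V) [Fintype D] [DecidableEq D]

open Classical in
/-- The unipotent matrix that adds to the row of the base edge `base v` of each vertex `v` all the
other rows of this vertex. -/
noncomputable def sweepMatrix (base : V → D) : Matrix D D ℂ :=
  Matrix.of fun d d' => if d = d' then 1 else if d = base (S.origin d') then
    Complex.exp (Complex.I / 2 * (S.angle d d' : ℂ)) else 0

/-- The angle of the base edge with itself is 2π rather than 0, the largest at its vertex. So minus
the angle from the base increases from the base edge to all the others. -/
theorem det_sweepMatrix {base : V → D} (hb : ∀ v, S.origin (base v) = v) :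
    (S.sweepMatrix base).det = 1 := by
  rw [Matrix.det_eq_prod_diag_of_key _ (fun d => -S.angle (base (S.origin d)) d)]
  · simp [sweepMatrix]
  · intro a b hab h
    simp only [sweepMatrix, Matrix.of_apply, if_neg hab] at h
    split_ifs at h with h1
    · have e : S.origin a = S.origin b := by rw [h1, hb]
      rw [e, ← h1, S.angle_self]
      have h2 := S.angle_add_swap a b e hab
      have h3 := S.angle_pos b a
      linarith
    · exact absurd rfl h

theorem sweepMatrix_mul_apply {base : V → D} (a b : D) :
    (S.sweepMatrix base * (1 - S.turnMatrix)) a (S.next b) = S.sweepMatrix base a (S.next b) -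
      S.sweepMatrix base a b * Complex.exp (Complex.I / 2 * (S.angle b (S.next b) : ℂ)) := by
  rw [Matrix.mul_sub, Matrix.mul_one, Matrix.sub_apply, mul_turnMatrix_apply]

/-- The sum over a vertex telescopes; what remains is 1 at the start of the sweep, minus the weight
-1 of the full turn. -/
theorem sweepMatrix_mul_base {base : V → D} (hb : ∀ v, S.origin (base v) = v) (v : V) (c : D) :
    (S.sweepMatrix base * (1 - S.turnMatrix)) (base v) c = if c = base v then 2 else 0 := by
  obtain ⟨b, rfl⟩ := S.next.surjective c
  rw [sweepMatrix_mul_apply]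
  by_cases ho : S.origin b = v
  · have hob : S.origin (base v) = S.origin b := by rw [hb, ho]
    by_cases h1 : base v = b
    · by_cases h2 : S.next b = base v
      · simp only [sweepMatrix, Matrix.of_apply, ho, S.origin_next, if_pos h1, if_pos h2,
          if_pos h2.symm]
        rw [h2, h1, exp_half_two_pi (S.angle b b : ℂ) (by rw [S.angle_self]; push_cast; ring)]
        norm_num
      · simp only [sweepMatrix, Matrix.of_apply, ho, S.origin_next, if_pos h1,
          if_neg h2, if_neg (Ne.symm h2), if_true]
        rw [h1]; simp
    · have h3 := S.angle_add_next hob h1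
      by_cases h2 : S.next b = base v
      · simp only [sweepMatrix, Matrix.of_apply, ho, S.origin_next, if_neg h1, if_pos h2,
          if_pos h2.symm, if_true]
        rw [← Complex.exp_add, ← mul_add, exp_half_two_pi]
        · norm_num
        · rw [h2, S.angle_self] at h3
          rw [h2]
          exact_mod_cast h3
      · simp only [sweepMatrix, Matrix.of_apply, ho, S.origin_next, if_neg h1,
          if_neg h2, if_neg (Ne.symm h2), if_true]
        rw [← Complex.exp_add, ← mul_add, ← h3]
        simp
  · have hne : ∀ d, S.origin d = S.origin b → base v ≠ d := by
      rintro d hd rfl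
      exact ho (by rw [← hd, hb])
    have hne' : base v ≠ base (S.origin b) := hne _ (hb _)
    have h1 := hne _ (S.origin_next b)
    simp [sweepMatrix, S.origin_next, hne _ rfl, h1, hne', Ne.symm h1]

/-- At each vertex `1 - S.turnMatrix` is the identity minus a weighted cycle whose weights multiply
to -1, so it contributes 1 - (-1) = 2. After the sweep, base rows have the single entry 2, and every
other row has 1 on the diagonal and one entry at a larger angle from the base. -/
theorem det_one_sub_turnMatrix [Fintype V] {base : V → D} (hb : ∀ v, S.origin (base v) = v) :
    (1 - S.turnMatrix).det = 2 ^ Fintype.card V := by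
  classical
  have hinj : Function.Injective base := fun v w h => by rw [← hb v, h, hb]
  have hrow : ∀ a, (¬ ∃ v, base v = a) → ∀ c,
      (S.sweepMatrix base * (1 - S.turnMatrix)) a c = (1 - S.turnMatrix) a c := by
    intro a ha c
    obtain ⟨b, rfl⟩ := S.next.surjective c
    have ha' : ∀ v, a ≠ base v := fun v h => ha ⟨v, h.symm⟩
    rw [sweepMatrix_mul_apply]
    by_cases hab : a = b
    · subst hab
      simp [sweepMatrix, turnMatrix, ha', Matrix.one_apply]
    · have : ¬ S.next b = S.next a := fun h => hab (S.next.injective h).symm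
      simp [sweepMatrix, turnMatrix, ha', Matrix.one_apply, hab, this]
  have hdet : (S.sweepMatrix base * (1 - S.turnMatrix)).det = (1 - S.turnMatrix).det := by
    rw [Matrix.det_mul, S.det_sweepMatrix hb, one_mul]
  rw [← hdet, Matrix.det_eq_prod_diag_of_key _ (fun d => S.angle (base (S.origin d)) d)]
  · have : ∀ a, (S.sweepMatrix base * (1 - S.turnMatrix)) a a =
        if a ∈ Finset.univ.image base then 2 else 1 := by
      intro a
      by_cases ha : ∃ v, base v = a
      · obtain ⟨v, rfl⟩ := ha
        rw [S.sweepMatrix_mul_base hb]; simp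
      · rw [hrow a ha]
        -- A fixed point of `S.next` would have a smallest angle of 2π, while its angle to the base
        -- edge is smaller.
        have hna : a ≠ S.next a := by
          intro hna
          apply ha
          refine ⟨S.origin a, ?_⟩
          by_contra hne
          have h1 := S.angle_next_le a (base (S.origin a)) (hb _)
          have h2 := S.angle_add_swap a (base (S.origin a)) (hb _).symm (Ne.symm hne)
          have h3 := S.angle_pos (base (S.origin a)) a
          rw [← hna, S.angle_self] at h1
          linarith
        simp only [Finset.mem_image, Finset.mem_univ, true_and, if_neg ha]
        simp [turnMatrix, hna]
    simp_rw [this]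
    rw [Finset.prod_ite]
    simp only [Finset.prod_const, one_pow, mul_one, Finset.filter_mem_eq_inter, Finset.univ_inter]
    rw [Finset.card_image_of_injective _ hinj, Finset.card_univ]
  · intro a c hac h
    by_cases ha : ∃ v, base v = a
    · obtain ⟨v, rfl⟩ := ha
      rw [S.sweepMatrix_mul_base hb, if_neg (Ne.symm hac)] at h
      exact absurd rfl h
    · rw [hrow a ha] at h
      have hc : c = S.next a := by
        by_contra hc
        simp [turnMatrix, hc, Matrix.one_apply_ne hac] at h
      subst hc
      rw [S.origin_next]
      have := S.angle_add_next (a := base (S.origin a)) (b := a) (hb _) (fun h => ha ⟨_, h⟩)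
      have := S.angle_pos a (S.next a)
      linarith

/-- For a unitary matrix R, 1 - R = -R(1 - R)ᴴ. The determinant 2^|V| of 1 - R is real and nonzero,
so it cancels, and the sign disappears in even dimension. -/
theorem det_turnMatrix [Fintype V] (hs : Function.Surjective S.origin)
    (hD : Even (Fintype.card D)) : S.turnMatrix.det = 1 := by
  choose base hb using hs
  have h1 := S.det_one_sub_turnMatrix hb
  have h2 : (1 - S.turnMatrix) = -(S.turnMatrix * (1 - S.turnMatrix)ᴴ) := by
    rw [Matrix.conjTranspose_sub, Matrix.mul_sub, S.turnMatrix_mul_conjTranspose]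
    simp
  have h3 := congrArg Matrix.det h2
  rw [Matrix.det_neg, hD.neg_one_pow, one_mul, Matrix.det_mul, Matrix.det_conjTranspose, h1] at h3
  simp only [star_pow, star_ofNat] at h3
  have h4 : (2 : ℂ) ^ Fintype.card V ≠ 0 := pow_ne_zero _ two_ne_zero
  exact (mul_right_cancel₀ h4 (by rw [one_mul]; exact h3)).symm

end AngularRotation

/-! ### Edge reversals and the algebraic form of duality -/

namespace ODart

variable {E : Type*}

@[simp] theorem rev_rev (d : ODart E) : d.rev.rev = d := by simp [rev]

@[simp] theorem rev_fst (d : ODart E) : d.rev.1 = d.1 := rfl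

theorem eq_or_eq_rev {d d' : ODart E} (h : d.1 = d'.1) : d = d' ∨ d = d'.rev := by
  obtain ⟨e, b⟩ := d
  obtain ⟨e', b'⟩ := d'
  cases b <;> cases b' <;> simp_all [rev]

end ODart

section FlipMatrix

variable {E : Type*} [Fintype E] [DecidableEq E]

/-- The matrix, indexed by the oriented edges, of the reversal with weights `u`. -/
def flipMatrix (u : ODart E → ℂ) : Matrix (ODart E) (ODart E) ℂ :=
  Matrix.of fun d d' => if d' = d.rev then u d else 0

/-- The diagonal matrix of the weights of the edges. -/
noncomputable def weightMatrix (x : E → ℂ) : Matrix (ODart E) (ODart E) ℂ :=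
  Matrix.diagonal fun d => x d.1

theorem flipMatrix_mul_apply (u : ODart E → ℂ) (M : Matrix (ODart E) (ODart E) ℂ)
    (d d' : ODart E) : (flipMatrix u * M) d d' = u d * M d.rev d' := by
  rw [Matrix.mul_apply, Finset.sum_eq_single d.rev]
  · simp [flipMatrix]
  · intro c _ hc
    simp [flipMatrix, hc]
  · simp

theorem flipMatrix_mul_self {u : ODart E → ℂ} (hu : ∀ d, u d * u d.rev = 1) :
    flipMatrix u * flipMatrix u = 1 := by
  ext d d'
  rw [flipMatrix_mul_apply]
  by_cases h : d' = d
  · subst h; simp [flipMatrix, hu]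
  · simp [flipMatrix, h, Matrix.one_apply_ne (Ne.symm h)]

theorem weightMatrix_mul_flipMatrix (x : E → ℂ) (u : ODart E → ℂ) :
    weightMatrix x * flipMatrix u = flipMatrix u * weightMatrix x := by
  ext d d'
  rw [flipMatrix_mul_apply, weightMatrix, Matrix.diagonal_mul]
  by_cases h : d' = d.rev
  · subst h; simp [flipMatrix, mul_comm]
  · simp [flipMatrix, h, Matrix.diagonal_apply_ne _ (Ne.symm h)]

/-- Each edge gives a two by two block with determinant 1 - i² = 2. -/
theorem det_one_add_flipMatrix {u : ODart E → ℂ} (hu : ∀ d, u d * u d.rev = 1) :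
    (1 + Complex.I • flipMatrix u).det = 2 ^ Fintype.card E := by
  have h : (1 + Complex.I • flipMatrix u) = (Matrix.blockDiagonal fun e : E =>
      (Matrix.of fun b b' : Bool => if b' = b then 1 else Complex.I * u (e, b))).submatrix
        (Equiv.prodComm E Bool) (Equiv.prodComm E Bool) := by
    ext ⟨e, b⟩ ⟨e', b'⟩
    by_cases he : e = e'
    · subst he
      cases b <;> cases b' <;>
        simp [flipMatrix, ODart.rev, Matrix.blockDiagonal_apply]
    · have he' : ¬ e' = e := fun h => he h.symm
      simp [flipMatrix, ODart.rev, Matrix.blockDiagonal_apply, he, he']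
  rw [h, Matrix.det_submatrix_equiv_self, Matrix.det_blockDiagonal]
  have : ∀ e : E, (Matrix.of fun b b' : Bool =>
      if b' = b then (1 : ℂ) else Complex.I * u (e, b)).det = 2 := by
    intro e
    rw [← Matrix.det_submatrix_equiv_self finTwoEquiv, Matrix.det_fin_two]
    have h1 : u (e, false) * u (e, true) = 1 := hu (e, false)
    simp only [finTwoEquiv, Matrix.submatrix_apply, Matrix.of_apply]
    simp
    linear_combination (-Complex.I ^ 2) * h1 - Complex.I_sq
  simp [this]

theorem det_one_add_weightMatrix (x : E → ℂ) :
    (1 + weightMatrix x).det = ∏ e, (1 + x e) ^ 2 := by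
  have : (1 + weightMatrix x) = Matrix.diagonal fun d : ODart E => 1 + x d.1 := by
    ext d d'
    rcases eq_or_ne d d' with rfl | h
    · simp [weightMatrix]
    · simp [weightMatrix, h]
  rw [this, Matrix.det_diagonal, Fintype.prod_prod_type]
  simp [sq]

/-- Multiplication by `1 - R` replaces `K` by -i(1 + R), and this -i cancels the factor i of `X`.
Only the sparse matrix `R` is left. -/
theorem det_cayley {n : Type*} [Fintype n] [DecidableEq n] {X J R K : Matrix n n ℂ}
    (hK : K * (1 - R) = -Complex.I • (1 + R)) :
    (1 + (Complex.I • X) * J * K).det * (1 - R).det = ((1 + X * J) - (1 - X * J) * R).det := by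
  rw [← Matrix.det_mul]
  congr 1
  rw [add_mul, Matrix.mul_assoc, hK]
  simp only [smul_mul_assoc, Matrix.mul_smul, smul_smul]
  simp
  noncomm_ring

/-- Because `J` commutes with `X` and squares to -1, the relation between the weights gives (1 +
X)(1 ± YJ) = (1 ± J)(1 ∓ XJ). Multiplying by `R` on the right turns `R'` into `J`, and (1 - J)J = 1
+ J makes the factor 1 + J common to both terms, whose roles are exchanged. -/
theorem det_dual {n : Type*} [Fintype n] [DecidableEq n] {X Y J R R' : Matrix n n ℂ}
    (hn : Even (Fintype.card n)) (hJ : J * J = -1) (hXJ : X * J = J * X)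
    (hXY : (1 + X) * Y = 1 - X) (hR : R.det = 1) (hR' : R' * R = J) :
    (1 + X).det * ((1 + Y * J) - (1 - Y * J) * R').det =
      (1 + J).det * ((1 + X * J) - (1 - X * J) * R).det := by
  have e1 : (1 + X) * (1 + Y * J) = (1 + J) * (1 - X * J) := by
    have : J * (X * J) = -X := by rw [← Matrix.mul_assoc, ← hXJ, Matrix.mul_assoc, hJ]; simp
    rw [mul_add, ← Matrix.mul_assoc, hXY, sub_mul, mul_sub, add_mul 1 J (X * J), this]
    noncomm_ring
  have e2 : (1 + X) * (1 - Y * J) = (1 - J) * (1 + X * J) := by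
    have : J * (X * J) = -X := by rw [← Matrix.mul_assoc, ← hXJ, Matrix.mul_assoc, hJ]; simp
    rw [mul_sub, ← Matrix.mul_assoc, hXY, sub_mul, mul_add, sub_mul 1 J (X * J), this]
    noncomm_ring
  have e3 : (1 - J) * (1 + X * J) * J = (1 + J) * (1 + X * J) := by
    have h1 : (1 - J) * (1 + X * J) * J = ((1 - J) * J) * (1 + X * J) := by
      have : (1 + X * J) * J = J * (1 + X * J) := by
        rw [add_mul, mul_add, hXJ, Matrix.mul_assoc, hXJ]; simp
      rw [Matrix.mul_assoc, this, Matrix.mul_assoc]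
    rw [h1, sub_mul, hJ]
    congr 1
    simp [add_comm]
  have key : (1 + X) * (((1 + Y * J) - (1 - Y * J) * R') * R) =
      -((1 + J) * ((1 + X * J) - (1 - X * J) * R)) := by
    calc _ = (1 + X) * (1 + Y * J) * R - (1 + X) * (1 - Y * J) * (R' * R) := by noncomm_ring
      _ = _ := by rw [hR', e1, e2, e3]; noncomm_ring
  have := congrArg Matrix.det key
  rwa [Matrix.det_neg, hn.neg_one_pow, one_mul, Matrix.det_mul, Matrix.det_mul, Matrix.det_mul, hR,
    mul_one] at this

/-- The duality of Kac-Ward determinants, for abstract rotation systems: the reversals and the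
turns of the dual system are obtained from those of the given one by a change of gauge. -/
theorem AngularRotation.kacWard_dual {V F : Type*} [Fintype V] [Fintype F]
    (S : AngularRotation (ODart E) V) (S' : AngularRotation (ODart E) F)
    (hS : Function.Surjective S.origin) (hS' : Function.Surjective S'.origin)
    (u u' g : ODart E → ℂ) (hg : ∀ d, g d ≠ 0) (hu : ∀ d, u d * u d.rev = 1)
    (hu' : ∀ d, g d * u' d = u d * g d.rev)
    (hnext : ∀ d, S'.next (S.next d).rev = d)
    (hangle : ∀ d, g (S.next d).rev *
        Complex.exp (Complex.I / 2 * (S'.angle (S.next d).rev d : ℂ)) *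
        Complex.exp (Complex.I / 2 * (S.angle d (S.next d) : ℂ)) =
      Complex.I * u (S.next d).rev * g d)
    (x y : E → ℂ) (hx : ∀ e, 1 + x e ≠ 0) (hxy : ∀ e, x e + y e + x e * y e = 1) :
    (2 : ℂ) ^ Fintype.card V * (∏ e, (1 + x e)⁻¹) *
        (1 - weightMatrix x * flipMatrix u * S.vertexMatrix).det =
      (2 : ℂ) ^ Fintype.card F * (∏ e, (1 + y e)⁻¹) *
        (1 - weightMatrix y * flipMatrix u' * S'.vertexMatrix).det := by
  have hn : Even (Fintype.card (ODart E)) := by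
    rw [Fintype.card_prod, Fintype.card_bool]; exact even_two.mul_left _
  set U := flipMatrix u with hU
  set U' := flipMatrix u'
  set X := weightMatrix x
  set Y := weightMatrix y
  set R := S.turnMatrix
  set R' := S'.turnMatrix
  set Gm : Matrix (ODart E) (ODart E) ℂ := Matrix.diagonal g
  set Gi : Matrix (ODart E) (ODart E) ℂ := Matrix.diagonal fun d => (g d)⁻¹
  have hGG : Gm * Gi = 1 := by
    rw [Matrix.diagonal_mul_diagonal, ← Matrix.diagonal_one]
    congr 1; ext d; exact mul_inv_cancel₀ (hg d)
  have hGG' : Gi * Gm = 1 := mul_eq_one_comm.mp hGG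
  have hUU' : Gm * U' * Gi = U := by
    ext d d'
    rw [Matrix.mul_diagonal, Matrix.diagonal_mul]
    by_cases h : d' = d.rev
    · subst h
      simp only [U', hU, flipMatrix, Matrix.of_apply, if_true, hu']
      rw [mul_assoc, mul_inv_cancel₀ (hg _), mul_one]
    · simp [U', hU, flipMatrix, h]
  have hYG : Y * Gm = Gm * Y := by
    simp only [Y, Gm, weightMatrix, Matrix.diagonal_mul_diagonal, mul_comm]
  -- Turn, reverse, then turn around the dual vertex: by `hnext` this returns to the same oriented
  -- edge, so both sides have the same support. `hangle` compares the entries.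
  have hRR' : (Gm * R' * Gi) * R = Complex.I • U := by
    ext a b
    obtain ⟨d, rfl⟩ := S.next.surjective b
    rw [S.mul_turnMatrix_apply, Matrix.mul_diagonal, Matrix.diagonal_mul, Matrix.smul_apply]
    by_cases h : a = (S.next d).rev
    · subst h
      have h1 : R' (S.next d).rev d =
          Complex.exp (Complex.I / 2 * (S'.angle (S.next d).rev d : ℂ)) := by
        simp only [R', AngularRotation.turnMatrix, Matrix.of_apply, hnext, if_true]
      have h2 : U (S.next d).rev (S.next d) = u (S.next d).rev := by simp [hU, flipMatrix]
      rw [h1, h2, smul_eq_mul]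
      have := hangle d
      calc _ = (g d)⁻¹ * (g (S.next d).rev *
        Complex.exp (Complex.I / 2 * (S'.angle (S.next d).rev d : ℂ)) *
        Complex.exp (Complex.I / 2 * (S.angle d (S.next d) : ℂ))) := by ring
        _ = _ := by rw [this]; field_simp [hg d]
    · have h1 : ¬ d = S'.next a := by
        intro h1
        rw [← hnext d] at h1
        exact h (S'.next.injective h1).symm
      have h2 : ¬ S.next d = a.rev := fun h2 => h (by rw [h2, ODart.rev_rev])
      simp [R', hU, AngularRotation.turnMatrix, flipMatrix, h1, h2]
  have hUsq := flipMatrix_mul_self hu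
  have hJ : (Complex.I • U) * (Complex.I • U) = -1 := by
    rw [smul_mul_smul_comm, hUsq, Complex.I_mul_I]; simp
  have hXJ : X * (Complex.I • U) = (Complex.I • U) * X := by
    rw [Matrix.mul_smul, Matrix.smul_mul, weightMatrix_mul_flipMatrix]
  have hXY : (1 + X) * Y = 1 - X := by
    have : X * Y = Matrix.diagonal fun d : ODart E => x d.1 * y d.1 := by
      simp only [X, Y, weightMatrix, Matrix.diagonal_mul_diagonal]
    rw [add_mul, one_mul, this]
    ext a b
    rcases eq_or_ne a b with rfl | hab
    · simp [X, Y, weightMatrix]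
      linear_combination hxy a.1
    · simp [X, Y, weightMatrix, hab]
  obtain ⟨base, hb⟩ := hS.hasRightInverse
  obtain ⟨base', hb'⟩ := hS'.hasRightInverse
  have hdet := det_dual hn hJ hXJ hXY (S.det_turnMatrix hS hn) hRR'
  have c1 := det_cayley (X := X) (J := Complex.I • U) S.vertexMatrix_mul
  have c2 := det_cayley (X := Y) (J := Complex.I • U') S'.vertexMatrix_mul
  rw [S.det_one_sub_turnMatrix hb] at c1
  rw [S'.det_one_sub_turnMatrix hb'] at c2
  have hI : ∀ (Z W K : Matrix (ODart E) (ODart E) ℂ),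
      1 + (Complex.I • Z) * (Complex.I • W) * K = 1 - Z * W * K := by
    intro Z W K
    rw [smul_mul_smul_comm, Complex.I_mul_I, neg_one_smul, neg_mul, ← sub_eq_add_neg]
  rw [hI] at c1 c2
  -- Conjugation by the diagonal gauge matrix preserves the determinant, and it commutes with the
  -- weights.
  have hconj : ((1 + Y * (Complex.I • U)) - (1 - Y * (Complex.I • U)) * (Gm * R' * Gi)).det =
      ((1 + Y * (Complex.I • U')) - (1 - Y * (Complex.I • U')) * R').det := by
    have e : (1 + Y * (Complex.I • U)) - (1 - Y * (Complex.I • U)) * (Gm * R' * Gi) =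
        Gm * ((1 + Y * (Complex.I • U')) - (1 - Y * (Complex.I • U')) * R') * Gi := by
      have e1 : Y * U = Gm * (Y * U') * Gi := by
        rw [← hUU', Matrix.mul_assoc Gm U' Gi, ← Matrix.mul_assoc, hYG]
        simp only [Matrix.mul_assoc]
      have e2 : Y * U * (Gm * R' * Gi) = Gm * (Y * U' * R') * Gi := by
        rw [e1]
        simp only [Matrix.mul_assoc]
        rw [← Matrix.mul_assoc Gi Gm, hGG', Matrix.one_mul]
      simp only [Matrix.mul_smul, sub_mul, one_mul, smul_mul_assoc, mul_add, mul_sub, add_mul,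
        mul_one, hGG, e2]
      rw [e1]
    rw [e, Matrix.det_mul, Matrix.det_mul, mul_right_comm, ← Matrix.det_mul, hGG, Matrix.det_one,
      one_mul]
  rw [hconj, det_one_add_flipMatrix hu, det_one_add_weightMatrix, ← c1, ← c2] at hdet
  -- The relation between dual weights is (1 + x)(1 + y) = 2.
  have hy : ∀ e, (1 + y e)⁻¹ = (1 + x e) / 2 := by
    intro e
    have h : (1 + y e) * (1 + x e) = 2 := by linear_combination hxy e
    have h0 : 1 + y e ≠ 0 := by
      intro h0; rw [h0, zero_mul] at h; exact two_ne_zero h.symm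
    field_simp
    linear_combination -h
  have hP : (∏ e, (1 + x e)) ≠ 0 := Finset.prod_ne_zero_iff.mpr fun e _ => hx e
  simp_rw [hy]
  rw [Finset.prod_div_distrib, Finset.prod_const, Finset.card_univ, Finset.prod_inv_distrib]
  rw [Finset.prod_pow] at hdet
  have h2 : (2 : ℂ) ^ Fintype.card E ≠ 0 := pow_ne_zero _ two_ne_zero
  field_simp
  linear_combination -hdet

end FlipMatrix

end Matrices

/-! ### Polygonal paths and the rotation of simple closed polygons -/

section Topology

open Set Filter Topology

/-- Continuous maps to the punctured plane have continuous arguments on simply connected,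
locally path connected sets. -/
theorem exists_continuousOn_angle {X : Type*} [TopologicalSpace X] {s : Set X}
    [SimplyConnectedSpace s] [LocallyPathConnectedSpace s] {f : X → ℂ} (hf : ContinuousOn f s)
    (h0 : ∀ x ∈ s, f x ≠ 0) :
    ∃ θ : X → ℝ, ContinuousOn θ s ∧ ∀ x ∈ s, (θ x : Real.Angle) = (f x).arg := by
  classical
  have hc : Continuous fun x : s => ((f x).arg : Real.Angle) := by
    rw [continuous_iff_continuousAt]
    intro x
    exact ContinuousAt.comp (f := fun x : s => f x) (Complex.continuousAt_arg_coe_angle (h0 x x.2))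
      (continuousOn_iff_continuous_domRestrict.mp hf).continuousAt
  obtain ⟨x₀⟩ : Nonempty s := inferInstance
  obtain ⟨θ, ⟨-, hθ⟩, -⟩ := (AddCircle.isCoveringMap_coe (2 * Real.pi)).existsUnique_continuousMap_lifts
    ⟨_, hc⟩ x₀ (f x₀).arg rfl
  refine ⟨fun x => if h : x ∈ s then θ ⟨x, h⟩ else 0, ?_, ?_⟩
  · rw [continuousOn_iff_continuous_domRestrict]
    have : s.domRestrict (fun x => if h : x ∈ s then θ ⟨x, h⟩ else 0) = θ := by
      ext x; simp [Set.domRestrict]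
    rw [this]
    exact θ.continuous
  · intro x hx
    simp only [hx, dif_pos]
    exact congrFun hθ ⟨x, hx⟩

/-- Values with the same angle differ by multiples of 2π, and a continuous function cannot jump
between them. This turns congruences modulo 2π into equalities. -/
theorem IsPreconnected.eq_of_coe_angle_eq {X : Type*} [TopologicalSpace X] {s : Set X}
    (hs : IsPreconnected s) {g : X → ℝ} (hg : ContinuousOn g s)
    (h : ∀ a ∈ s, ∀ b ∈ s, (g a : Real.Angle) = g b) {a b : X} (ha : a ∈ s) (hb : b ∈ s) :
    g a = g b :=
  (AddCircle.isCoveringMap_coe (2 * Real.pi)).constOn_of_comp hs hg h ha hb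

/-- If the quotient were a negative real number, the second segment would run straight back over the
first. The turning angle is therefore never π. -/
theorem div_mem_slitPlane_of_lineMap_ne {a b c : ℂ} (hab : a ≠ b) (hbc : b ≠ c)
    (h : ∀ t ∈ Ioo (0 : ℝ) 1, ∀ t' ∈ Ioo (0 : ℝ) 1,
      AffineMap.lineMap a b t ≠ AffineMap.lineMap b c t') :
    (c - b) / (b - a) ∈ Complex.slitPlane := by
  by_contra hcon
  rw [Complex.mem_slitPlane_iff, not_or, not_lt, not_not] at hcon
  set q := (c - b) / (b - a) with hq
  have hba : b - a ≠ 0 := sub_ne_zero.mpr hab.symm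
  have hcb : c - b = q * (b - a) := by rw [hq]; field_simp
  have hqr : q = ((q.re : ℝ) : ℂ) := by
    apply Complex.ext <;> simp [hcon.2]
  have hq0 : q.re ≠ 0 := by
    intro h0
    rw [h0] at hqr
    rw [hqr] at hcb
    simp at hcb
    exact hbc (sub_eq_zero.mp hcb).symm
  set r := -q.re with hr
  have hr0 : 0 < r := by
    rcases lt_or_eq_of_le hcon.1 with h | h
    · linarith
    · exact absurd h hq0
  -- If `c - b = -r * (b - a)`, the points at the same parameter `t` of the two segments coincide
  -- when `t - 1 = -r * t`.
  have hmem : 1 / (1 + r) ∈ Ioo (0 : ℝ) 1 := by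
    refine ⟨by positivity, ?_⟩
    rw [div_lt_one (by positivity)]; linarith
  apply h _ hmem _ hmem
  rw [AffineMap.lineMap_apply_module', AffineMap.lineMap_apply_module', hcb, hqr,
    show q.re = -r by simp [hr]]
  have : ((1 + r : ℝ) : ℂ) ≠ 0 := by exact_mod_cast (by positivity : (1 + r) ≠ 0)
  simp only [Complex.real_smul]
  push_cast at this ⊢
  field_simp
  ring

/-- The polygonal path with successive corners `z 0, z 1, …`, each segment being traversed in
unit time. -/
noncomputable def polyline (z : ℕ → ℂ) (s : ℝ) : ℂ :=
  AffineMap.lineMap (z ⌊s⌋₊) (z (⌊s⌋₊ + 1)) (s - ⌊s⌋₊)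

theorem polyline_eq (z : ℕ → ℂ) {k : ℕ} {s : ℝ} (h : s ∈ Icc (k : ℝ) (k + 1)) :
    polyline z s = AffineMap.lineMap (z k) (z (k + 1)) (s - k) := by
  rcases eq_or_lt_of_le h.2 with h2 | h2
  · have : ⌊s⌋₊ = k + 1 := by rw [h2]; exact_mod_cast Nat.floor_natCast (R := ℝ) (k + 1)
    rw [polyline, this, h2]
    push_cast
    simp
  · have : ⌊s⌋₊ = k := (Nat.floor_eq_iff (le_trans (Nat.cast_nonneg k) h.1)).mpr ⟨h.1, h2⟩
    rw [polyline, this]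

theorem polyline_add (z : ℕ → ℂ) (k : ℕ) {t : ℝ} (h : t ∈ Icc (0 : ℝ) 1) :
    polyline z (k + t) = AffineMap.lineMap (z k) (z (k + 1)) t := by
  rw [polyline_eq z (k := k) ⟨by linarith [h.1], by linarith [h.2]⟩]
  congr 1; ring

@[simp] theorem polyline_natCast (z : ℕ → ℂ) (k : ℕ) : polyline z k = z k := by
  have := polyline_add z k (t := 0) (by simp)
  simpa using this

theorem exists_eq_natCast_add {s : ℝ} (hs : 0 ≤ s) : ∃ (k : ℕ) (t : ℝ), t ∈ Ico (0 : ℝ) 1 ∧ s = k + t :=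
  ⟨⌊s⌋₊, s - ⌊s⌋₊, ⟨sub_nonneg.mpr (Nat.floor_le hs), by linarith [Nat.lt_floor_add_one s]⟩, by ring⟩

theorem exists_eq_natCast_add_of_lt {n : ℕ} {s : ℝ} (hs : 0 ≤ s) (hn : s < n) :
    ∃ k < n, ∃ t ∈ Ico (0 : ℝ) 1, s = k + t := by
  obtain ⟨k, t, ht, rfl⟩ := exists_eq_natCast_add hs
  refine ⟨k, ?_, t, ht, rfl⟩
  have : (k : ℝ) < n := by linarith [ht.1]
  exact_mod_cast this

theorem exists_eq_natCast_add_of_le {n : ℕ} (hn : 0 < n) {s : ℝ} (hs : 0 ≤ s) (h : s ≤ n) :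
    ∃ k < n, ∃ t ∈ Icc (0 : ℝ) 1, s = k + t := by
  rcases eq_or_lt_of_le h with h | h
  · refine ⟨n - 1, by omega, 1, by simp, ?_⟩
    rw [h, Nat.cast_sub hn]; simp
  · obtain ⟨k, hk, t, ht, h⟩ := exists_eq_natCast_add_of_lt hs h
    exact ⟨k, hk, t, ⟨ht.1, ht.2.le⟩, h⟩

/-- The definition uses the integer part, whose jumps hide the continuity. On a bounded interval the
path is also a sum of clamped ramps, one for each segment, and this form is visibly continuous. -/
theorem continuousOn_polyline (z : ℕ → ℂ) : ContinuousOn (polyline z) (Ici 0) := by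
  have key : ∀ (N : ℕ) (s : ℝ), 0 ≤ s → s ≤ N → polyline z s =
      z 0 + ∑ j ∈ Finset.range N, (max 0 (min 1 (s - j)) : ℝ) • (z (j + 1) - z j) := by
    intro N s hs hN
    have h1 : ∀ k : ℕ, (k : ℝ) ≤ s →
        z 0 + ∑ j ∈ Finset.range k, (max 0 (min 1 (s - j)) : ℝ) • (z (j + 1) - z j) = z k := by
      intro k
      induction k with
      | zero => simp
      | succ k ih =>
        intro hk
        push_cast at hk
        rw [Finset.sum_range_succ, ← add_assoc, ih (by linarith), min_eq_left (by linarith),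
          max_eq_right zero_le_one]
        simp
    have h2 : ∀ m k : ℕ, s ≤ k →
        ∑ j ∈ Finset.range (k + m), (max 0 (min 1 (s - j)) : ℝ) • (z (j + 1) - z j) =
        ∑ j ∈ Finset.range k, (max 0 (min 1 (s - j)) : ℝ) • (z (j + 1) - z j) := by
      intro m k hk
      induction m with
      | zero => rfl
      | succ m ih =>
        have : s - ((k + m : ℕ) : ℝ) ≤ 0 := by
          push_cast; linarith [Nat.cast_nonneg (α := ℝ) m]
        rw [← add_assoc, Finset.sum_range_succ, ih, max_eq_left (min_le_of_right_le this)]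
        simp
    rcases Nat.eq_zero_or_pos N with rfl | hN0
    · have : s = 0 := le_antisymm (by simpa using hN) hs
      subst this
      simpa using polyline_natCast z 0
    obtain ⟨k, hk, t, ht, rfl⟩ := exists_eq_natCast_add_of_le hN0 hs hN
    obtain ⟨m, rfl⟩ : ∃ m, N = k + 1 + m := ⟨N - (k + 1), by omega⟩
    rw [h2 m (k + 1) (by push_cast; linarith [ht.2]), Finset.sum_range_succ, ← add_assoc,
      h1 k (by linarith [ht.1]), polyline_add z k ht, AffineMap.lineMap_apply_module',
      show (k : ℝ) + t - k = t by ring, min_eq_right ht.2, max_eq_right ht.1, add_comm]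
  intro s hs
  obtain ⟨N, hN⟩ := exists_nat_gt s
  have hc : ContinuousAt (fun s : ℝ => z 0 + ∑ j ∈ Finset.range N,
      (max 0 (min 1 (s - j)) : ℝ) • (z (j + 1) - z j)) s := by fun_prop
  refine hc.continuousWithinAt.congr_of_eventuallyEq ?_ (key N s hs hN.le)
  filter_upwards [self_mem_nhdsWithin, mem_nhdsWithin_of_mem_nhds (Iio_mem_nhds hN)] with t ht ht'
  exact key N t ht (le_of_lt ht')

theorem polyline_add_period {z : ℕ → ℂ} {n : ℕ} (h : ∀ k, z (k + n) = z k) {s : ℝ} (hs : 0 ≤ s) :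
    polyline z (s + n) = polyline z s := by
  obtain ⟨k, t, ht, rfl⟩ := exists_eq_natCast_add hs
  have ht' := Ico_subset_Icc_self ht
  rw [polyline_add z k ht', show (k : ℝ) + t + n = ((k + n : ℕ) : ℝ) + t by push_cast; ring,
    polyline_add z _ ht', h, show k + n + 1 = k + 1 + n by ring, h]

theorem polyline_ne_of_injOn {z : ℕ → ℂ} {n : ℕ} (hn : 0 < n) (hper : ∀ k, z (k + n) = z k)
    (hinj : InjOn (polyline z) (Ico 0 n)) {s t : ℝ} (hs : 0 ≤ s) (hst : s < t) (ht : t < s + n) :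
    polyline z t ≠ polyline z s := by
  have hred : ∀ m : ℕ, ∀ s : ℝ, 0 ≤ s → polyline z (s + m * n) = polyline z s := by
    intro m
    induction m with
    | zero => simp
    | succ m ih =>
      intro s hs
      have : s + ((m + 1 : ℕ) : ℝ) * n = (s + m * n) + n := by push_cast; ring
      rw [this, polyline_add_period hper (by positivity), ih s hs]
  have hn' : (0 : ℝ) < n := by exact_mod_cast hn
  have hdec : ∀ s : ℝ, 0 ≤ s → ∃ m : ℕ, ∃ s' ∈ Ico (0 : ℝ) n, s = s' + m * n := by
    intro s hs
    obtain ⟨k, t, ht, h⟩ := exists_eq_natCast_add (div_nonneg hs hn'.le)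
    refine ⟨k, t * n, ⟨mul_nonneg ht.1 hn'.le, ?_⟩, ?_⟩
    · nlinarith [ht.2]
    · field_simp at h; linarith
  obtain ⟨m, s', hs', rfl⟩ := hdec s hs
  obtain ⟨m', t', ht', rfl⟩ := hdec t (hs.trans hst.le)
  rw [hred m _ hs'.1, hred m' _ ht'.1]
  intro h
  have := hinj ht' hs' h
  subst this
  have h1 : (m : ℝ) < m' := by
    by_contra hc
    have := not_lt.mp hc
    nlinarith
  have h2 : (m' : ℝ) < m + 1 := by
    by_contra hc
    have := not_lt.mp hc
    nlinarith
  have h1' : m < m' := by exact_mod_cast h1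
  have h2' : m' < m + 1 := by exact_mod_cast h2
  omega

/-- A chord across one corner is a nonnegative combination of the two adjacent directions. Relative
to the first direction it thus avoids the cut of the argument. -/
theorem smul_add_smul_slitPlane {q : ℂ} (hq : q ∈ Complex.slitPlane) {a b : ℝ} (ha : 0 ≤ a)
    (hb : 0 ≤ b) (hab : 0 < a + b) : (a : ℂ) + b * q ∈ Complex.slitPlane := by
  rw [Complex.mem_slitPlane_iff] at hq ⊢
  simp only [Complex.add_re, Complex.ofReal_re, Complex.mul_re, Complex.ofReal_im, zero_mul,
    sub_zero, Complex.add_im, Complex.mul_im, zero_add, add_zero]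
  rcases eq_or_lt_of_le hb with rfl | hb
  · left; simpa using hab
  · rcases hq with hq | hq
    · left; positivity
    · right; exact mul_ne_zero hb.ne' hq

/-- The parity of the rotation number of a simple closed polygon: its total rotation is an odd
multiple of `2π`. -/
theorem rotation_closed_polygon {z : ℕ → ℂ} {n : ℕ} (hn : 0 < n) (hper : ∀ k, z (k + n) = z k)
    (hinj : InjOn (polyline z) (Ico 0 n)) :
    ∃ m : ℤ, ∑ k ∈ Finset.range n, Complex.arg ((z (k + 2) - z (k + 1)) / (z (k + 1) - z k)) =
      2 * Real.pi * (2 * m + 1) := by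
  have hne := @polyline_ne_of_injOn z n hn hper hinj
  have hn' : (1 : ℝ) ≤ n := by exact_mod_cast hn
  -- Following Hopf, consider the direction of the secant from parameter `s` to parameter `t` over
  -- the strip 0 < s < t < s + n. There it never vanishes, and the strip is convex, so its angle has
  -- a continuous choice.
  set D : Set (ℝ × ℝ) := {p | 0 < p.1 ∧ p.1 < p.2 ∧ p.2 < p.1 + n} with hD
  have hDopen : IsOpen D := by
    refine (isOpen_lt continuous_const continuous_fst).inter
      ((isOpen_lt continuous_fst continuous_snd).inter
      (isOpen_lt continuous_snd (continuous_fst.add continuous_const)))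
  have hDconv : Convex ℝ D := by
    rintro ⟨a, b⟩ ⟨h1, h2, h3⟩ ⟨c, d⟩ ⟨h4, h5, h6⟩ u v hu hv huv
    simp only [hD, Set.mem_ofPred_eq, Prod.smul_mk, Prod.mk_add_mk, smul_eq_mul] at *
    rcases eq_or_lt_of_le hu with rfl | hu
    · have : v = 1 := by linarith
      subst this
      refine ⟨?_, ?_, ?_⟩ <;> linarith
    · refine ⟨by positivity, ?_, ?_⟩ <;> nlinarith
  have : LocallyPathConnectedSpace D := hDopen.locallyPathConnectedSpace
  have : ContractibleSpace D := hDconv.contractibleSpace ⟨(1, 3 / 2), by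
    simp only [hD, Set.mem_ofPred_eq]; refine ⟨?_, ?_, ?_⟩ <;> linarith⟩
  have hcont : ContinuousOn (fun p : ℝ × ℝ => polyline z p.2 - polyline z p.1) D := by
    refine ContinuousOn.sub ?_ ?_
    · exact (continuousOn_polyline z).comp continuousOn_snd fun p hp => (hp.1.trans hp.2.1).le
    · exact (continuousOn_polyline z).comp continuousOn_fst fun p hp => hp.1.le
  obtain ⟨θ, hθc, hθ⟩ := exists_continuousOn_angle hcont fun p hp =>
    sub_ne_zero.mpr (hne hp.1.le hp.2.1 hp.2.2)
  -- the angle changes by an odd multiple of `π` under the symmetry of the domain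
  have hswapD : ∀ p ∈ D, ((p.2, p.1 + n) : ℝ × ℝ) ∈ D := by
    rintro ⟨a, b⟩ ⟨h1, h2, h3⟩
    exact ⟨h1.trans h2, h3, by simpa using h2⟩
  have hswap : ∀ p ∈ D, ((θ (p.2, p.1 + n) - θ p : ℝ) : Real.Angle) = Real.pi := by
    intro p hp
    rw [Real.Angle.coe_sub, hθ _ hp, hθ _ (hswapD p hp)]
    simp only
    rw [polyline_add_period hper hp.1.le, ← neg_sub (polyline z p.2) (polyline z p.1),
      Complex.arg_neg_coe_angle
      (sub_ne_zero.mpr (hne hp.1.le hp.2.1 hp.2.2))]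
    simp
  have hconst : ∀ p ∈ D, ∀ q ∈ D, θ (p.2, p.1 + n) - θ p = θ (q.2, q.1 + n) - θ q := by
    intro p hp q hq
    refine hDconv.isPreconnected.eq_of_coe_angle_eq
      (g := fun p : ℝ × ℝ => θ (p.2, p.1 + n) - θ p) ?_ (fun a ha b hb => ?_) hp hq
    · refine ContinuousOn.sub (hθc.comp (by fun_prop) hswapD) hθc
    · rw [hswap a ha, hswap b hb]
  have hp1 : ((1, 3 / 2) : ℝ × ℝ) ∈ D := by
    simp only [hD, Set.mem_ofPred_eq]; refine ⟨?_, ?_, ?_⟩ <;> linarith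
  -- the angle along the diagonal
  have hdiag : ∀ s : ℝ, 0 < s → ((s, s + 1 / 2) : ℝ × ℝ) ∈ D := by
    intro s hs
    refine ⟨hs, by simp, ?_⟩
    show s + 1 / 2 < s + n
    linarith
  -- With the offset 1/2 both ends of the secant lie on two successive segments. Its angle relative
  -- to the first segment stays in the range of the principal argument, and changes exactly by the
  -- turning angle.
  have hstep : ∀ k : ℕ, 0 < k → θ ((k : ℝ) + 1, (k : ℝ) + 1 + 1 / 2) - θ (k, (k : ℝ) + 1 / 2) =
      Complex.arg ((z (k + 2) - z (k + 1)) / (z (k + 1) - z k)) := by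
    intro k hk
    have hk' : (0 : ℝ) < k := by exact_mod_cast hk
    have hw : ∀ j : ℕ, z j ≠ z (j + 1) := by
      intro j
      have hj : (0 : ℝ) ≤ j := Nat.cast_nonneg j
      have hne1 : ∀ t ∈ Ioo (0 : ℝ) 1, polyline z (j + t) ≠ polyline z j := fun t ht =>
        hne hj (by linarith [ht.1]) (by linarith [ht.2])
      intro h
      apply hne1 (1 / 2) (by norm_num)
      rw [polyline_add z j (by norm_num), polyline_natCast, ← h]
      simp
    set q := (z (k + 2) - z (k + 1)) / (z (k + 1) - z k) with hq
    have hq_mem : q ∈ Complex.slitPlane := by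
      apply div_mem_slitPlane_of_lineMap_ne (hw _) (hw _)
      intro t ht t' ht' h
      rw [← polyline_add z k (Ioo_subset_Icc_self ht),
        ← polyline_add z (k + 1) (Ioo_subset_Icc_self ht')] at h
      have hkt : (0 : ℝ) ≤ k + t := by linarith [ht.1]
      by_cases hc : t' < t ∨ 2 ≤ n
      · refine hne hkt ?_ ?_ h.symm
        · push_cast; linarith [ht.2, ht'.1]
        · push_cast
          rcases hc with hc | hc
          · linarith
          · have : (2 : ℝ) ≤ n := by exact_mod_cast hc
            linarith [ht.1, ht'.2]
      -- A polygon with one side would have a side of length zero.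
      · push Not at hc
        have hn1 : n = 1 := by omega
        exact hw k (by have := hper k; rw [hn1] at this; exact this.symm)
    have hwk : z (k + 1) - z k ≠ 0 := sub_ne_zero.mpr (hw k).symm
    -- the difference quotient along this corner
    have hval : ∀ u ∈ Icc (0 : ℝ) 1, ∃ a b : ℝ, 0 ≤ a ∧ 0 ≤ b ∧ 0 < a + b ∧
        (polyline z (k + u + 1 / 2) - polyline z (k + u)) = ((a : ℂ) + b * q) * (z (k + 1) - z k) := by
      intro u hu
      have e2 : z (k + 2) - z (k + 1) = q * (z (k + 1) - z k) := by rw [hq]; field_simp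
      rcases le_total u (1 / 2) with hu2 | hu2
      · refine ⟨1 / 2, 0, by norm_num, le_rfl, by norm_num, ?_⟩
        rw [add_assoc, polyline_add z k ⟨by linarith [hu.1], by linarith⟩, polyline_add z k hu,
          AffineMap.lineMap_apply_module', AffineMap.lineMap_apply_module']
        simp only [Complex.real_smul]
        push_cast
        ring
      · refine ⟨1 - u, u - 1 / 2, by linarith [hu.2], by linarith, by linarith, ?_⟩
        rw [show (k : ℝ) + u + 1 / 2 = ((k + 1 : ℕ) : ℝ) + (u - 1 / 2) by push_cast; ring,
          polyline_add z (k + 1) ⟨by linarith, by linarith [hu.2]⟩, polyline_add z k hu,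
          AffineMap.lineMap_apply_module', AffineMap.lineMap_apply_module', e2]
        simp only [Complex.real_smul]
        push_cast
        ring
    have hsl : ∀ u ∈ Icc (0 : ℝ) 1,
        (polyline z (k + u + 1 / 2) - polyline z (k + u)) / (z (k + 1) - z k) ∈
          Complex.slitPlane := by
      intro u hu
      obtain ⟨a, b, ha, hb, hab, h⟩ := hval u hu
      rw [h, mul_div_cancel_right₀ _ hwk]
      exact smul_add_smul_slitPlane hq_mem ha hb hab
    have hmap : MapsTo (fun u : ℝ => (((k : ℝ) + u, (k : ℝ) + u + 1 / 2) : ℝ × ℝ)) (Icc 0 1) D :=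
      fun u hu => hdiag _ (by linarith [hu.1])
    have hg : ContinuousOn (fun u : ℝ => θ ((k : ℝ) + u, (k : ℝ) + u + 1 / 2) -
        Complex.arg ((polyline z (k + u + 1 / 2) - polyline z (k + u)) / (z (k + 1) - z k)))
        (Icc 0 1) := by
      refine ContinuousOn.sub (hθc.comp (by fun_prop) hmap) ?_
      refine Complex.continuousOn_arg.comp ?_ hsl
      refine ContinuousOn.div_const ?_ _
      exact hcont.comp (f := fun u : ℝ => (((k : ℝ) + u, (k : ℝ) + u + 1 / 2) : ℝ × ℝ))
        (by fun_prop) hmap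
    have hcoe : ∀ u ∈ Icc (0 : ℝ) 1, ((θ ((k : ℝ) + u, (k : ℝ) + u + 1 / 2) -
        Complex.arg ((polyline z (k + u + 1 / 2) - polyline z (k + u)) / (z (k + 1) - z k)) : ℝ) :
          Real.Angle) = (z (k + 1) - z k).arg := by
      intro u hu
      have h1 := hmap hu
      rw [Real.Angle.coe_sub, hθ _ h1, Complex.arg_div_coe_angle _ hwk]
      · simp
      · exact sub_ne_zero.mpr (hne h1.1.le h1.2.1 h1.2.2)
    have := isPreconnected_Icc.eq_of_coe_angle_eq hg
      (fun a ha b hb => by rw [hcoe a ha, hcoe b hb])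
      (left_mem_Icc.mpr zero_le_one) (right_mem_Icc.mpr zero_le_one)
    have v0 : (polyline z (k + 0 + 1 / 2) - polyline z (k + 0)) / (z (k + 1) - z k) =
        ((1 / 2 : ℝ) : ℂ) := by
      rw [add_zero, polyline_add z k (by norm_num), polyline_natCast,
        AffineMap.lineMap_apply_module', Complex.real_smul]
      field_simp
      ring
    have v1 : (polyline z (k + 1 + 1 / 2) - polyline z (k + 1)) / (z (k + 1) - z k) =
        ((1 / 2 : ℝ) : ℂ) * q := by
      rw [show (k : ℝ) + 1 = ((k + 1 : ℕ) : ℝ) by push_cast; ring,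
        polyline_add z _ (by norm_num), polyline_natCast,
        AffineMap.lineMap_apply_module', Complex.real_smul, hq]
      field_simp
      ring
    rw [v0, v1, Complex.arg_real_mul _ (by norm_num), Complex.arg_ofReal_of_nonneg (by norm_num)]
      at this
    rw [add_zero] at this
    linarith
  -- The strip excludes the parameter 0, so the sum starts at the corner with index 1 and is shifted
  -- back by periodicity.
  have hsum : ∑ k ∈ Finset.range n, Complex.arg ((z (k + 2) - z (k + 1)) / (z (k + 1) - z k)) =
      θ ((1 : ℝ) + n, (1 : ℝ) + n + 1 / 2) - θ (1, 1 + 1 / 2) := by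
    have h1 : ∀ m : ℕ, ∑ k ∈ Finset.range m,
        Complex.arg ((z (k + 1 + 2) - z (k + 1 + 1)) / (z (k + 1 + 1) - z (k + 1))) =
        θ ((1 : ℝ) + m, (1 : ℝ) + m + 1 / 2) - θ (1, 1 + 1 / 2) := by
      intro m
      induction m with
      | zero => simp
      | succ m ih =>
        rw [Finset.sum_range_succ, ih, ← hstep (m + 1) (Nat.succ_pos m)]
        push_cast
        rw [show (m : ℝ) + 1 + 1 = 1 + (m + 1) by ring, show (m : ℝ) + 1 = 1 + m by ring]
        ring
    rw [← h1 n]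
    have h2 := Finset.sum_range_succ' (fun k => Complex.arg ((z (k + 2) - z (k + 1)) /
      (z (k + 1) - z k))) n
    rw [Finset.sum_range_succ] at h2
    rw [show n + 2 = 2 + n by ring, hper, show n + 1 = 1 + n by ring, hper,
      show z n = z 0 by simpa using hper 0] at h2
    simpa using h2
  -- Applying the symmetry of the strip twice translates both parameters by `n`. Each application
  -- changes the angle by the same amount π + 2πm, so the total is twice an odd multiple of π.
  obtain ⟨m, hm⟩ := Real.Angle.angle_eq_iff_two_pi_dvd_sub.mp (hswap _ hp1)
  refine ⟨m, ?_⟩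
  have h1 := hconst _ hp1 _ (hswapD _ hp1)
  rw [hsum]
  simp only at h1 hm
  rw [show (3 / 2 : ℝ) + n = 1 + n + 1 / 2 by ring] at h1
  rw [show (1 : ℝ) + 1 / 2 = 3 / 2 by norm_num]
  linarith

theorem polyline_congr {z w : ℕ → ℂ} {n : ℕ} (hn : 0 < n) (h : ∀ k ≤ n, z k = w k) {s : ℝ}
    (hs : s ∈ Icc (0 : ℝ) n) : polyline z s = polyline w s := by
  obtain ⟨k, hk, t, ht, rfl⟩ := exists_eq_natCast_add_of_le hn hs.1 hs.2
  rw [polyline_add z k ht, polyline_add w k ht, h k hk.le, h (k + 1) hk]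

theorem polyline_reverse {z w : ℕ → ℂ} {n : ℕ} (hn : 0 < n) (h : ∀ k ≤ n, w k = z (n - k)) {s : ℝ}
    (hs : s ∈ Icc (0 : ℝ) n) : polyline w s = polyline z (n - s) := by
  obtain ⟨k, hk, t, ht, rfl⟩ := exists_eq_natCast_add_of_le hn hs.1 hs.2
  have e : (n : ℝ) - (k + t) = ((n - (k + 1) : ℕ) : ℝ) + (1 - t) := by
    rw [Nat.cast_sub (by omega)]; push_cast; ring
  rw [e, polyline_add w k ht, polyline_add z _ ⟨by linarith [ht.2], by linarith [ht.1]⟩, h k hk.le,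
    h (k + 1) hk, show n - (k + 1) + 1 = n - k by omega, AffineMap.lineMap_apply_one_sub]

/-! ### Oriented edges as parametrized paths -/

namespace TorusGraph

variable {Λ : Submodule ℤ ℂ} {V E : Type*} (G : TorusGraph Λ V E)

@[simp] theorem origin_rev (d : ODart E) : G.origin d.rev = G.terminus d := by
  rcases d with ⟨e, b⟩; cases b <;> simp [origin, terminus, ODart.rev]

@[simp] theorem terminus_rev (d : ODart E) : G.terminus d.rev = G.origin d := by
  rcases d with ⟨e, b⟩; cases b <;> simp [origin, terminus, ODart.rev]

theorem dartCorner_rev (d : ODart E) {k : ℕ} (hk : k ≤ G.len d.1) :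
    G.dartCorner d.rev k = G.dartCorner d (G.len d.1 - k) := by
  rcases d with ⟨e, b⟩
  cases b
  · simp only [dartCorner, ODart.rev] at *
    rw [Nat.sub_sub_self hk]; simp
  · simp [dartCorner, ODart.rev]

/-- The path along an oriented edge, each segment being traversed in unit time. -/
noncomputable def dartPath (d : ODart E) (s : ℝ) : ℂ := polyline (G.dartCorner d) s

theorem dartPath_rev (d : ODart E) {s : ℝ} (hs : s ∈ Icc (0 : ℝ) (G.len d.1)) :
    G.dartPath d.rev s = G.dartPath d (G.len d.1 - s) :=
  polyline_reverse (G.len_pos _) (fun _ hk => G.dartCorner_rev d hk) hs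

theorem dartPath_true (e : E) {k : ℕ} {t : ℝ} (ht : t ∈ Icc (0 : ℝ) 1) :
    Λ.mkQ (G.dartPath (e, true) (k + t)) = G.point e k t := by
  rw [dartPath, polyline_add _ _ ht]; rfl

@[simp] theorem dartPath_zero (d : ODart E) : G.dartPath d 0 = G.dartCorner d 0 := by
  have := polyline_natCast (G.dartCorner d) 0
  rwa [Nat.cast_zero] at this

theorem mkQ_dartPath_zero (d : ODart E) : Λ.mkQ (G.dartPath d 0) = G.pos (G.origin d) := by
  rw [dartPath_zero]
  rcases d with ⟨e, b⟩
  cases b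
  · simpa [dartCorner, origin] using G.corner_len e
  · simpa [dartCorner, origin] using G.corner_zero e

theorem mkQ_dartPath_len (d : ODart E) :
    Λ.mkQ (G.dartPath d (G.len d.1)) = G.pos (G.terminus d) := by
  have := G.mkQ_dartPath_zero d.rev
  rw [G.dartPath_rev d ⟨le_rfl, Nat.cast_nonneg _⟩, sub_zero, origin_rev] at this
  exact this

theorem dartPath_true_of_mem (e : E) {s : ℝ} (hs : s ∈ Ioo (0 : ℝ) (G.len e)) :
    ∃ k < G.len e, ∃ t ∈ Ico (0 : ℝ) 1, (k ≠ 0 ∨ t ≠ 0) ∧ s = k + t ∧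
      G.dartPath (e, true) s = AffineMap.lineMap (G.corner e k) (G.corner e (k + 1)) t := by
  obtain ⟨k, hk, t, ht, rfl⟩ := exists_eq_natCast_add_of_lt hs.1.le hs.2
  refine ⟨k, hk, t, ht, ?_, rfl, ?_⟩
  · by_contra! hc
    rw [hc.1, hc.2] at hs
    simpa using hs.1
  · rw [dartPath, polyline_add _ _ (Ico_subset_Icc_self ht)]; rfl

theorem mkQ_dartPath_ne_pos (d : ODart E) {s : ℝ} (hs : s ∈ Ioo (0 : ℝ) (G.len d.1)) (v : V) :
    Λ.mkQ (G.dartPath d s) ≠ G.pos v := by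
  have key : ∀ (e : E) (s : ℝ), s ∈ Ioo (0 : ℝ) (G.len e) →
      Λ.mkQ (G.dartPath (e, true) s) ≠ G.pos v := by
    intro e s hs
    obtain ⟨k, hk, t, ht, hkt, -, h⟩ := G.dartPath_true_of_mem e hs
    rw [h]
    exact G.avoid e k t hk ht hkt v
  rcases d with ⟨e, b⟩
  cases b
  · have := G.dartPath_rev (e, true) (Ioo_subset_Icc_self hs)
    rw [show (e, false) = ODart.rev (e, true) from rfl, this]
    exact key _ _ ⟨by linarith [hs.2], by linarith [hs.1]⟩
  · exact key e s hs

theorem dartPath_true_inj {e e' : E} {s s' : ℝ} (hs : s ∈ Ioo (0 : ℝ) (G.len e))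
    (hs' : s' ∈ Ioo (0 : ℝ) (G.len e'))
    (h : Λ.mkQ (G.dartPath (e, true) s) = Λ.mkQ (G.dartPath (e', true) s')) : e = e' ∧ s = s' := by
  obtain ⟨k, hk, t, ht, hkt, rfl, h1⟩ := G.dartPath_true_of_mem e hs
  obtain ⟨k', hk', t', ht', hkt', rfl, h1'⟩ := G.dartPath_true_of_mem e' hs'
  rw [h1, h1'] at h
  obtain ⟨rfl, rfl, rfl⟩ := G.simple e e' k k' t t' hk ht hkt hk' ht' hkt' h
  exact ⟨rfl, rfl⟩

theorem dartPath_inj_fst {d d' : ODart E} {s s' : ℝ} (hs : s ∈ Ioo (0 : ℝ) (G.len d.1))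
    (hs' : s' ∈ Ioo (0 : ℝ) (G.len d'.1))
    (h : Λ.mkQ (G.dartPath d s) = Λ.mkQ (G.dartPath d' s')) : d.1 = d'.1 := by
  have key : ∀ (d : ODart E) (s : ℝ), s ∈ Ioo (0 : ℝ) (G.len d.1) →
      ∃ t ∈ Ioo (0 : ℝ) (G.len d.1), G.dartPath d s = G.dartPath (d.1, true) t := by
    rintro ⟨e, b⟩ s hs
    cases b
    · exact ⟨G.len e - s, ⟨by linarith [hs.2], by linarith [hs.1]⟩,
        G.dartPath_rev (e, true) (Ioo_subset_Icc_self hs)⟩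
    · exact ⟨s, hs, rfl⟩
  obtain ⟨t, ht, e1⟩ := key d s hs
  obtain ⟨t', ht', e2⟩ := key d' s' hs'
  rw [e1, e2] at h
  exact (G.dartPath_true_inj ht ht' h).1

theorem dartPath_inj {d : ODart E} {s s' : ℝ} (hs : s ∈ Ioo (0 : ℝ) (G.len d.1))
    (hs' : s' ∈ Ioo (0 : ℝ) (G.len d.1))
    (h : Λ.mkQ (G.dartPath d s) = Λ.mkQ (G.dartPath d s')) : s = s' := by
  rcases d with ⟨e, b⟩
  cases b
  · have h1 := G.dartPath_rev (e, true) (Ioo_subset_Icc_self hs)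
    have h2 := G.dartPath_rev (e, true) (Ioo_subset_Icc_self hs')
    rw [show (e, false) = ODart.rev (e, true) from rfl, h1, h2] at h
    have := (G.dartPath_true_inj (e := e) (e' := e) ⟨by linarith [hs.2], by linarith [hs.1]⟩
      ⟨by linarith [hs'.2], by linarith [hs'.1]⟩ h).2
    linarith
  · exact (G.dartPath_true_inj hs hs' h).2

theorem dartPath_rev_inj {d : ODart E} {s s' : ℝ} (hs : s ∈ Ioo (0 : ℝ) (G.len d.1))
    (hs' : s' ∈ Ioo (0 : ℝ) (G.len d.1))
    (h : Λ.mkQ (G.dartPath d s) = Λ.mkQ (G.dartPath d.rev s')) : s + s' = G.len d.1 := by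
  rw [G.dartPath_rev d (Ioo_subset_Icc_self hs')] at h
  have := G.dartPath_inj hs ⟨by linarith [hs'.2], by linarith [hs'.1]⟩ h
  linarith

theorem dartPath_add (d : ODart E) (k : ℕ) {t : ℝ} (ht : t ∈ Icc (0 : ℝ) 1) :
    G.dartPath d (k + t) = AffineMap.lineMap (G.dartCorner d k) (G.dartCorner d (k + 1)) t :=
  polyline_add _ _ ht

theorem dartPath_natCast (d : ODart E) (k : ℕ) : G.dartPath d k = G.dartCorner d k :=
  polyline_natCast _ _

theorem natCast_add_mem_Ioo {n k : ℕ} (hk : k < n) {t : ℝ} (ht : t ∈ Ioo (0 : ℝ) 1) :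
    (k : ℝ) + t ∈ Ioo (0 : ℝ) n := by
  have : (k : ℝ) + 1 ≤ n := by exact_mod_cast hk
  exact ⟨by linarith [ht.1, Nat.cast_nonneg (α := ℝ) k], by linarith [ht.2]⟩

theorem dartCorner_ne (d : ODart E) {k : ℕ} (hk : k < G.len d.1) :
    G.dartCorner d k ≠ G.dartCorner d (k + 1) := by
  intro h
  have h1 : (1 / 2 : ℝ) ∈ Ioo (0 : ℝ) 1 := by norm_num
  have h2 : (1 / 3 : ℝ) ∈ Ioo (0 : ℝ) 1 := by norm_num
  have := G.dartPath_inj (natCast_add_mem_Ioo hk h1) (natCast_add_mem_Ioo hk h2) (by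
    rw [G.dartPath_add d k (Ioo_subset_Icc_self h1), G.dartPath_add d k (Ioo_subset_Icc_self h2), h]
    simp)
  norm_num at this

theorem dartCorner_turn_mem_slitPlane (d : ODart E) {k : ℕ} (hk : k + 1 < G.len d.1) :
    (G.dartCorner d (k + 2) - G.dartCorner d (k + 1)) /
      (G.dartCorner d (k + 1) - G.dartCorner d k) ∈ Complex.slitPlane := by
  refine div_mem_slitPlane_of_lineMap_ne (G.dartCorner_ne d (by omega)) (G.dartCorner_ne d hk) ?_
  intro t ht t' ht' h
  rw [← G.dartPath_add d k (Ioo_subset_Icc_self ht),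
    ← G.dartPath_add d (k + 1) (Ioo_subset_Icc_self ht')] at h
  have := G.dartPath_inj (natCast_add_mem_Ioo (by omega) ht) (natCast_add_mem_Ioo hk ht')
    (congrArg _ h)
  push_cast at this
  linarith [ht.2, ht'.1]

theorem startDir_ne_zero (d : ODart E) : G.startDir d ≠ 0 :=
  sub_ne_zero.mpr (G.dartCorner_ne d (G.len_pos _)).symm

theorem endDir_eq (d : ODart E) : G.endDir d = -G.startDir d.rev := by
  have := G.len_pos d.1
  rw [endDir, startDir, G.dartCorner_rev d (Nat.zero_le _), G.dartCorner_rev d this]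
  simp

/-- Distinct oriented edges with the same origin leave it in distinct directions. -/
theorem neg_startDir_div_mem_slitPlane {d d' : ODart E} (ho : G.origin d = G.origin d')
    (hne : d ≠ d') : -(G.startDir d' / G.startDir d) ∈ Complex.slitPlane := by
  have h0 : Λ.mkQ (G.dartCorner d 0) = Λ.mkQ (G.dartCorner d' 0) := by
    have h1 := G.mkQ_dartPath_zero d
    have h2 := G.mkQ_dartPath_zero d'
    rw [dartPath_zero] at h1 h2
    rw [h1, h2, ho]
  set c := G.dartCorner d' 0 - G.dartCorner d 0 with hc
  have hcΛ : c ∈ Λ := by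
    have := (Submodule.Quotient.eq Λ).mp h0.symm
    exact this
  -- The last segment of `d.rev`, translated so that it ends at the chosen lift of the origin of
  -- `d'`, is followed by the first segment of `d'`. A common direction of `d` and `d'` would make
  -- this path turn straight back.
  have key := div_mem_slitPlane_of_lineMap_ne (a := G.dartCorner d 1 + c)
    (b := G.dartCorner d 0 + c) (c := G.dartCorner d' 1) ?_ ?_ ?_
  · have e : (G.dartCorner d' 1 - (G.dartCorner d 0 + c)) /
      (G.dartCorner d 0 + c - (G.dartCorner d 1 + c)) = -(G.startDir d' / G.startDir d) := by
      rw [startDir, startDir, ← div_neg]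
      congr 1
      · rw [hc]; ring
      · ring
    rwa [e] at key
  · intro h
    exact G.dartCorner_ne d (G.len_pos _) (add_right_cancel h).symm
  · rw [hc, add_sub_cancel]
    exact G.dartCorner_ne d' (G.len_pos _)
  · intro t ht t' ht' h
    have ht1 : 1 - t ∈ Ioo (0 : ℝ) 1 := ⟨by linarith [ht.2], by linarith [ht.1]⟩
    have m1 := natCast_add_mem_Ioo (G.len_pos d.1) ht1
    have m2 := natCast_add_mem_Ioo (G.len_pos d'.1) ht'
    have h1 : G.dartPath d ((0 : ℕ) + (1 - t)) + c = G.dartPath d' ((0 : ℕ) + t') := by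
      rw [G.dartPath_add d 0 (Ioo_subset_Icc_self ht1), G.dartPath_add d' 0 (Ioo_subset_Icc_self ht'),
        AffineMap.lineMap_apply_one_sub]
      rw [show G.dartCorner d 0 + c = G.dartCorner d' 0 by rw [hc]; ring] at h
      rw [← h]
      simp only [AffineMap.lineMap_apply_module', Complex.real_smul]
      rw [hc]; push_cast; ring
    have h2 : Λ.mkQ (G.dartPath d ((0 : ℕ) + (1 - t))) = Λ.mkQ (G.dartPath d' ((0 : ℕ) + t')) := by
      rw [← h1, map_add]
      have : Λ.mkQ c = 0 := (Submodule.Quotient.mk_eq_zero Λ).mpr hcΛ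
      rw [this, add_zero]
    rcases ODart.eq_or_eq_rev (G.dartPath_inj_fst m1 m2 h2) with h3 | h3
    · exact hne h3
    · have h4 : d' = d.rev := by rw [h3, ODart.rev_rev]
      subst h4
      have h5 := G.dartPath_rev_inj m1 m2 h2
      -- a loop which is a straight segment is impossible; otherwise the two halves are distinct
      have hlen : (1 : ℝ) ≤ G.len d.1 := by exact_mod_cast G.len_pos d.1
      rcases Nat.lt_or_ge 1 (G.len d.1) with hl | hl
      · have : (2 : ℝ) ≤ G.len d.1 := by exact_mod_cast hl
        push_cast at h5
        linarith [ht1.2, ht'.2]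
      · have hl1 : G.len d.1 = 1 := le_antisymm hl (G.len_pos _)
        rw [hl1] at h5
        have e1 : G.dartPath d.rev ((0 : ℕ) + t') = G.dartPath d ((0 : ℕ) + (1 - t)) := by
          rw [G.dartPath_rev d ⟨m2.1.le, m2.2.le⟩, hl1]
          congr 1
          push_cast at h5 ⊢
          linarith
        rw [e1] at h1
        have hc0 : c = 0 := by simpa using h1
        have := G.dartCorner_rev d (Nat.zero_le _)
        rw [Nat.sub_zero, hl1] at this
        rw [hc, this, sub_eq_zero] at hc0
        exact G.dartCorner_ne d (G.len_pos _) hc0.symm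

theorem arg_inv_of_mem_slitPlane {q : ℂ} (hq : q ∈ Complex.slitPlane) : q⁻¹.arg = -q.arg := by
  rw [Complex.arg_inv, if_neg (Complex.slitPlane_arg_ne_pi hq)]

theorem bend_rev (d : ODart E) : G.bend d.rev = -G.bend d := by
  unfold bend
  rw [ODart.rev_fst, ← Finset.sum_neg_distrib, ← Finset.sum_range_reflect]
  refine Finset.sum_congr rfl fun k hk => ?_
  rw [Finset.mem_range] at hk
  have hk' : k + 1 < G.len d.1 := by omega
  rw [G.dartCorner_rev d (by omega), G.dartCorner_rev d (by omega), G.dartCorner_rev d (by omega),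
    ← arg_inv_of_mem_slitPlane (G.dartCorner_turn_mem_slitPlane d hk'), inv_div,
    show G.len d.1 - (G.len d.1 - 1 - 1 - k + 2) = k by omega,
    show G.len d.1 - (G.len d.1 - 1 - 1 - k + 1) = k + 1 by omega,
    show G.len d.1 - (G.len d.1 - 1 - 1 - k) = k + 2 by omega,
    ← neg_sub (G.dartCorner d (k + 1)), ← neg_sub (G.dartCorner d (k + 2)), neg_div_neg_eq]

end TorusGraph

/-! ### Counterclockwise angles and the rotation system of a graph -/

section ccwAngle

theorem ccwAngle_pos (u v : ℂ) : 0 < ccwAngle u v := (toIocMod_mem_Ioc Real.two_pi_pos 0 _).1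

theorem ccwAngle_le (u v : ℂ) : ccwAngle u v ≤ 2 * Real.pi := by
  have := (toIocMod_mem_Ioc Real.two_pi_pos 0 (Complex.arg (v / u))).2
  rwa [zero_add] at this

theorem coe_ccwAngle {u v : ℂ} (hu : u ≠ 0) (hv : v ≠ 0) :
    (ccwAngle u v : Real.Angle) = v.arg - u.arg := by
  rw [ccwAngle, Real.Angle.coe_toIocMod, Complex.arg_div_coe_angle hv hu]

theorem ccwAngle_self {u : ℂ} (hu : u ≠ 0) : ccwAngle u u = 2 * Real.pi := by
  rw [ccwAngle, div_self hu, Complex.arg_one, toIocMod_apply_left, zero_add]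

/-- Both sides agree modulo 2π and lie in (-π, π]. This expresses the turning angle of the Kac–Ward
matrix through the counterclockwise angle from the reversed edge. -/
theorem ccwAngle_sub_pi {u v : ℂ} (hu : u ≠ 0) (hv : v ≠ 0) :
    ccwAngle u v - Real.pi = (-(v / u)).arg := by
  have h : ((ccwAngle u v - Real.pi : ℝ) : Real.Angle) = (-(v / u)).arg := by
    rw [Complex.arg_neg_coe_angle (div_ne_zero hv hu), Real.Angle.coe_sub, ccwAngle,
      Real.Angle.coe_toIocMod, sub_eq_add_neg, Real.Angle.neg_coe_pi]
  obtain ⟨m, hm⟩ := Real.Angle.angle_eq_iff_two_pi_dvd_sub.mp h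
  have h1 := ccwAngle_pos u v
  have h2 := ccwAngle_le u v
  have h3 := Complex.neg_pi_lt_arg (-(v / u))
  have h4 := Complex.arg_le_pi (-(v / u))
  have hpi := Real.pi_pos
  have l1 : (m : ℝ) < 1 := by nlinarith
  have l2 : (-1 : ℝ) < m := by nlinarith
  have l1' : m < 1 := by exact_mod_cast l1
  have l2' : -1 < m := by exact_mod_cast l2
  have : m = 0 := by omega
  subst this
  simp only [Int.cast_zero, mul_zero] at hm
  linarith

theorem ccwAngle_add_swap {u v : ℂ} (hu : u ≠ 0) (hv : v ≠ 0)
    (h : -(v / u) ∈ Complex.slitPlane) : ccwAngle u v + ccwAngle v u = 2 * Real.pi := by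
  have h1 := ccwAngle_sub_pi hu hv
  have h2 := ccwAngle_sub_pi hv hu
  have h3 : -(u / v) = (-(v / u))⁻¹ := by rw [inv_neg, inv_div]
  rw [h3, TorusGraph.arg_inv_of_mem_slitPlane h] at h2
  linarith

theorem ccwAngle_cocycle {u v w : ℂ} (hu : u ≠ 0) (hv : v ≠ 0) (hw : w ≠ 0) :
    ∃ m : ℤ, ccwAngle u v + ccwAngle v w = ccwAngle u w + m * (2 * Real.pi) := by
  have : ((ccwAngle u v + ccwAngle v w : ℝ) : Real.Angle) = ccwAngle u w := by
    rw [Real.Angle.coe_add, coe_ccwAngle hu hv, coe_ccwAngle hv hw, coe_ccwAngle hu hw]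
    abel
  obtain ⟨m, hm⟩ := Real.Angle.angle_eq_iff_two_pi_dvd_sub.mp this
  exact ⟨m, by linarith⟩

end ccwAngle

namespace TorusGraph

variable {Λ : Submodule ℤ ℂ} {V E : Type*} (G : TorusGraph Λ V E)

theorem ccwAngle_startDir_add_swap {a b : ODart E} (ho : G.origin a = G.origin b) (hab : a ≠ b) :
    ccwAngle (G.startDir a) (G.startDir b) + ccwAngle (G.startDir b) (G.startDir a) =
      2 * Real.pi :=
  ccwAngle_add_swap (G.startDir_ne_zero a) (G.startDir_ne_zero b)
    (G.neg_startDir_div_mem_slitPlane ho hab)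

theorem exists_isNext [Finite E] (d : ODart E) : ∃ d', G.IsNext d d' := by
  obtain ⟨d', hd', h⟩ := Set.exists_min_image {d' : ODart E | G.origin d' = G.origin d}
    (fun d' => ccwAngle (G.startDir d) (G.startDir d')) (Set.toFinite _) ⟨d, rfl⟩
  exact ⟨d', hd', fun d'' h'' => h d'' h''⟩

/-- If `d` came next after both `a` and `b`, then turning from `a` one would meet `d` no later than
`b`, and from `b` no later than `a`. These inequalities leave no integer for the number of full
turns in the cocycle relation. It makes the successor map a permutation. -/
theorem IsNext.injective {a b d : ODart E} (ha : G.IsNext a d) (hb : G.IsNext b d) : a = b := by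
  by_contra hne
  have ho : G.origin a = G.origin b := by rw [← ha.1, hb.1]
  have h1 := ha.2 b ho.symm
  have h2 := hb.2 a ho
  have h3 := G.ccwAngle_startDir_add_swap ho hne
  obtain ⟨m, hm⟩ := ccwAngle_cocycle (G.startDir_ne_zero a) (G.startDir_ne_zero b)
    (G.startDir_ne_zero d)
  have h4 := ccwAngle_pos (G.startDir a) (G.startDir b)
  have h5 := ccwAngle_pos (G.startDir b) (G.startDir d)
  have h6 := ccwAngle_pos (G.startDir a) (G.startDir d)
  have hpi := Real.pi_pos
  have l1 : (m : ℝ) < 1 := by nlinarith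
  have l2 : (0 : ℝ) < m := by
    by_contra hc
    have := not_lt.mp hc
    nlinarith
  have l1' : m < 1 := by exact_mod_cast l1
  have l2' : 0 < m := by exact_mod_cast l2
  omega

theorem IsNext.unique {a b d : ODart E} (ha : G.IsNext d a) (hb : G.IsNext d b) : a = b := by
  by_contra hne
  have ho : G.origin a = G.origin b := by rw [ha.1, hb.1]
  have h1 := ha.2 b hb.1
  have h2 := hb.2 a ha.1
  have h3 := G.ccwAngle_startDir_add_swap ho hne
  obtain ⟨m, hm⟩ := ccwAngle_cocycle (G.startDir_ne_zero d) (G.startDir_ne_zero a)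
    (G.startDir_ne_zero b)
  have h4 := ccwAngle_pos (G.startDir a) (G.startDir b)
  have h5 := ccwAngle_pos (G.startDir b) (G.startDir a)
  have hpi := Real.pi_pos
  have e : ccwAngle (G.startDir a) (G.startDir b) = m * (2 * Real.pi) := by linarith
  have l1 : (m : ℝ) < 1 := by nlinarith
  have l2 : (0 : ℝ) < m := by
    by_contra hc
    have := not_lt.mp hc
    nlinarith
  have l1' : m < 1 := by exact_mod_cast l1
  have l2' : 0 < m := by exact_mod_cast l2
  omega

/-- The rotation system of a graph in the torus. -/
noncomputable def rotation [Finite E] : AngularRotation (ODart E) V where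
  origin := G.origin
  angle a b := ccwAngle (G.startDir a) (G.startDir b)
  next := Equiv.ofBijective (fun d => (G.exists_isNext d).choose) (Finite.injective_iff_bijective.mp
    fun a b h => IsNext.injective G (G.exists_isNext a).choose_spec (by
      have h' : (G.exists_isNext a).choose = (G.exists_isNext b).choose := h
      rw [h']
      exact (G.exists_isNext b).choose_spec))
  origin_next d := (G.exists_isNext d).choose_spec.1
  angle_pos _ _ := ccwAngle_pos _ _
  angle_le _ _ := ccwAngle_le _ _
  angle_self a := ccwAngle_self (G.startDir_ne_zero a)
  angle_add_swap _ _ ho hab := G.ccwAngle_startDir_add_swap ho hab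
  angle_cocycle a b c := ccwAngle_cocycle (G.startDir_ne_zero a) (G.startDir_ne_zero b)
    (G.startDir_ne_zero c)
  angle_next_le a b h := (G.exists_isNext a).choose_spec.2 b h

theorem isNext_next [Finite E] (d : ODart E) : G.IsNext d (G.rotation.next d) :=
  (G.exists_isNext d).choose_spec

/-- The weight with which an oriented edge is reversed: its holonomy. -/
noncomputable def holonomy (φ : ODart E → ℂˣ) (d : ODart E) : ℂ :=
  φ d * Complex.exp (Complex.I / 2 * (G.bend d : ℂ))

theorem holonomy_mul_rev {φ : ODart E → ℂˣ} (hφ : ∀ d, φ d.rev = (φ d)⁻¹) (d : ODart E) :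
    G.holonomy φ d * G.holonomy φ d.rev = 1 := by
  rw [holonomy, holonomy, hφ, bend_rev, mul_mul_mul_comm, ← Complex.exp_add, ← mul_add]
  simp

/-- The angle of a turn is the bending along the edge plus the exterior angle at its terminus.
Passing to `d.rev` moves to this terminus, where the exterior angle is the counterclockwise angle
from `d.rev` to `d'` minus π. -/
theorem kwT_eq [Fintype E] [DecidableEq E] (φ : ODart E → ℂˣ) (x : E → ℝ) :
    G.kwT φ x = weightMatrix (fun e => (x e : ℂ)) * flipMatrix (G.holonomy φ) *
      G.rotation.vertexMatrix := by
  ext d d'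
  rw [Matrix.mul_assoc, weightMatrix, Matrix.diagonal_mul, flipMatrix_mul_apply]
  have ha : G.rotation.angle d.rev d' = ccwAngle (G.startDir d.rev) (G.startDir d') := rfl
  have hiff : (G.rotation.origin d.rev = G.rotation.origin d' ∧ d.rev ≠ d') ↔
      (G.terminus d = G.origin d' ∧ d' ≠ d.rev) := by
    rw [← G.origin_rev d, ne_comm]; rfl
  simp only [kwT, AngularRotation.vertexMatrix, Matrix.of_apply]
  by_cases h : G.terminus d = G.origin d' ∧ d' ≠ d.rev
  · have e1 := ccwAngle_sub_pi (G.startDir_ne_zero d.rev) (G.startDir_ne_zero d')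
    rw [if_pos h, if_pos (hiff.mpr h), turn, endDir_eq, div_neg, ← e1, holonomy, ha]
    push_cast
    rw [mul_add, Complex.exp_add]
    ring
  · rw [if_neg h, if_neg (mt hiff.mp h)]
    simp

end TorusGraph

/-! ### Cocycles, characters and potentials -/

section Character

variable (Λ : Submodule ℤ ℂ) [DiscreteTopology Λ] [IsZLattice ℝ Λ]

/-- A character of a lattice extends to the plane. -/
theorem exists_extend_character (χ : Multiplicative Λ →* ℂˣ) :
    ∃ X : Multiplicative ℂ →* ℂˣ, ∀ c : Λ, X (Multiplicative.ofAdd (c : ℂ)) =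
      χ (Multiplicative.ofAdd c) := by
  have := ZLattice.module_free ℝ Λ
  have := ZLattice.module_finite ℝ Λ
  let b := Module.Free.chooseBasis ℤ Λ
  let B := b.ofZLatticeBasis ℝ Λ
  -- A ℤ-basis of the lattice is an ℝ-basis of the plane, so logarithms chosen on it extend
  -- linearly.
  let ℓ : ℂ →ₗ[ℝ] ℂ := B.constr ℝ fun i => Complex.log (χ (Multiplicative.ofAdd (b i)) : ℂ)
  let X : Multiplicative ℂ →* ℂˣ :=
    { toFun := fun z => Units.mk0 (Complex.exp (ℓ z.toAdd)) (Complex.exp_ne_zero _)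
      map_one' := by ext; simp
      map_mul' := by intro z w; ext; simp [Complex.exp_add] }
  let Y : Multiplicative Λ →* ℂˣ := X.comp (AddMonoidHom.toMultiplicative Λ.subtype.toAddMonoidHom)
  suffices h : Y = χ from ⟨X, fun c => DFunLike.congr_fun h (Multiplicative.ofAdd c)⟩
  have h2 : MonoidHom.toAdditive Y = MonoidHom.toAdditive χ := by
    have h3 : (MonoidHom.toAdditive Y).toIntLinearMap = (MonoidHom.toAdditive χ).toIntLinearMap := by
      refine b.ext fun i => ?_
      show Additive.ofMul (Y (Multiplicative.ofAdd (b i))) =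
        Additive.ofMul (χ (Multiplicative.ofAdd (b i)))
      congr 1
      ext
      show Complex.exp (ℓ (b i : ℂ)) = _
      have : ℓ (b i : ℂ) = Complex.log (χ (Multiplicative.ofAdd (b i)) : ℂ) := by
        rw [← b.ofZLatticeBasis_apply ℝ Λ i]
        exact B.constr_basis ℝ _ i
      rw [this, Complex.exp_log (Units.ne_zero _)]
    ext c
    have := congrArg (fun f => f c) h3
    exact congrArg (fun z : Additive ℂˣ => ((Additive.toMul z : ℂˣ) : ℂ)) this
  exact MonoidHom.toAdditive.injective h2

end Character

namespace TorusGraph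

variable {Λ : Submodule ℤ ℂ} {V F E : Type*} (G : TorusGraph Λ V E)

theorem IsWalk.append {u v w : V} {l l' : List (ODart E)} (h : G.IsWalk u l v)
    (h' : G.IsWalk v l' w) : G.IsWalk u (l ++ l') w := by
  induction l generalizing u with
  | nil =>
    have e : u = v := h
    subst e; exact h'
  | cons d l ih => exact ⟨h.1, ih h.2⟩

theorem IsWalk.single (d : ODart E) : G.IsWalk (G.origin d) [d] (G.terminus d) := ⟨rfl, rfl⟩

theorem IsWalk.exists_symm {u v : V} {l : List (ODart E)} (h : G.IsWalk u l v) :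
    ∃ l', G.IsWalk v l' u := by
  induction l generalizing u with
  | nil =>
    have e : u = v := h
    subst e; exact ⟨[], rfl⟩
  | cons d l ih =>
    obtain ⟨l', hl'⟩ := ih h.2
    refine ⟨l' ++ [d.rev], IsWalk.append G hl' ?_⟩
    have := IsWalk.single G d.rev
    rwa [origin_rev, terminus_rev, h.1] at this

theorem mkQ_disp (d : ODart E) :
    Λ.mkQ (G.disp d) = G.pos (G.terminus d) - G.pos (G.origin d) := by
  rw [disp, map_sub, ← mkQ_dartPath_zero, ← mkQ_dartPath_len, dartPath_zero, dartPath_natCast]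

theorem disp_rev (d : ODart E) : G.disp d.rev = -G.disp d := by
  rw [disp, disp, ODart.rev_fst, G.dartCorner_rev d le_rfl, G.dartCorner_rev d (Nat.zero_le _)]
  simp

theorem IsWalk.mkQ_sum_disp {u v : V} {l : List (ODart E)} (h : G.IsWalk u l v) :
    Λ.mkQ (l.map G.disp).sum = G.pos v - G.pos u := by
  induction l generalizing u with
  | nil =>
    have e : u = v := h
    subst e; simp
  | cons d l ih =>
    rw [List.map_cons, List.sum_cons, map_add, ih h.2, mkQ_disp, h.1]
    abel

/-- A cocycle is, up to a coboundary, the restriction of a character of the plane. -/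
theorem Represents.exists_potential {χ : Multiplicative Λ →* ℂˣ} {φ : ODart E → ℂˣ}
    (h : G.Represents χ φ) {X : Multiplicative ℂ →* ℂˣ}
    (hX : ∀ c : Λ, X (Multiplicative.ofAdd (c : ℂ)) = χ (Multiplicative.ofAdd c)) :
    ∃ a : V → ℂˣ, ∀ d, φ d = X (Multiplicative.ofAdd (G.disp d)) * a (G.terminus d) *
      (a (G.origin d))⁻¹ := by
  let S : Setoid V :=
    { r := fun u v => ∃ l, G.IsWalk u l v
      iseqv := ⟨fun v => ⟨[], rfl⟩, fun ⟨_, h⟩ => IsWalk.exists_symm G h,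
        fun ⟨_, h⟩ ⟨_, h'⟩ => ⟨_, IsWalk.append G h h'⟩⟩ }
  -- After division by the character of the displacement, the cocycle has product 1 on every closed
  -- walk. It is then a coboundary, with the products along walks from a base vertex as potential.
  let ψ : ODart E → ℂˣ := fun d => φ d * (X (Multiplicative.ofAdd (G.disp d)))⁻¹
  have hψ : ∀ l : List (ODart E), (l.map ψ).prod =
      (l.map φ).prod * (X (Multiplicative.ofAdd (l.map G.disp).sum))⁻¹ := by
    intro l
    induction l with
    | nil => simp
    | cons d l ih =>
      simp only [List.map_cons, List.prod_cons, List.sum_cons, ih, ofAdd_add, map_mul, ψ, mul_inv]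
      exact mul_mul_mul_comm _ _ _ _
  have hclosed : ∀ v l, G.IsWalk v l v → (l.map ψ).prod = 1 := by
    intro v l hl
    have hmem : (l.map G.disp).sum ∈ Λ := by
      have := IsWalk.mkQ_sum_disp G hl
      rw [sub_self] at this
      exact (Submodule.Quotient.mk_eq_zero Λ).mp this
    have h1 := h.2 v l hl ⟨_, hmem⟩ rfl
    rw [hψ, h1, ← hX, mul_inv_cancel]
  -- One base vertex for each class of vertices joined by walks, so that connectedness of the graph
  -- is not needed.
  let base : V → V := fun v => (Quotient.mk S v).out
  have hbase : ∀ v, ∃ l, G.IsWalk (base v) l v := fun v =>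
    Quotient.exact (s := S) (Quotient.out_eq (Quotient.mk S v))
  choose p hp using hbase
  choose q hq using fun v => IsWalk.exists_symm G (hp v)
  refine ⟨fun v => ((p v).map ψ).prod, fun d => ?_⟩
  have hb : base (G.origin d) = base (G.terminus d) := by
    have : Quotient.mk S (G.origin d) = Quotient.mk S (G.terminus d) :=
      Quotient.sound ⟨_, IsWalk.single G d⟩
    simp only [base, this]
  have h1 := hclosed _ _ (IsWalk.append G (hp (G.terminus d)) (hq _))
  have h2 := hclosed _ _ (IsWalk.append G (IsWalk.append G (hp (G.origin d)) (IsWalk.single G d))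
    (hb ▸ hq (G.terminus d)))
  simp only [List.map_append, List.prod_append, List.map_cons, List.map_nil, List.prod_cons,
    List.prod_nil, mul_one] at h1 h2
  have h3 := eq_inv_of_mul_eq_one_right h1
  rw [h3] at h2
  simp only [ψ] at h2
  set A := ((p (G.origin d)).map fun d => φ d * (X (Multiplicative.ofAdd (G.disp d)))⁻¹).prod
  set B := ((p (G.terminus d)).map fun d => φ d * (X (Multiplicative.ofAdd (G.disp d)))⁻¹).prod
  show φ d = X _ * B * A⁻¹
  have h4 : A * (φ d * (X (Multiplicative.ofAdd (G.disp d)))⁻¹) = B := mul_inv_eq_one.mp h2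
  rw [← h4]
  rw [mul_comm A, mul_assoc, mul_assoc, mul_inv_cancel, mul_one, mul_comm, inv_mul_cancel_right]

/-! ### Crossings of edges with their duals, and the gauge between the two systems -/

/-- The oriented edge `d` of `G` crosses its dual at the point of parameter `t` of its `k`-th
segment, which is the point of parameter `s` of the `l`-th segment of the dual. -/
structure IsCrossing (H : TorusGraph Λ F E) (d : ODart E) (k : ℕ) (t : ℝ) (l : ℕ) (s : ℝ) :
    Prop where
  lt_len : k < G.len d.1
  mem : t ∈ Ioo (0 : ℝ) 1
  lt_len_dual : l < H.len d.1
  mem_dual : s ∈ Ioo (0 : ℝ) 1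
  eq : Λ.mkQ (G.dartPath d (k + t)) = Λ.mkQ (H.dartPath d (l + s))
  im_neg : ((H.dartCorner d (l + 1) - H.dartCorner d l) /
    (G.dartCorner d (k + 1) - G.dartCorner d k)).im < 0

theorem dartPath_rev_add (d : ODart E) {k : ℕ} (hk : k < G.len d.1) {t : ℝ}
    (ht : t ∈ Icc (0 : ℝ) 1) :
    G.dartPath d.rev ((G.len d.1 - 1 - k : ℕ) + (1 - t)) = G.dartPath d (k + t) := by
  have e : ((G.len d.1 - 1 - k : ℕ) : ℝ) = G.len d.1 - 1 - k := by
    rw [Nat.sub_sub, Nat.cast_sub (by omega)]; push_cast; ring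
  have hk' : (k : ℝ) + 1 ≤ G.len d.1 := by exact_mod_cast hk
  have hk0 : (0 : ℝ) ≤ k := Nat.cast_nonneg k
  rw [e, G.dartPath_rev d ⟨by linarith [ht.2], by linarith [ht.1]⟩]
  congr 1; ring

/-- Reversing both edges negates both directions, so the sign of the crossing is unchanged. -/
theorem IsCrossing.rev {H : TorusGraph Λ F E} {d : ODart E} {k : ℕ} {t : ℝ} {l : ℕ} {s : ℝ}
    (h : G.IsCrossing H d k t l s) :
    G.IsCrossing H d.rev (G.len d.1 - 1 - k) (1 - t) (H.len d.1 - 1 - l) (1 - s) where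
  lt_len := by have := h.lt_len; rw [ODart.rev_fst]; omega
  mem := ⟨by linarith [h.mem.2], by linarith [h.mem.1]⟩
  lt_len_dual := by have := h.lt_len_dual; rw [ODart.rev_fst]; omega
  mem_dual := ⟨by linarith [h.mem_dual.2], by linarith [h.mem_dual.1]⟩
  eq := by
    rw [G.dartPath_rev_add d h.lt_len (Ioo_subset_Icc_self h.mem),
      H.dartPath_rev_add d h.lt_len_dual (Ioo_subset_Icc_self h.mem_dual), h.eq]
  im_neg := by
    have h1 := h.lt_len
    have h2 := h.lt_len_dual
    rw [G.dartCorner_rev d (by omega), G.dartCorner_rev d (by omega), H.dartCorner_rev d (by omega),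
      H.dartCorner_rev d (by omega), show G.len d.1 - (G.len d.1 - 1 - k + 1) = k by omega,
      show G.len d.1 - (G.len d.1 - 1 - k) = k + 1 by omega,
      show H.len d.1 - (H.len d.1 - 1 - l + 1) = l by omega,
      show H.len d.1 - (H.len d.1 - 1 - l) = l + 1 by omega,
      ← neg_sub (H.dartCorner d (l + 1)), ← neg_sub (G.dartCorner d (k + 1)), neg_div_neg_eq]
    exact h.im_neg

/-- A choice of the crossings of all the oriented edges with their duals, compatible with the
reversal of orientations. -/
structure CrossingData (H : TorusGraph Λ F E) where
  k : ODart E → ℕ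
  t : ODart E → ℝ
  l : ODart E → ℕ
  s : ODart E → ℝ
  isCrossing : ∀ d, G.IsCrossing H d (k d) (t d) (l d) (s d)
  k_rev : ∀ d, k d.rev = G.len d.1 - 1 - k d
  t_rev : ∀ d, t d.rev = 1 - t d
  l_rev : ∀ d, l d.rev = H.len d.1 - 1 - l d
  s_rev : ∀ d, s d.rev = 1 - s d
  inter : ∀ d, G.edgeSet d.1 ∩ H.edgeSet d.1 ⊆ {Λ.mkQ (G.dartPath d (k d + t d))}

variable {G}

theorem IsDual.nonempty_crossingData {H : TorusGraph Λ F E} (h : G.IsDual H) :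
    Nonempty (G.CrossingData H) := by
  choose k hk t ht l hl s hs heq him hinter using h.cross
  have hc : ∀ e, G.IsCrossing H (e, true) (k e) (t e) (l e) (s e) := fun e =>
    ⟨hk e, ht e, hl e, hs e, by
      rw [G.dartPath_true e (Ioo_subset_Icc_self (ht e)),
        H.dartPath_true e (Ioo_subset_Icc_self (hs e)), heq e], him e⟩
  refine ⟨⟨fun d => if d.2 then k d.1 else G.len d.1 - 1 - k d.1,
    fun d => if d.2 then t d.1 else 1 - t d.1,
    fun d => if d.2 then l d.1 else H.len d.1 - 1 - l d.1,
    fun d => if d.2 then s d.1 else 1 - s d.1, ?_, ?_, ?_, ?_, ?_, ?_⟩⟩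
  · rintro ⟨e, b⟩
    cases b
    · exact IsCrossing.rev G (hc e)
    · simpa using hc e
  case refine_6 =>
    rintro ⟨e, b⟩
    have h1 := G.dartPath_true e (k := k e) (Ioo_subset_Icc_self (ht e))
    cases b
    · have h2 := G.dartPath_rev_add (e, true) (hk e) (Ioo_subset_Icc_self (ht e))
      simp only [ODart.rev] at h2
      simp only [Bool.false_eq_true, if_false]
      rw [hinter e, show (e, false) = (e, !true) from rfl, h2, h1]
    · simp only [if_true]
      rw [hinter e, h1]
  all_goals
    rintro ⟨e, b⟩
    have := hk e
    have := hl e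
    cases b <;> simp [ODart.rev] <;> omega

namespace CrossingData

variable {H : TorusGraph Λ F E} (C : G.CrossingData H)

/-- The displacement from the origin of an oriented edge along this edge to the crossing, and back
along the dual edge to its origin. -/
noncomputable def shift (d : ODart E) : ℂ :=
  (G.dartPath d (C.k d + C.t d) - G.dartCorner d 0) -
    (H.dartPath d (C.l d + C.s d) - H.dartCorner d 0)

/-- Both sides are the displacement from the origin of `d` to the crossing, and from there along the
dual edge to its terminus; the pieces traversed back and forth cancel. -/
theorem shift_add_disp (d : ODart E) : C.shift d + H.disp d = G.disp d + C.shift d.rev := by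
  have h := C.isCrossing d
  rw [shift, shift, C.k_rev, C.t_rev, C.l_rev, C.s_rev,
    G.dartPath_rev_add d h.lt_len (Ioo_subset_Icc_self h.mem),
    H.dartPath_rev_add d h.lt_len_dual (Ioo_subset_Icc_self h.mem_dual), disp, disp,
    G.dartCorner_rev d (Nat.zero_le _), H.dartCorner_rev d (Nat.zero_le _)]
  simp
  ring

end CrossingData

variable (G)

/-- The total rotation along an oriented edge, up to its `k`-th segment. -/
noncomputable def bendTo (d : ODart E) (k : ℕ) : ℝ :=
  ∑ j ∈ Finset.range k, Complex.arg ((G.dartCorner d (j + 2) - G.dartCorner d (j + 1)) /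
    (G.dartCorner d (j + 1) - G.dartCorner d j))

theorem bendTo_rev (d : ODart E) {k : ℕ} (hk : k < G.len d.1) :
    G.bendTo d.rev (G.len d.1 - 1 - k) = G.bendTo d k - G.bend d := by
  have h1 : G.bend d = G.bendTo d k + ∑ j ∈ Finset.range (G.len d.1 - 1 - k),
      Complex.arg ((G.dartCorner d (k + j + 2) - G.dartCorner d (k + j + 1)) /
        (G.dartCorner d (k + j + 1) - G.dartCorner d (k + j))) := by
    rw [bend, bendTo, show G.len d.1 - 1 = k + (G.len d.1 - 1 - k) by omega, Finset.sum_range_add]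
    simp
  rw [h1, sub_add_cancel_left, ← Finset.sum_neg_distrib, bendTo, ← Finset.sum_range_reflect]
  refine Finset.sum_congr rfl fun j hj => ?_
  rw [Finset.mem_range] at hj
  have hk' : k + j + 1 < G.len d.1 := by omega
  rw [G.dartCorner_rev d (by omega), G.dartCorner_rev d (by omega), G.dartCorner_rev d (by omega),
    ← arg_inv_of_mem_slitPlane (G.dartCorner_turn_mem_slitPlane d hk'), inv_div,
    show G.len d.1 - (G.len d.1 - 1 - k - 1 - j + 2) = k + j by omega,
    show G.len d.1 - (G.len d.1 - 1 - k - 1 - j + 1) = k + j + 1 by omega,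
    show G.len d.1 - (G.len d.1 - 1 - k - 1 - j) = k + j + 2 by omega,
    ← neg_sub (G.dartCorner d (k + j + 1)), ← neg_sub (G.dartCorner d (k + j + 2)), neg_div_neg_eq]

variable {G}

namespace CrossingData

variable {H : TorusGraph Λ F E} (C : G.CrossingData H)

/-- The angle in `(-π, 0)` from an oriented edge to its dual, at their crossing. -/
noncomputable def crossAngle (d : ODart E) : ℝ :=
  Complex.arg ((H.dartCorner d (C.l d + 1) - H.dartCorner d (C.l d)) /
    (G.dartCorner d (C.k d + 1) - G.dartCorner d (C.k d)))

theorem crossAngle_rev (d : ODart E) : C.crossAngle d.rev = C.crossAngle d := by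
  have h1 := (C.isCrossing d).lt_len
  have h2 := (C.isCrossing d).lt_len_dual
  rw [crossAngle, C.k_rev, C.l_rev, G.dartCorner_rev d (by omega), G.dartCorner_rev d (by omega),
    H.dartCorner_rev d (by omega),
    H.dartCorner_rev d (by omega), show G.len d.1 - (G.len d.1 - 1 - C.k d + 1) = C.k d by omega,
    show G.len d.1 - (G.len d.1 - 1 - C.k d) = C.k d + 1 by omega,
    show H.len d.1 - (H.len d.1 - 1 - C.l d + 1) = C.l d by omega,
    show H.len d.1 - (H.len d.1 - 1 - C.l d) = C.l d + 1 by omega,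
    ← neg_sub (H.dartCorner d (C.l d + 1)), ← neg_sub (G.dartCorner d (C.k d + 1)), neg_div_neg_eq]
  rfl

/-- The total rotation from the origin of an oriented edge along this edge to the crossing, and
back along the dual edge to its origin. -/
noncomputable def shiftAngle (d : ODart E) : ℝ :=
  G.bendTo d (C.k d) + C.crossAngle d - H.bendTo d (C.l d)

/-- The same cancellation for rotations, using that the angle of the crossing does not depend on the
common orientation. -/
theorem shiftAngle_add_bend (d : ODart E) :
    C.shiftAngle d + H.bend d = G.bend d + C.shiftAngle d.rev := by
  have h := C.isCrossing d
  rw [shiftAngle, shiftAngle, C.k_rev, C.l_rev, C.crossAngle_rev, G.bendTo_rev d h.lt_len,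
    H.bendTo_rev d h.lt_len_dual]
  ring

/-- The duality of Kac-Ward determinants, reduced to the displacement and the rotation along the
boundaries of the pieces of the faces of `G` between consecutive oriented edges. -/
theorem kwDet_dual [DiscreteTopology Λ] [IsZLattice ℝ Λ] [Fintype V] [Fintype F] [Fintype E]
    [DecidableEq E] (hG : Function.Surjective G.origin) (hH : Function.Surjective H.origin)
    (horder : ∀ d d', G.IsNext d d' → H.IsNext d'.rev d)
    (hshift : ∀ d d', G.IsNext d d' → C.shift d = G.disp d' + C.shift d'.rev)
    (hangle : ∀ d d', G.IsNext d d' → ∃ m : ℤ,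
      ccwAngle (H.startDir d'.rev) (H.startDir d) + ccwAngle (G.startDir d) (G.startDir d') +
        C.shiftAngle d'.rev + G.bend d' - C.shiftAngle d = Real.pi + 4 * Real.pi * m)
    (x y : E → ℝ) (hx : ∀ e, 0 < x e) (hxy : ∀ e, x e + y e + x e * y e = 1)
    (χ : Multiplicative Λ →* ℂˣ) {φ φ' : ODart E → ℂˣ} (hφ : G.Represents χ φ)
    (hφ' : H.Represents χ φ') :
    (2 : ℂ) ^ Fintype.card V * (∏ e, (1 + (x e : ℂ))⁻¹) * G.kwDet φ x =
      (2 : ℂ) ^ Fintype.card F * (∏ e, (1 + (y e : ℂ))⁻¹) * H.kwDet φ' y := by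
  obtain ⟨X, hX⟩ := exists_extend_character Λ χ
  obtain ⟨a, ha⟩ := hφ.exists_potential G hX
  obtain ⟨b, hb⟩ := hφ'.exists_potential H hX
  -- The transport of the class from the origin of `d` through the crossing to the origin of the
  -- dual edge, corrected by the potentials of the two cocycles. Together with half of
  -- `C.shiftAngle` it is the gauge that identifies the two systems.
  set h : ODart E → ℂˣ := fun d =>
    X (Multiplicative.ofAdd (C.shift d)) * b (H.origin d) * (a (G.origin d))⁻¹ with hh
  have hnext : ∀ d, H.rotation.next (G.rotation.next d).rev = d := fun d =>
    IsNext.unique H (H.isNext_next _) (horder _ _ (G.isNext_next d))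
  rw [kwDet, kwDet, kwT_eq, kwT_eq]
  refine AngularRotation.kacWard_dual G.rotation H.rotation hG hH _ _
    (fun d => h d * Complex.exp (Complex.I / 2 * (C.shiftAngle d : ℂ)))
    (fun d => mul_ne_zero (Units.ne_zero _) (Complex.exp_ne_zero _)) (holonomy_mul_rev G hφ.1) ?_
    hnext ?_ _ _ (fun e => ?_) (fun e => by exact_mod_cast hxy e)
  · intro d
    have e1 : h d * φ' d = φ d * h d.rev := by
      simp only [hh, ha d, hb d, origin_rev]
      have : X (Multiplicative.ofAdd (C.shift d)) * X (Multiplicative.ofAdd (H.disp d)) =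
          X (Multiplicative.ofAdd (G.disp d)) * X (Multiplicative.ofAdd (C.shift d.rev)) := by
        rw [← map_mul X, ← map_mul X, ← ofAdd_add, ← ofAdd_add, C.shift_add_disp]
      calc _ = (X (Multiplicative.ofAdd (C.shift d)) * X (Multiplicative.ofAdd (H.disp d))) *
            b (H.terminus d) * (a (G.origin d))⁻¹ * (b (H.origin d) * (b (H.origin d))⁻¹) := by
              simp only [mul_comm, mul_left_comm, mul_assoc]
        _ = (X (Multiplicative.ofAdd (G.disp d)) * X (Multiplicative.ofAdd (C.shift d.rev))) *
            b (H.terminus d) * (a (G.origin d))⁻¹ * (a (G.terminus d) * (a (G.terminus d))⁻¹) := by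
              rw [this, mul_inv_cancel, mul_inv_cancel]
        _ = _ := by simp only [mul_comm, mul_left_comm, mul_assoc]
    have e2 := C.shiftAngle_add_bend d
    have e1' : (h d : ℂ) * φ' d = φ d * h d.rev := by exact_mod_cast congrArg Units.val e1
    simp only [holonomy]
    calc _ = ((h d : ℂ) * φ' d) *
        Complex.exp (Complex.I / 2 * ((C.shiftAngle d + H.bend d : ℝ) : ℂ)) := by
          push_cast; rw [mul_add, Complex.exp_add]; ring
      _ = _ := by rw [e1', e2]; push_cast; rw [mul_add, Complex.exp_add]; ring
  · intro d
    set d' := G.rotation.next d with hd'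
    have hn : G.IsNext d d' := G.isNext_next d
    have hn' := horder _ _ hn
    have e1 : h d'.rev = φ d'.rev * h d := by
      have e : C.shift d'.rev = G.disp d'.rev + C.shift d := by
        rw [hshift d d' hn, disp_rev]; ring
      simp only [hh, ha d'.rev, e, ofAdd_add, map_mul, terminus_rev, hn.1, hn'.1]
      rw [show X (Multiplicative.ofAdd (G.disp d'.rev)) * a (G.origin d) * (a (G.origin d'.rev))⁻¹ *
        (X (Multiplicative.ofAdd (C.shift d)) * b (H.origin d'.rev) * (a (G.origin d))⁻¹) =
        X (Multiplicative.ofAdd (G.disp d'.rev)) * X (Multiplicative.ofAdd (C.shift d)) *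
          b (H.origin d'.rev) * (a (G.origin d'.rev))⁻¹ * (a (G.origin d) * (a (G.origin d))⁻¹) by
          simp only [mul_comm, mul_left_comm, mul_assoc], mul_inv_cancel, mul_one]
    have e1' : (h d'.rev : ℂ) = φ d'.rev * h d := by exact_mod_cast congrArg Units.val e1
    obtain ⟨m, hm⟩ := hangle d d' hn
    have hH' : H.rotation.angle d'.rev d = ccwAngle (H.startDir d'.rev) (H.startDir d) := rfl
    have hG' : G.rotation.angle d d' = ccwAngle (G.startDir d) (G.startDir d') := rfl
    rw [hH', hG', e1', holonomy, bend_rev]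
    have hexp : Complex.exp (Complex.I / 2 * (C.shiftAngle d'.rev : ℂ)) *
        Complex.exp (Complex.I / 2 * (ccwAngle (H.startDir d'.rev) (H.startDir d) : ℂ)) *
        Complex.exp (Complex.I / 2 * (ccwAngle (G.startDir d) (G.startDir d') : ℂ)) =
        Complex.I * Complex.exp (Complex.I / 2 * ((-G.bend d' : ℝ) : ℂ)) *
          Complex.exp (Complex.I / 2 * (C.shiftAngle d : ℂ)) := by
      -- Since angles are halved, they matter modulo 4π: the term 4πm disappears and the term π
      -- becomes the factor i.
      have e3 : Complex.exp ((m : ℂ) * (2 * Real.pi * Complex.I)) = 1 :=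
        Complex.exp_int_mul_two_pi_mul_I m
      have e4 := AngularRotation.exp_half_pi (Real.pi : ℂ) rfl
      calc _ = Complex.exp (Complex.I / 2 * (Real.pi : ℂ) + Complex.I / 2 * ((-G.bend d' : ℝ) : ℂ) +
            Complex.I / 2 * (C.shiftAngle d : ℂ) + (m : ℂ) * (2 * Real.pi * Complex.I)) := by
            rw [← Complex.exp_add, ← Complex.exp_add]
            congr 1
            have hmC := congrArg (fun r : ℝ => (r : ℂ)) hm
            push_cast at hmC ⊢
            linear_combination (Complex.I / 2) * hmC
        _ = _ := by rw [Complex.exp_add, e3, Complex.exp_add, Complex.exp_add, e4, mul_one]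
    linear_combination (φ d'.rev * h d : ℂ) * hexp
  · have := hx e
    exact_mod_cast (by positivity : 1 + x e ≠ 0)

end CrossingData

end TorusGraph

/-! ### Concatenation and truncation of polygonal paths -/

/-- The total rotation of a polygonal path with `n` segments. -/
noncomputable def polyRotation (z : ℕ → ℂ) (n : ℕ) : ℝ :=
  ∑ j ∈ Finset.range (n - 1), Complex.arg ((z (j + 2) - z (j + 1)) / (z (j + 1) - z j))

theorem lineMap_ne_of_injOn {z : ℕ → ℂ} {n : ℕ} (h : InjOn (polyline z) (Ico 0 n)) {k : ℕ}
    (hk : k < n) : z k ≠ z (k + 1) := by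
  intro h'
  have hk' : (k : ℝ) + 1 ≤ n := by exact_mod_cast hk
  have hk0 : (0 : ℝ) ≤ k := Nat.cast_nonneg k
  have h1 : (1 / 2 : ℝ) ∈ Icc (0 : ℝ) 1 := by norm_num
  have h2 : (1 / 3 : ℝ) ∈ Icc (0 : ℝ) 1 := by norm_num
  have := @h (k + 1 / 2) ⟨by linarith, by linarith⟩ (k + 1 / 3)
    ⟨by linarith, by linarith⟩ (by rw [polyline_add z k h1, polyline_add z k h2, h']; simp)
  norm_num at this

theorem turn_mem_slitPlane_of_injOn {z : ℕ → ℂ} {n : ℕ} (h : InjOn (polyline z) (Ico 0 n)) {k : ℕ}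
    (hk : k + 1 < n) : (z (k + 2) - z (k + 1)) / (z (k + 1) - z k) ∈ Complex.slitPlane := by
  refine div_mem_slitPlane_of_lineMap_ne (lineMap_ne_of_injOn h (by omega))
    (lineMap_ne_of_injOn h hk) fun t ht t' ht' he => ?_
  have hk' : (k : ℝ) + 1 + 1 ≤ n := by exact_mod_cast hk
  have hk0 : (0 : ℝ) ≤ k := Nat.cast_nonneg k
  rw [← polyline_add z k (Ioo_subset_Icc_self ht),
    ← polyline_add z (k + 1) (Ioo_subset_Icc_self ht')] at he
  have := h ⟨by linarith [ht.1], by linarith [ht.2]⟩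
    ⟨by push_cast; linarith [ht'.1], by push_cast; linarith [ht'.2]⟩ he
  push_cast at this
  linarith [ht.2, ht'.1]

theorem polyRotation_congr {z w : ℕ → ℂ} {n : ℕ} (h : ∀ j ≤ n, z j = w j) :
    polyRotation z n = polyRotation w n := by
  refine Finset.sum_congr rfl fun j hj => ?_
  rw [Finset.mem_range] at hj
  rw [h j (by omega), h (j + 1) (by omega), h (j + 2) (by omega)]

theorem polyRotation_translate (z : ℕ → ℂ) (c : ℂ) (n : ℕ) :
    polyRotation (fun j => z j + c) n = polyRotation z n := by
  simp [polyRotation]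

theorem polyline_translate (z : ℕ → ℂ) (c : ℂ) {s : ℝ} (hs : 0 ≤ s) :
    polyline (fun j => z j + c) s = polyline z s + c := by
  obtain ⟨k, t, ht, rfl⟩ := exists_eq_natCast_add hs
  rw [polyline_add _ k (Ico_subset_Icc_self ht), polyline_add _ k (Ico_subset_Icc_self ht)]
  simp only [AffineMap.lineMap_apply_module']
  simp only [add_sub_add_right_eq_sub]
  ring

theorem polyRotation_reverse {z : ℕ → ℂ} {n : ℕ} (h : InjOn (polyline z) (Ico 0 n)) :
    polyRotation (fun j => z (n - j)) n = -polyRotation z n := by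
  unfold polyRotation
  rw [← Finset.sum_neg_distrib, ← Finset.sum_range_reflect]
  refine Finset.sum_congr rfl fun k hk => ?_
  rw [Finset.mem_range] at hk
  simp only
  rw [← TorusGraph.arg_inv_of_mem_slitPlane (turn_mem_slitPlane_of_injOn h (k := k) (by omega)),
    inv_div, show n - (n - 1 - 1 - k + 2) = k by omega,
    show n - (n - 1 - 1 - k + 1) = k + 1 by omega, show n - (n - 1 - 1 - k) = k + 2 by omega,
    ← neg_sub (z (k + 1)), ← neg_sub (z (k + 2)), neg_div_neg_eq]

/-- The concatenation of two polygonal paths, the first one with `n` segments. -/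
def polyConcat (z : ℕ → ℂ) (n : ℕ) (w : ℕ → ℂ) (j : ℕ) : ℂ := if j ≤ n then z j else w (j - n)

theorem polyConcat_left {z w : ℕ → ℂ} {n j : ℕ} (h : j ≤ n) : polyConcat z n w j = z j := if_pos h

theorem polyConcat_right {z w : ℕ → ℂ} {n : ℕ} (h : z n = w 0) (j : ℕ) :
    polyConcat z n w (n + j) = w j := by
  rcases Nat.eq_zero_or_pos j with rfl | hj
  · rw [add_zero, polyConcat_left le_rfl, h]
  · rw [polyConcat, if_neg (by omega), Nat.add_sub_cancel_left]

theorem polyRotation_concat {z w : ℕ → ℂ} {n m : ℕ} (h : z n = w 0) (hn : 0 < n) (hm : 0 < m) :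
    polyRotation (polyConcat z n w) (n + m) = polyRotation z n +
      Complex.arg ((w 1 - w 0) / (z n - z (n - 1))) + polyRotation w m := by
  have e : n + m - 1 = (n - 1) + 1 + (m - 1) := by omega
  rw [polyRotation, e, Finset.sum_range_add, Finset.sum_range_succ]
  congr 1
  · congr 1
    · refine Finset.sum_congr rfl fun j hj => ?_
      rw [Finset.mem_range] at hj
      rw [polyConcat_left (by omega), polyConcat_left (by omega), polyConcat_left (by omega)]
    · rw [show n - 1 + 2 = n + 1 by omega, show n - 1 + 1 = n + 0 by omega, polyConcat_right h,
        polyConcat_right h, polyConcat_left (by omega), h]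
  · refine Finset.sum_congr rfl fun j hj => ?_
    rw [show n - 1 + 1 + j + 2 = n + (j + 2) by omega, show n - 1 + 1 + j + 1 = n + (j + 1) by omega,
      show n - 1 + 1 + j = n + j by omega, polyConcat_right h, polyConcat_right h,
      polyConcat_right h]

theorem polyline_concat_left {z w : ℕ → ℂ} {n : ℕ} (hn : 0 < n) {s : ℝ} (hs : s ∈ Icc (0 : ℝ) n) :
    polyline (polyConcat z n w) s = polyline z s :=
  polyline_congr hn (fun _ => polyConcat_left) hs

theorem polyline_concat_right {z w : ℕ → ℂ} {n : ℕ} (h : z n = w 0) {s : ℝ} (hs : 0 ≤ s) :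
    polyline (polyConcat z n w) (n + s) = polyline w s := by
  obtain ⟨k, t, ht, rfl⟩ := exists_eq_natCast_add hs
  rw [← add_assoc, ← Nat.cast_add, polyline_add _ _ (Ico_subset_Icc_self ht),
    polyline_add _ _ (Ico_subset_Icc_self ht), polyConcat_right h, add_assoc, polyConcat_right h]

theorem injOn_concat {z w : ℕ → ℂ} {n m : ℕ} (h : z n = w 0) (hn : 0 < n)
    (hz : InjOn (polyline z) (Icc 0 n)) (hw : InjOn (polyline w) (Icc 0 m))
    (hzw : ∀ s ∈ Ico (0 : ℝ) n, ∀ t ∈ Icc (0 : ℝ) m, polyline z s ≠ polyline w t) :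
    InjOn (polyline (polyConcat z n w)) (Icc 0 (n + m : ℕ)) := by
  have key : ∀ s ∈ Icc (0 : ℝ) (n + m : ℕ), ∀ t ∈ Icc (0 : ℝ) (n + m : ℕ), s ≤ t →
      polyline (polyConcat z n w) s = polyline (polyConcat z n w) t → s = t := by
    intro s hs t ht hst he
    push_cast at hs ht
    rcases le_or_gt t n with h1 | h1
    · rw [polyline_concat_left hn ⟨hs.1, hst.trans h1⟩, polyline_concat_left hn ⟨ht.1, h1⟩] at he
      exact hz ⟨hs.1, hst.trans h1⟩ ⟨ht.1, h1⟩ he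
    · rw [show t = n + (t - n) by ring, polyline_concat_right h (by linarith)] at he
      rcases lt_or_ge s n with h2 | h2
      · rw [polyline_concat_left hn ⟨hs.1, h2.le⟩] at he
        exact absurd he (hzw s ⟨hs.1, h2⟩ _ ⟨by linarith, by linarith [ht.2]⟩)
      · rw [show s = n + (s - n) by ring, polyline_concat_right h (by linarith)] at he
        have := hw ⟨by linarith, by linarith [hs.2]⟩ ⟨by linarith, by linarith [ht.2]⟩ he
        linarith
  intro s hs t ht he
  rcases le_total s t with hst | hst
  · exact key s hs t ht hst he
  · exact (key t ht s hs hst he.symm).symm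

/-- Only interior points of the second path need to avoid the first one: its ends may be the joint
and the closing point. -/
theorem injOn_concat_closed {z w : ℕ → ℂ} {n m : ℕ} (h : z n = w 0) (hn : 0 < n)
    (hz : InjOn (polyline z) (Icc 0 n)) (hw : InjOn (polyline w) (Icc 0 m))
    (hzw : ∀ s ∈ Icc (0 : ℝ) n, ∀ t ∈ Ioo (0 : ℝ) m, polyline z s ≠ polyline w t) :
    InjOn (polyline (polyConcat z n w)) (Ico 0 (n + m : ℕ)) := by
  have key : ∀ s ∈ Ico (0 : ℝ) (n + m : ℕ), ∀ t ∈ Ico (0 : ℝ) (n + m : ℕ), s ≤ t →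
      polyline (polyConcat z n w) s = polyline (polyConcat z n w) t → s = t := by
    intro s hs t ht hst he
    push_cast at hs ht
    rcases le_or_gt t n with h1 | h1
    · rw [polyline_concat_left hn ⟨hs.1, hst.trans h1⟩, polyline_concat_left hn ⟨ht.1, h1⟩] at he
      exact hz ⟨hs.1, hst.trans h1⟩ ⟨ht.1, h1⟩ he
    · rw [show t = n + (t - n) by ring, polyline_concat_right h (by linarith)] at he
      rcases le_or_gt s n with h2 | h2
      · rw [polyline_concat_left hn ⟨hs.1, h2⟩] at he
        exact absurd he (hzw s ⟨hs.1, h2⟩ _ ⟨by linarith, by linarith [ht.2]⟩)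
      · rw [show s = n + (s - n) by ring, polyline_concat_right h (by linarith)] at he
        have := hw ⟨by linarith, by linarith [hs.2]⟩ ⟨by linarith, by linarith [ht.2]⟩ he
        linarith
  intro s hs t ht he
  rcases le_total s t with hst | hst
  · exact key s hs t ht hst he
  · exact (key t ht s hs hst he.symm).symm

/-- Extending the corners periodically makes the turn at the closing point the last term of the sum
over one period. -/
theorem polyRotation_closed {z : ℕ → ℂ} {n : ℕ} (hn : 0 < n) (hz : z n = z 0)
    (hinj : InjOn (polyline z) (Ico 0 n)) :
    ∃ m : ℤ, polyRotation z n + Complex.arg ((z 1 - z 0) / (z n - z (n - 1))) =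
      2 * Real.pi * (2 * m + 1) := by
  have hw : ∀ j ≤ n, z (j % n) = z j := by
    intro j hj
    rcases eq_or_lt_of_le hj with rfl | hj
    · rw [Nat.mod_self, hz]
    · rw [Nat.mod_eq_of_lt hj]
  obtain ⟨m, hm⟩ := rotation_closed_polygon (z := fun j => z (j % n)) hn (by simp) (by
    refine hinj.congr fun s hs => ?_
    exact polyline_congr hn (fun j hj => (hw j hj).symm) ⟨hs.1, hs.2.le⟩)
  refine ⟨m, ?_⟩
  have h1 : z 1 = z ((n - 1 + 2) % n) := by
    rw [show n - 1 + 2 = 1 + n by omega, Nat.add_mod_right]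
    exact (hw 1 hn).symm
  rw [← hm, show n = (n - 1) + 1 by omega, Finset.sum_range_succ, ← show n = (n - 1) + 1 by omega]
  congr 1
  · exact polyRotation_congr fun j hj => (hw j hj).symm
  · rw [hw n le_rfl, hw (n - 1) (by omega), ← hz, ← h1]

/-- The initial piece of a polygonal path, up to the point of parameter `t` of the `k`-th
segment. -/
noncomputable def polyTrunc (z : ℕ → ℂ) (k : ℕ) (t : ℝ) (j : ℕ) : ℂ :=
  if j ≤ k then z j else AffineMap.lineMap (z k) (z (k + 1)) t

section Trunc

variable (z : ℕ → ℂ) (k : ℕ)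

theorem polyTrunc_zero (t : ℝ) : polyTrunc z k t 0 = z 0 := if_pos (Nat.zero_le _)

theorem polyTrunc_last {t : ℝ} (ht : t ∈ Ioo (0 : ℝ) 1) : polyTrunc z k t (k + 1) = polyline z (k + t) := by
  rw [polyline_add _ _ (Ioo_subset_Icc_self ht)]
  exact if_neg (by omega)

theorem polyTrunc_sub (t : ℝ) :
    polyTrunc z k t (k + 1) - polyTrunc z k t k = (t : ℂ) * (z (k + 1) - z k) := by
  rw [polyTrunc, polyTrunc, if_neg (by omega), if_pos le_rfl, AffineMap.lineMap_apply_module']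
  simp

theorem exists_polyTrunc_one_sub {t : ℝ} (ht : t ∈ Ioo (0 : ℝ) 1) :
    ∃ c : ℝ, 0 < c ∧ polyTrunc z k t 1 - polyTrunc z k t 0 = (c : ℂ) * (z 1 - z 0) := by
  rcases Nat.eq_zero_or_pos k with rfl | hk
  · exact ⟨t, ht.1, polyTrunc_sub z 0 t⟩
  · exact ⟨1, one_pos, by rw [polyTrunc, polyTrunc, if_pos (by omega), if_pos (by omega)]; simp⟩

theorem polyRotation_trunc {t : ℝ} (ht : t ∈ Ioo (0 : ℝ) 1) : polyRotation (polyTrunc z k t) (k + 1) =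
    ∑ j ∈ Finset.range k, Complex.arg ((z (j + 2) - z (j + 1)) / (z (j + 1) - z j)) := by
  refine Finset.sum_congr rfl fun j hj => ?_
  simp only [Finset.mem_range] at hj
  have e1 : polyTrunc z k t j = z j := if_pos (by omega)
  have e2 : polyTrunc z k t (j + 1) = z (j + 1) := if_pos (by omega)
  rcases Nat.lt_or_ge (j + 1) k with h | h
  · have e3 : polyTrunc z k t (j + 2) = z (j + 2) := if_pos (by omega)
    rw [e1, e2, e3]
  · obtain rfl : k = j + 1 := by omega
    rw [polyTrunc_sub, e1, e2, mul_div_assoc, Complex.arg_real_mul _ ht.1]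

/-- A truncated path is a reparametrization of an initial piece of the path. -/
theorem exists_polyline_trunc_eq {t : ℝ} (ht : t ∈ Ioo (0 : ℝ) 1) : ∃ r : ℝ → ℝ, StrictMono r ∧ r 0 = 0 ∧
    r (k + 1 : ℕ) = k + t ∧ ∀ s ∈ Icc (0 : ℝ) (k + 1 : ℕ),
      polyline (polyTrunc z k t) s = polyline z (r s) := by
  refine ⟨fun s => if s ≤ k then s else k + t * (s - k), ?_, ?_, ?_, ?_⟩
  · intro a b hab
    simp only
    split_ifs with h1 h2 h2
    · exact hab
    · push Not at h2
      have := mul_pos ht.1 (sub_pos.mpr h2)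
      linarith
    · linarith
    · have := mul_lt_mul_of_pos_left hab ht.1
      linarith
  · simp
  · push_cast
    rw [if_neg (by linarith)]
    ring
  · intro s hs
    simp only
    split_ifs with h
    · rcases Nat.eq_zero_or_pos k with rfl | hk
      · have : s = ((0 : ℕ) : ℝ) := le_antisymm h (by simpa using hs.1)
        rw [this, polyline_natCast, polyline_natCast, polyTrunc_zero]
      · exact polyline_congr hk (fun j hj => if_pos hj) ⟨hs.1, h⟩
    · push Not at h
      have h1 : s - k ∈ Icc (0 : ℝ) 1 := ⟨by linarith, by have := hs.2; push_cast at this; linarith⟩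
      have h2 : t * (s - k) ∈ Icc (0 : ℝ) 1 :=
        ⟨mul_nonneg ht.1.le h1.1, mul_le_one₀ ht.2.le h1.1 h1.2⟩
      nth_rewrite 1 [show s = k + (s - k) by ring]
      rw [polyline_add _ _ h1, polyline_add _ _ h2, polyTrunc, polyTrunc, if_pos le_rfl,
        if_neg (by omega)]
      simp only [AffineMap.lineMap_apply_module', Complex.real_smul]
      push_cast
      ring

end Trunc

/-! ### Rotation around the corners of the faces -/

namespace TorusGraph

variable {Λ : Submodule ℤ ℂ} {V F E : Type*} (G : TorusGraph Λ V E)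

theorem dartPath_injOn_Ico (d : ODart E) {s s' : ℝ} (hs : s ∈ Ico (0 : ℝ) (G.len d.1))
    (hs' : s' ∈ Ico (0 : ℝ) (G.len d.1))
    (h : Λ.mkQ (G.dartPath d s) = Λ.mkQ (G.dartPath d s')) : s = s' := by
  rcases eq_or_lt_of_le hs.1 with h0 | h0 <;> rcases eq_or_lt_of_le hs'.1 with h0' | h0'
  · rw [← h0, ← h0']
  · rw [← h0, mkQ_dartPath_zero] at h
    exact absurd h.symm (G.mkQ_dartPath_ne_pos d ⟨h0', hs'.2⟩ _)
  · rw [← h0', mkQ_dartPath_zero] at h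
    exact absurd h (G.mkQ_dartPath_ne_pos d ⟨h0, hs.2⟩ _)
  · exact G.dartPath_inj ⟨h0, hs.2⟩ ⟨h0', hs'.2⟩ h

theorem dartPath_eq_zero_of_fst_ne {d d' : ODart E} (hne : d.1 ≠ d'.1) {s s' : ℝ}
    (hs : s ∈ Ico (0 : ℝ) (G.len d.1)) (hs' : s' ∈ Ico (0 : ℝ) (G.len d'.1))
    (h : Λ.mkQ (G.dartPath d s) = Λ.mkQ (G.dartPath d' s')) : s = 0 ∧ s' = 0 := by
  rcases eq_or_lt_of_le hs.1 with h0 | h0 <;> rcases eq_or_lt_of_le hs'.1 with h0' | h0'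
  · exact ⟨h0.symm, h0'.symm⟩
  · rw [← h0, mkQ_dartPath_zero] at h
    exact absurd h.symm (G.mkQ_dartPath_ne_pos d' ⟨h0', hs'.2⟩ _)
  · rw [← h0', mkQ_dartPath_zero] at h
    exact absurd h (G.mkQ_dartPath_ne_pos d ⟨h0, hs.2⟩ _)
  · exact absurd (G.dartPath_inj_fst ⟨h0, hs.2⟩ ⟨h0', hs'.2⟩ h) hne

theorem mkQ_dartPath_mem_edgeSet (d : ODart E) {s : ℝ} (hs : s ∈ Icc (0 : ℝ) (G.len d.1)) :
    Λ.mkQ (G.dartPath d s) ∈ G.edgeSet d.1 := by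
  have key : ∀ (e : E) (s : ℝ), s ∈ Icc (0 : ℝ) (G.len e) →
      Λ.mkQ (G.dartPath (e, true) s) ∈ G.edgeSet e := by
    intro e s hs
    obtain ⟨k, hk, t, ht, rfl⟩ := exists_eq_natCast_add_of_le (G.len_pos e) hs.1 hs.2
    exact ⟨k, hk, t, ht, G.dartPath_true e ht⟩
  rcases d with ⟨e, b⟩
  cases b
  · rw [show (e, false) = ODart.rev (e, true) from rfl, G.dartPath_rev (e, true) hs]
    exact key e _ ⟨by linarith [hs.2], by linarith [hs.1]⟩
  · exact key e s hs

/-- A null-homologous loop of a graph in the torus has odd rotation number. -/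
theorem rotation_loop {a : ODart E} (hdisp : G.disp a = 0) :
    ∃ m : ℤ, G.bend a + ccwAngle (G.startDir a.rev) (G.startDir a) - Real.pi =
      2 * Real.pi * (2 * m + 1) := by
  obtain ⟨m, hm⟩ := polyRotation_closed (z := G.dartCorner a) (G.len_pos a.1) (sub_eq_zero.mp hdisp)
    fun s hs s' hs' h => G.dartPath_injOn_Ico a hs hs' (congrArg _ h)
  refine ⟨m, ?_⟩
  have h1 := ccwAngle_sub_pi (G.startDir_ne_zero a.rev) (G.startDir_ne_zero a)
  rw [← div_neg, ← endDir_eq] at h1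
  rw [add_sub_assoc, h1]
  exact hm

/-- The piece of an oriented edge up to the point of parameter `t` of its `k`-th segment. -/
noncomputable def halfArc (d : ODart E) (k : ℕ) (t : ℝ) : ℕ → ℂ := polyTrunc (G.dartCorner d) k t

theorem add_lt_len {d : ODart E} {k : ℕ} (hk : k < G.len d.1) {t : ℝ} (ht : t ∈ Ioo (0 : ℝ) 1) :
    (k : ℝ) + t < G.len d.1 := (natCast_add_mem_Ioo hk ht).2

theorem exists_halfArc_eq (d : ODart E) {k : ℕ} (hk : k < G.len d.1) {t : ℝ}
    (ht : t ∈ Ioo (0 : ℝ) 1) : ∃ r : ℝ → ℝ, StrictMono r ∧ r 0 = 0 ∧ r (k + 1 : ℕ) = k + t ∧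
      ∀ s ∈ Icc (0 : ℝ) (k + 1 : ℕ), polyline (G.halfArc d k t) s = G.dartPath d (r s) ∧
        r s ∈ Ico (0 : ℝ) (G.len d.1) := by
  obtain ⟨r, h1, h2, h3, h4⟩ := exists_polyline_trunc_eq (G.dartCorner d) k ht
  refine ⟨r, h1, h2, h3, fun s hs => ⟨h4 s hs, ?_, ?_⟩⟩
  · rw [← h2]; exact h1.monotone hs.1
  · refine lt_of_le_of_lt ?_ (G.add_lt_len hk ht)
    rw [← h3]; exact h1.monotone hs.2

theorem injOn_halfArc (d : ODart E) {k : ℕ} (hk : k < G.len d.1) {t : ℝ} (ht : t ∈ Ioo (0 : ℝ) 1) :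
    InjOn (polyline (G.halfArc d k t)) (Icc 0 (k + 1 : ℕ)) := by
  obtain ⟨r, h1, h2, h3, h4⟩ := G.exists_halfArc_eq d hk ht
  intro s hs s' hs' h
  rw [(h4 s hs).1, (h4 s' hs').1] at h
  exact h1.injective (G.dartPath_injOn_Ico d (h4 s hs).2 (h4 s' hs').2 (congrArg _ h))

theorem polyRotation_halfArc (d : ODart E) (k : ℕ) {t : ℝ} (ht : t ∈ Ioo (0 : ℝ) 1) :
    polyRotation (G.halfArc d k t) (k + 1) = G.bendTo d k := polyRotation_trunc _ _ ht

end TorusGraph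

theorem injOn_polyline_translate {z : ℕ → ℂ} {n : ℕ} (h : InjOn (polyline z) (Icc 0 n)) (c : ℂ) :
    InjOn (polyline fun j => z j + c) (Icc 0 n) := by
  intro s hs s' hs' he
  rw [polyline_translate z c hs.1, polyline_translate z c hs'.1] at he
  exact h hs hs' (add_right_cancel he)

theorem injOn_polyline_reverse {z : ℕ → ℂ} {n : ℕ} (hn : 0 < n)
    (h : InjOn (polyline z) (Icc 0 n)) : InjOn (polyline fun j => z (n - j)) (Icc 0 n) := by
  intro s hs s' hs' he
  rw [polyline_reverse (z := z) hn (fun _ _ => rfl) hs,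
    polyline_reverse (z := z) hn (fun _ _ => rfl) hs'] at he
  have := h (⟨by linarith [hs.2], by linarith [hs.1]⟩ : (n : ℝ) - s ∈ Icc (0 : ℝ) n)
    (⟨by linarith [hs'.2], by linarith [hs'.1]⟩ : (n : ℝ) - s' ∈ Icc (0 : ℝ) n) he
  linarith

theorem arg_pos_mul_div {c c' : ℝ} (hc : 0 < c) (hc' : 0 < c') (z w : ℂ) :
    ((c * z) / (c' * w)).arg = (z / w).arg := by
  rw [mul_div_mul_comm, ← Complex.ofReal_div, Complex.arg_real_mul _ (div_pos hc hc')]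

namespace TorusGraph.CrossingData

variable {Λ : Submodule ℤ ℂ} {V F E : Type*} {G : TorusGraph Λ V E} {H : TorusGraph Λ F E}
  (C : G.CrossingData H)

theorem eq_crossing (d : ODart E) {s s' : ℝ} (hs : s ∈ Ico (0 : ℝ) (G.len d.1))
    (hs' : s' ∈ Ico (0 : ℝ) (H.len d.1))
    (h : Λ.mkQ (G.dartPath d s) = Λ.mkQ (H.dartPath d s')) : s = C.k d + C.t d := by
  have h1 := C.inter d ⟨G.mkQ_dartPath_mem_edgeSet d ⟨hs.1, hs.2.le⟩,
    h ▸ H.mkQ_dartPath_mem_edgeSet d ⟨hs'.1, hs'.2.le⟩⟩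
  have hc := C.isCrossing d
  have := natCast_add_mem_Ioo hc.lt_len hc.mem
  exact G.dartPath_injOn_Ico d hs ⟨this.1.le, this.2⟩ h1

theorem eq_crossing_rev (d : ODart E) {s s' : ℝ} (hs : s ∈ Ico (0 : ℝ) (G.len d.1))
    (hs' : s' ∈ Ico (0 : ℝ) (H.len d.1))
    (h : Λ.mkQ (G.dartPath d s) = Λ.mkQ (H.dartPath d.rev s')) : s = C.k d + C.t d := by
  have h1 := C.inter d ⟨G.mkQ_dartPath_mem_edgeSet d ⟨hs.1, hs.2.le⟩,
    h ▸ H.mkQ_dartPath_mem_edgeSet d.rev ⟨hs'.1, hs'.2.le⟩⟩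
  have hc := C.isCrossing d
  have := natCast_add_mem_Ioo hc.lt_len hc.mem
  exact G.dartPath_injOn_Ico d hs ⟨this.1.le, this.2⟩ h1

/-- The rotation along the boundary of the piece of a face of `G` between two consecutive oriented
edges, for distinct edges. -/
theorem rotation_corner_of_fst_ne
    (hdisj : ∀ e e', e ≠ e' → Disjoint (G.edgeSet e) (H.edgeSet e'))
    {d d' : ODart E} (hne : d.1 ≠ d'.1) (ho : G.origin d' = G.origin d)
    (hshift : C.shift d = G.disp d' + C.shift d'.rev) :
    ∃ m : ℤ, ccwAngle (H.startDir d'.rev) (H.startDir d) +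
      ccwAngle (G.startDir d) (G.startDir d') + C.shiftAngle d'.rev + G.bend d' - C.shiftAngle d =
        Real.pi + 4 * Real.pi * m := by
  have c1 := C.isCrossing d
  have c2 := C.isCrossing d'
  have c3 := C.isCrossing d'.rev
  -- The quadrilateral goes from the common origin along `d'` (`A`) to its crossing, back along the
  -- dual (`B`) to the vertex in the face, along the dual of `d` (`P`) to the crossing of `d`, and
  -- back along `d` (`Q`).
  set A := G.halfArc d' (C.k d') (C.t d') with hA
  set B := H.halfArc d'.rev (C.l d'.rev) (C.s d'.rev) with hB
  set P := H.halfArc d (C.l d) (C.s d) with hP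
  set Q := G.halfArc d (C.k d) (C.t d) with hQ
  set nA := C.k d' + 1
  set nB := C.l d'.rev + 1
  set nP := C.l d + 1
  set nQ := C.k d + 1
  have hA0 : A 0 = G.dartCorner d' 0 := polyTrunc_zero _ _ _
  have hB0 : B 0 = H.dartCorner d'.rev 0 := polyTrunc_zero _ _ _
  have hP0 : P 0 = H.dartCorner d 0 := polyTrunc_zero _ _ _
  have hQ0 : Q 0 = G.dartCorner d 0 := polyTrunc_zero _ _ _
  have hAn : A nA = G.dartPath d' (C.k d' + C.t d') := polyTrunc_last _ _ c2.mem
  have hBn : B nB = H.dartPath d'.rev (C.l d'.rev + C.s d'.rev) := polyTrunc_last _ _ c3.mem_dual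
  have hPn : P nP = H.dartPath d (C.l d + C.s d) := polyTrunc_last _ _ c1.mem_dual
  have hQn : Q nQ = G.dartPath d (C.k d + C.t d) := polyTrunc_last _ _ c1.mem
  -- The sides are given by unrelated lifts; these three translations fit them together, with `Q`
  -- kept fixed. They are lattice vectors, so the points in the torus do not change.
  set a := G.dartCorner d 0 - G.dartCorner d' 0 with ha
  set b := A nA + a - B nB with hb
  set c := Q nQ - P nP with hc
  have hmk : ∀ z : ℂ, z ∈ Λ → ∀ w, Λ.mkQ (w + z) = Λ.mkQ w := by
    intro z hz w
    rw [map_add, show Λ.mkQ z = 0 from (Submodule.Quotient.mk_eq_zero Λ).mpr hz, add_zero]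
  have hmem : ∀ {z w : ℂ}, Λ.mkQ z = Λ.mkQ w → z - w ∈ Λ := fun h =>
    (Submodule.Quotient.eq Λ).mp h
  have haΛ : a ∈ Λ := hmem (by
    rw [← dartPath_zero, ← dartPath_zero, mkQ_dartPath_zero, mkQ_dartPath_zero, ho])
  have hbΛ : b ∈ Λ := hmem (by
    rw [hmk a haΛ, hAn, hBn, ← c3.eq, C.k_rev, C.t_rev,
      G.dartPath_rev_add d' c2.lt_len (Ioo_subset_Icc_self c2.mem)])
  have hcΛ : c ∈ Λ := hmem (by rw [hQn, hPn, c1.eq])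
  -- This is where the displacement hypothesis enters: the two dual halves start from the same lift,
  -- so that the quadrilateral closes in the plane.
  have hstart : B 0 + b = P 0 + c := by
    have e1 := G.dartCorner_rev d' (Nat.zero_le _)
    rw [Nat.sub_zero] at e1
    have e2 : G.dartPath d'.rev (C.k d'.rev + C.t d'.rev) = A nA := by
      rw [C.k_rev, C.t_rev, G.dartPath_rev_add d' c2.lt_len (Ioo_subset_Icc_self c2.mem), hAn]
    rw [shift, shift, disp, e1, e2] at hshift
    rw [hB0, hP0, hb, hc, ha, hBn, hPn, hQn]
    linear_combination -hshift
  -- the four sides of the polygon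
  set z₁ : ℕ → ℂ := fun j => A j + a with hz₁
  set z₂ : ℕ → ℂ := fun j => B (nB - j) + b with hz₂
  set z₃ : ℕ → ℂ := fun j => P j + c with hz₃
  set z₄ : ℕ → ℂ := fun j => Q (nQ - j) with hz₄
  have h12 : z₁ nA = z₂ 0 := by simp only [hz₁, hz₂, Nat.sub_zero, hb]; ring
  have h23 : z₂ nB = z₃ 0 := by simp only [hz₂, hz₃, Nat.sub_self]; exact hstart
  have h34 : z₃ nP = z₄ 0 := by simp only [hz₃, hz₄, Nat.sub_zero, hc]; ring
  have h41 : z₄ nQ = z₁ 0 := by simp only [hz₁, hz₄, Nat.sub_self, hA0, hQ0, ha]; ring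
  have iA := G.injOn_halfArc d' c2.lt_len c2.mem
  have iB := H.injOn_halfArc d'.rev c3.lt_len_dual c3.mem_dual
  have iP := H.injOn_halfArc d c1.lt_len_dual c1.mem_dual
  have iQ := G.injOn_halfArc d c1.lt_len c1.mem
  have i1 : InjOn (polyline z₁) (Icc 0 nA) := injOn_polyline_translate iA a
  have i2 : InjOn (polyline z₂) (Icc 0 nB) :=
    injOn_polyline_translate (injOn_polyline_reverse (Nat.succ_pos _) iB) b
  have i3 : InjOn (polyline z₃) (Icc 0 nP) := injOn_polyline_translate iP c
  have i4 : InjOn (polyline z₄) (Icc 0 nQ) := injOn_polyline_reverse (Nat.succ_pos _) iQ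
  -- the points of the sides, in the torus
  obtain ⟨r₁, m1, r10, r1n, r1⟩ := G.exists_halfArc_eq d' c2.lt_len c2.mem
  obtain ⟨r₂, m2, r20, r2n, r2⟩ := H.exists_halfArc_eq d'.rev c3.lt_len_dual c3.mem_dual
  obtain ⟨r₃, m3, r30, r3n, r3⟩ := H.exists_halfArc_eq d c1.lt_len_dual c1.mem_dual
  obtain ⟨r₄, m4, r40, r4n, r4⟩ := G.exists_halfArc_eq d c1.lt_len c1.mem
  have p1 : ∀ s ∈ Icc (0 : ℝ) nA, Λ.mkQ (polyline z₁ s) = Λ.mkQ (G.dartPath d' (r₁ s)) := by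
    intro s hs
    rw [hz₁, polyline_translate A a hs.1, hmk a haΛ, (r1 s hs).1]
  have hrefl : ∀ {n : ℕ} {s : ℝ}, s ∈ Icc (0 : ℝ) n → (n : ℝ) - s ∈ Icc (0 : ℝ) n := fun hs =>
    ⟨by linarith [hs.2], by linarith [hs.1]⟩
  have p2 : ∀ s ∈ Icc (0 : ℝ) nB, Λ.mkQ (polyline z₂ s) =
      Λ.mkQ (H.dartPath d'.rev (r₂ (nB - s))) := by
    intro s hs
    rw [hz₂, polyline_translate (fun j => B (nB - j)) b hs.1, hmk b hbΛ,
      polyline_reverse (z := B) (Nat.succ_pos _) (fun _ _ => rfl) hs, (r2 _ (hrefl hs)).1]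
  have p3 : ∀ s ∈ Icc (0 : ℝ) nP, Λ.mkQ (polyline z₃ s) = Λ.mkQ (H.dartPath d (r₃ s)) := by
    intro s hs
    rw [hz₃, polyline_translate P c hs.1, hmk c hcΛ, (r3 s hs).1]
  have p4 : ∀ s ∈ Icc (0 : ℝ) nQ, Λ.mkQ (polyline z₄ s) = Λ.mkQ (G.dartPath d (r₄ (nQ - s))) := by
    intro s hs
    rw [hz₄, polyline_reverse (z := Q) (Nat.succ_pos _) (fun _ _ => rfl) hs, (r4 _ (hrefl hs)).1]
  have d12 : ∀ s ∈ Ico (0 : ℝ) nA, ∀ t ∈ Icc (0 : ℝ) nB, polyline z₁ s ≠ polyline z₂ t := by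
    intro s hs t ht he
    have hs' := Ico_subset_Icc_self hs
    have h := congrArg Λ.mkQ he
    rw [p1 s hs', p2 t ht] at h
    have h5 := C.eq_crossing_rev d' (r1 s hs').2 (r2 _ (hrefl ht)).2 h
    rw [← r1n] at h5
    exact hs.2.ne (m1.injective h5)
  have d34 : ∀ s ∈ Ico (0 : ℝ) nP, ∀ t ∈ Icc (0 : ℝ) nQ, polyline z₃ s ≠ polyline z₄ t := by
    intro s hs t ht he
    have hs' := Ico_subset_Icc_self hs
    have h := congrArg Λ.mkQ he
    rw [p3 s hs', p4 t ht] at h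
    have h5 := C.eq_crossing d (r4 _ (hrefl ht)).2 (r3 s hs').2 h.symm
    rw [h5, c1.eq] at h
    have c4 := natCast_add_mem_Ioo c1.lt_len_dual c1.mem_dual
    have h6 := H.dartPath_injOn_Ico d (r3 s hs').2 ⟨c4.1.le, c4.2⟩ h
    rw [← r3n] at h6
    exact hs.2.ne (m3.injective h6)
  have d13 : ∀ s ∈ Icc (0 : ℝ) nA, ∀ t ∈ Icc (0 : ℝ) nP, polyline z₁ s ≠ polyline z₃ t := by
    intro s hs t ht he
    have h := congrArg Λ.mkQ he
    rw [p1 s hs, p3 t ht] at h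
    refine Set.disjoint_left.mp (hdisj _ _ hne.symm)
      (G.mkQ_dartPath_mem_edgeSet d' (Ico_subset_Icc_self (r1 s hs).2)) ?_
    rw [h]
    exact H.mkQ_dartPath_mem_edgeSet d (Ico_subset_Icc_self (r3 t ht).2)
  have d24 : ∀ s ∈ Icc (0 : ℝ) nB, ∀ t ∈ Icc (0 : ℝ) nQ, polyline z₂ s ≠ polyline z₄ t := by
    intro s hs t ht he
    have h := congrArg Λ.mkQ he
    rw [p2 s hs, p4 t ht] at h
    refine Set.disjoint_left.mp (hdisj _ _ hne)
      (G.mkQ_dartPath_mem_edgeSet d (Ico_subset_Icc_self (r4 _ (hrefl ht)).2)) ?_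
    rw [← h]
    exact H.mkQ_dartPath_mem_edgeSet d'.rev (Ico_subset_Icc_self (r2 _ (hrefl hs)).2)
  have d14 : ∀ s ∈ Icc (0 : ℝ) nA, ∀ t ∈ Icc (0 : ℝ) nQ, t < nQ → polyline z₁ s ≠ polyline z₄ t := by
    intro s hs t ht htn he
    have h := congrArg Λ.mkQ he
    rw [p1 s hs, p4 t ht] at h
    have h5 := (G.dartPath_eq_zero_of_fst_ne hne.symm (r1 s hs).2 (r4 _ (hrefl ht)).2 h).2
    rw [← r40] at h5
    linarith [m4.injective h5]
  have d23 : ∀ s ∈ Icc (0 : ℝ) nB, ∀ t ∈ Icc (0 : ℝ) nP, 0 < t → polyline z₂ s ≠ polyline z₃ t := by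
    intro s hs t ht htn he
    have h := congrArg Λ.mkQ he
    rw [p2 s hs, p3 t ht] at h
    have h5 := (H.dartPath_eq_zero_of_fst_ne (d := d'.rev) hne.symm (r2 _ (hrefl hs)).2
      (r3 t ht).2 h).2
    rw [← r30] at h5
    linarith [m3.injective h5]
  -- the polygon
  have nA0 : 0 < nA := Nat.succ_pos _
  have nB0 : 0 < nB := Nat.succ_pos _
  have nP0 : 0 < nP := Nat.succ_pos _
  have nQ0 : 0 < nQ := Nat.succ_pos _
  set Z := polyConcat z₁ nA z₂ with hZ
  set W := polyConcat z₃ nP z₄ with hW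
  have iZ : InjOn (polyline Z) (Icc 0 (nA + nB : ℕ)) := injOn_concat h12 nA0 i1 i2 d12
  have iW : InjOn (polyline W) (Icc 0 (nP + nQ : ℕ)) := injOn_concat h34 nP0 i3 i4 d34
  have hZend : Z (nA + nB) = z₂ nB := polyConcat_right h12 _
  have hWend : W (nP + nQ) = z₄ nQ := polyConcat_right h34 _
  have hZ0 : ∀ j ≤ nA, Z j = z₁ j := fun j hj => polyConcat_left hj
  have hW0 : ∀ j ≤ nP, W j = z₃ j := fun j hj => polyConcat_left hj
  have hZW : Z (nA + nB) = W 0 := by rw [hZend, hW0 0 (Nat.zero_le _), h23]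
  have dZW : ∀ s ∈ Icc (0 : ℝ) (nA + nB : ℕ), ∀ t ∈ Ioo (0 : ℝ) (nP + nQ : ℕ),
      polyline Z s ≠ polyline W t := by
    intro s hs t ht
    push_cast at hs ht
    rcases le_or_gt s nA with h1 | h1 <;> rcases le_or_gt t nP with h2 | h2
    · rw [hZ, hW, polyline_concat_left nA0 ⟨hs.1, h1⟩, polyline_concat_left nP0 ⟨ht.1.le, h2⟩]
      exact d13 s ⟨hs.1, h1⟩ t ⟨ht.1.le, h2⟩
    · rw [hZ, hW, polyline_concat_left nA0 ⟨hs.1, h1⟩, show t = nP + (t - nP) by ring,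
        polyline_concat_right h34 (by linarith)]
      exact d14 s ⟨hs.1, h1⟩ _ ⟨by linarith, by linarith [ht.2]⟩ (by linarith [ht.2])
    · rw [hZ, hW, show s = nA + (s - nA) by ring, polyline_concat_right h12 (by linarith),
        polyline_concat_left nP0 ⟨ht.1.le, h2⟩]
      exact d23 _ ⟨by linarith, by linarith [hs.2]⟩ t ⟨ht.1.le, h2⟩ ht.1
    · rw [hZ, hW, show s = nA + (s - nA) by ring, polyline_concat_right h12 (by linarith),
        show t = nP + (t - nP) by ring, polyline_concat_right h34 (by linarith)]
      exact d24 _ ⟨by linarith, by linarith [hs.2]⟩ _ ⟨by linarith, by linarith [ht.2]⟩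
  obtain ⟨m, hm⟩ := polyRotation_closed (z := polyConcat Z (nA + nB) W) (n := nA + nB + (nP + nQ))
    (by omega) (by
      rw [polyConcat_right hZW, hWend, polyConcat_left (Nat.zero_le _), hZ0 0 (Nat.zero_le _), h41])
    (injOn_concat_closed hZW (by omega) iZ iW dZW)
  rw [polyRotation_concat hZW (by omega) (by omega), hZ, hW, polyRotation_concat h12 nA0 nB0,
    polyRotation_concat h34 nP0 nQ0, ← hZ, ← hW] at hm
  have e1 : polyRotation z₁ nA = G.bendTo d' (C.k d') := by
    rw [hz₁, polyRotation_translate, G.polyRotation_halfArc d' _ c2.mem]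
  have e2 : polyRotation z₂ nB = -H.bendTo d'.rev (C.l d'.rev) := by
    rw [hz₂, polyRotation_translate (fun j => B (nB - j)),
      polyRotation_reverse (iB.mono Ico_subset_Icc_self),
      H.polyRotation_halfArc d'.rev _ c3.mem_dual]
  have e3 : polyRotation z₃ nP = H.bendTo d (C.l d) := by
    rw [hz₃, polyRotation_translate, H.polyRotation_halfArc d _ c1.mem_dual]
  have e4 : polyRotation z₄ nQ = -G.bendTo d (C.k d) := by
    rw [hz₄, polyRotation_reverse (iQ.mono Ico_subset_Icc_self), G.polyRotation_halfArc d _ c1.mem]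
  -- the turns at the four corners
  obtain ⟨sA, sA0, hsA⟩ := exists_polyTrunc_one_sub (G.dartCorner d') (C.k d') c2.mem
  obtain ⟨sB, sB0, hsB⟩ := exists_polyTrunc_one_sub (H.dartCorner d'.rev) (C.l d'.rev) c3.mem_dual
  obtain ⟨sP, sP0, hsP⟩ := exists_polyTrunc_one_sub (H.dartCorner d) (C.l d) c1.mem_dual
  obtain ⟨sQ, sQ0, hsQ⟩ := exists_polyTrunc_one_sub (G.dartCorner d) (C.k d) c1.mem
  have tA := polyTrunc_sub (G.dartCorner d') (C.k d') (C.t d')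
  have tB := polyTrunc_sub (H.dartCorner d'.rev) (C.l d'.rev) (C.s d'.rev)
  have tP := polyTrunc_sub (H.dartCorner d) (C.l d) (C.s d)
  have tQ := polyTrunc_sub (G.dartCorner d) (C.k d) (C.t d)
  have hGd : G.dartCorner d 1 - G.dartCorner d 0 = G.startDir d := rfl
  have hGd' : G.dartCorner d' 1 - G.dartCorner d' 0 = G.startDir d' := rfl
  have hHd : H.dartCorner d 1 - H.dartCorner d 0 = H.startDir d := rfl
  have hHd' : H.dartCorner d'.rev 1 - H.dartCorner d'.rev 0 = H.startDir d'.rev := rfl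
  rw [hGd'] at hsA
  rw [hHd'] at hsB
  rw [hHd] at hsP
  rw [hGd] at hsQ
  have hrevdir : H.dartCorner d'.rev (C.l d'.rev + 1) - H.dartCorner d'.rev (C.l d'.rev) =
      -(H.dartCorner d' (C.l d' + 1) - H.dartCorner d' (C.l d')) := by
    have := c2.lt_len_dual
    rw [C.l_rev, H.dartCorner_rev d' (by omega), H.dartCorner_rev d' (by omega),
      show H.len d'.1 - (H.len d'.1 - 1 - C.l d' + 1) = C.l d' by omega,
      show H.len d'.1 - (H.len d'.1 - 1 - C.l d') = C.l d' + 1 by omega]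
    ring
  have a1 : Complex.arg ((z₂ 1 - z₂ 0) / (z₁ nA - z₁ (nA - 1))) = C.crossAngle d' := by
    have x1 : z₂ 1 - z₂ 0 = (C.s d'.rev : ℂ) *
        (H.dartCorner d' (C.l d' + 1) - H.dartCorner d' (C.l d')) := by
      have : z₂ 1 - z₂ 0 = -(B (C.l d'.rev + 1) - B (C.l d'.rev)) := by
        simp only [hz₂, nB, Nat.add_sub_cancel, Nat.sub_zero]; ring
      rw [this, hB, halfArc, tB, hrevdir]; ring
    have x2 : z₁ nA - z₁ (nA - 1) = (C.t d' : ℂ) *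
        (G.dartCorner d' (C.k d' + 1) - G.dartCorner d' (C.k d')) := by
      rw [← tA]
      simp only [hz₁, nA, Nat.add_sub_cancel, hA, halfArc]; ring
    rw [x1, x2, arg_pos_mul_div c3.mem_dual.1 c2.mem.1]
    rfl
  have a2 : Complex.arg ((W 1 - W 0) / (Z (nA + nB) - Z (nA + nB - 1))) =
      ccwAngle (H.startDir d'.rev) (H.startDir d) - Real.pi := by
    have x1 : W 1 - W 0 = (sP : ℂ) * H.startDir d := by
      rw [hW0 1 nP0, hW0 0 nP0.le, ← hsP]
      simp only [hz₃, hP, halfArc]; ring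
    have x2 : Z (nA + nB) - Z (nA + nB - 1) = (sB : ℂ) * (-H.startDir d'.rev) := by
      rw [show nA + nB - 1 = nA + (nB - 1) by omega, hZ, polyConcat_right h12, polyConcat_right h12,
        mul_neg, ← hsB]
      simp only [hz₂, Nat.sub_self, show nB - (nB - 1) = 1 by omega, hB, halfArc]; ring
    rw [x1, x2, arg_pos_mul_div sP0 sB0, div_neg,
      ccwAngle_sub_pi (H.startDir_ne_zero _) (H.startDir_ne_zero _)]
  -- The angle at the crossing is in (-π, 0), so adding π stays within the principal range; the turn
  -- from the dual to the reversed edge is minus the result.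
  have a3 : Complex.arg ((z₄ 1 - z₄ 0) / (z₃ nP - z₃ (nP - 1))) = -C.crossAngle d - Real.pi := by
    have x1 : z₄ 1 - z₄ 0 = (C.t d : ℂ) *
        (-(G.dartCorner d (C.k d + 1) - G.dartCorner d (C.k d))) := by
      rw [mul_neg, ← tQ]
      simp only [hz₄, nQ, Nat.add_sub_cancel, Nat.sub_zero, hQ, halfArc]; ring
    have x2 : z₃ nP - z₃ (nP - 1) = (C.s d : ℂ) *
        (H.dartCorner d (C.l d + 1) - H.dartCorner d (C.l d)) := by
      rw [← tP]
      simp only [hz₃, nP, Nat.add_sub_cancel, hP, halfArc]; ring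
    rw [x1, x2, arg_pos_mul_div c1.mem.1 c1.mem_dual.1, neg_div, crossAngle]
    have him := c1.im_neg
    set q := (H.dartCorner d (C.l d + 1) - H.dartCorner d (C.l d)) /
      (G.dartCorner d (C.k d + 1) - G.dartCorner d (C.k d)) with hq
    have x3 : -((G.dartCorner d (C.k d + 1) - G.dartCorner d (C.k d)) /
      (H.dartCorner d (C.l d + 1) - H.dartCorner d (C.l d))) = (-q)⁻¹ := by
      rw [hq, inv_neg, inv_div]
    have x4 : -q ∈ Complex.slitPlane := by
      rw [Complex.mem_slitPlane_iff]
      right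
      simpa using him.ne
    rw [x3, arg_inv_of_mem_slitPlane x4, Complex.arg_neg_eq_arg_add_pi_of_im_neg him]
    ring
  have a4 : Complex.arg ((polyConcat Z (nA + nB) W 1 - polyConcat Z (nA + nB) W 0) /
      (polyConcat Z (nA + nB) W (nA + nB + (nP + nQ)) -
        polyConcat Z (nA + nB) W (nA + nB + (nP + nQ) - 1))) =
      ccwAngle (G.startDir d) (G.startDir d') - Real.pi := by
    have x1 : polyConcat Z (nA + nB) W 1 - polyConcat Z (nA + nB) W 0 = (sA : ℂ) * G.startDir d' := by
      rw [polyConcat_left (by omega), polyConcat_left (by omega), hZ0 1 nA0, hZ0 0 nA0.le, ← hsA]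
      simp only [hz₁, hA, halfArc]; ring
    have x2 : polyConcat Z (nA + nB) W (nA + nB + (nP + nQ)) -
        polyConcat Z (nA + nB) W (nA + nB + (nP + nQ) - 1) = (sQ : ℂ) * (-G.startDir d) := by
      rw [show nA + nB + (nP + nQ) - 1 = nA + nB + (nP + (nQ - 1)) by omega, polyConcat_right hZW,
        polyConcat_right hZW, hW, polyConcat_right h34, polyConcat_right h34, mul_neg, ← hsQ]
      simp only [hz₄, Nat.sub_self, show nQ - (nQ - 1) = 1 by omega, hQ, halfArc]; ring
    rw [x1, x2, arg_pos_mul_div sA0 sQ0, div_neg,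
      ccwAngle_sub_pi (G.startDir_ne_zero _) (G.startDir_ne_zero _)]
  rw [e1, e2, e3, e4, a1, a2, a3, a4] at hm
  have e5 : C.shiftAngle d'.rev = G.bendTo d' (C.k d') - G.bend d' + C.crossAngle d' -
      H.bendTo d'.rev (C.l d'.rev) := by
    rw [shiftAngle, C.crossAngle_rev, C.k_rev, G.bendTo_rev d' c2.lt_len]
  -- Three of the four corner turns contribute -π, and 2π(2m + 1) + 3π = π + 4π(m + 1).
  refine ⟨m + 1, ?_⟩
  rw [e5, shiftAngle]
  push_cast
  linarith

/-- The rotation along the boundary of the piece of a face of `G` between two consecutive oriented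
edges. -/
theorem rotation_corner (hdisj : ∀ e e', e ≠ e' → Disjoint (G.edgeSet e) (H.edgeSet e'))
    {d d' : ODart E} (ho : G.origin d' = G.origin d)
    (hshift : C.shift d = G.disp d' + C.shift d'.rev) :
    ∃ m : ℤ, ccwAngle (H.startDir d'.rev) (H.startDir d) +
      ccwAngle (G.startDir d) (G.startDir d') + C.shiftAngle d'.rev + G.bend d' - C.shiftAngle d =
        Real.pi + 4 * Real.pi * m := by
  -- With a single edge the quadrilateral degenerates. By the displacement hypothesis, the dual edge
  -- (if `d = d'`) or the edge itself (if `d = d'.rev`) is then a loop that closes in the plane, and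
  -- it replaces the quadrilateral.
  by_cases hne : d.1 = d'.1
  · rcases ODart.eq_or_eq_rev hne with rfl | rfl
    · obtain ⟨m, hm⟩ := H.rotation_loop (a := d) (by
        have := C.shift_add_disp d
        rw [← hshift] at this
        simpa using this)
      refine ⟨m + 1, ?_⟩
      have h1 := C.shiftAngle_add_bend d
      have h2 := ccwAngle_self (G.startDir_ne_zero d)
      push_cast
      linarith
    · obtain ⟨m, hm⟩ := G.rotation_loop (a := d') (by
        simpa using hshift.symm)
      refine ⟨m + 1, ?_⟩
      have h2 := ccwAngle_self (H.startDir_ne_zero d'.rev)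
      push_cast
      linarith
  · exact C.rotation_corner_of_fst_ne hdisj hne ho hshift

end TorusGraph.CrossingData

/-! ### Components of the complement of a system of segments -/

theorem ccwAngle_exp_mul {u : ℂ} (hu : u ≠ 0) {c ψ : ℝ} (hc : 0 < c) (h0 : 0 < ψ)
    (h1 : ψ ≤ 2 * Real.pi) : ccwAngle u (c * Complex.exp (ψ * Complex.I) * u) = ψ := by
  rw [ccwAngle, mul_div_cancel_right₀ _ hu, Complex.arg_real_mul _ hc, Complex.arg_exp_mul_I,
    toIocMod_eq_iff]
  refine ⟨⟨h0, by rwa [zero_add]⟩, ?_⟩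
  refine ⟨-toIocDiv Real.two_pi_pos (-Real.pi) ψ, ?_⟩
  rw [toIocMod]
  simp only [neg_smul]
  ring

theorem exists_eq_exp_ccwAngle_mul {u v : ℂ} (hu : u ≠ 0) (hv : v ≠ 0) :
    ∃ c : ℝ, 0 < c ∧ v = c * Complex.exp (ccwAngle u v * Complex.I) * u := by
  refine ⟨‖v / u‖, norm_pos_iff.mpr (div_ne_zero hv hu), ?_⟩
  have h1 := Complex.norm_mul_exp_arg_mul_I (v / u)
  have h2 : Complex.exp (ccwAngle u v * Complex.I) = Complex.exp ((v / u).arg * Complex.I) := by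
    rw [Complex.exp_eq_exp_iff_exists_int]
    refine ⟨-toIocDiv Real.two_pi_pos 0 (v / u).arg, ?_⟩
    rw [ccwAngle, toIocMod]
    push_cast [zsmul_eq_mul]
    ring
  rw [h2, h1, div_mul_cancel₀ _ hu]

/-- A locally finite system of oriented segments in the plane, closed under the reversal of
orientations, whose members meet only in their end points. -/
structure SegmentSystem (ι : Type*) where
  a : ι → ℂ
  b : ι → ℂ
  ne : ∀ i, a i ≠ b i
  rev : ι → ι
  a_rev : ∀ i, a (rev i) = b i
  b_rev : ∀ i, b (rev i) = a i
  locallyFinite : LocallyFinite fun i => segment ℝ (a i) (b i)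
  interior : ∀ i j, ∀ t ∈ Ioo (0 : ℝ) 1, AffineMap.lineMap (a i) (b i) t ∈ segment ℝ (a j) (b j) →
    (a j = a i ∧ b j = b i) ∨ (a j = b i ∧ b j = a i)

namespace SegmentSystem

variable {ι : Type*} (S : SegmentSystem ι)

/-- The union of the segments. -/
def carrier : Set ℂ := ⋃ i, segment ℝ (S.a i) (S.b i)

theorem isClosed_segment (i : ι) : IsClosed (segment ℝ (S.a i) (S.b i)) := by
  rw [segment_eq_image_lineMap]
  exact (isCompact_Icc.image (AffineMap.lineMap_continuous)).isClosed

theorem isClosed_carrier : IsClosed S.carrier := S.locallyFinite.isClosed_iUnion S.isClosed_segment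

theorem eventually_mem_segment (p : ℂ) : ∀ᶠ z in 𝓝 p, ∀ i, z ∈ segment ℝ (S.a i) (S.b i) →
    p ∈ segment ℝ (S.a i) (S.b i) :=
  (S.locallyFinite.eventually_subset S.isClosed_segment p).mono fun _ h _ hi => h hi

/-- The point of complex coordinate `ζ` with respect to the segment `i`. -/
def pt (i : ι) (ζ : ℂ) : ℂ := S.a i + ζ * (S.b i - S.a i)

theorem pt_rev (i : ι) (ζ : ℂ) : S.pt (S.rev i) ζ = S.pt i (1 - ζ) := by
  rw [pt, pt, a_rev, b_rev]; ring

theorem continuous_pt (i : ι) : Continuous (S.pt i) := by unfold pt; fun_prop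

theorem lineMap_eq_pt (i : ι) (t : ℝ) : AffineMap.lineMap (S.a i) (S.b i) t = S.pt i t := by
  rw [AffineMap.lineMap_apply_module', pt, Complex.real_smul]; ring

theorem mem_segment_iff (i : ι) (z : ℂ) :
    z ∈ segment ℝ (S.a i) (S.b i) ↔ ∃ t ∈ Icc (0 : ℝ) 1, z = S.pt i t := by
  rw [segment_eq_image_lineMap]
  simp only [mem_image, S.lineMap_eq_pt, eq_comm]

theorem pt_injective (i : ι) : Function.Injective (S.pt i) := by
  intro z w h
  exact mul_right_cancel₀ (sub_ne_zero.mpr (S.ne i).symm) (add_left_cancel h)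

/-- Close to an interior point, local finiteness leaves only the segment itself, and it has no point
with positive imaginary coordinate. -/
theorem eventually_pt_notMem (i : ι) {t : ℝ} (ht : t ∈ Ioo (0 : ℝ) 1) :
    ∀ᶠ ζ in 𝓝 (t : ℂ), 0 < ζ.im → S.pt i ζ ∉ S.carrier := by
  have h := (S.continuous_pt i).continuousAt.eventually (S.eventually_mem_segment (S.pt i t))
  filter_upwards [h] with ζ hζ him hmem
  obtain ⟨j, hj⟩ := mem_iUnion.mp hmem
  have hj' := hζ j hj
  rw [← S.lineMap_eq_pt] at hj'
  have hseg : S.pt i ζ ∈ segment ℝ (S.a i) (S.b i) := by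
    rcases S.interior i j t ht hj' with ⟨h1, h2⟩ | ⟨h1, h2⟩
    · rwa [h1, h2] at hj
    · rwa [h1, h2, segment_symm] at hj
  obtain ⟨u, -, hu⟩ := (S.mem_segment_iff i _).mp hseg
  rw [S.pt_injective i hu] at him
  simp at him

/-- `Q` is a union of connected components of the complement of the segments. -/
def Saturated (Q : Set ℂ) : Prop :=
  Q ⊆ S.carrierᶜ ∧ ∀ T : Set ℂ, IsPreconnected T → T ⊆ S.carrierᶜ → (T ∩ Q).Nonempty → T ⊆ Q

/-- The set `Q` contains the points close to the interior of the segment `i`, on its left. -/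
def Left (Q : Set ℂ) (i : ι) : Prop :=
  ∀ t ∈ Ioo (0 : ℝ) 1, ∀ᶠ ζ in 𝓝 (t : ℂ), 0 < ζ.im → S.pt i ζ ∈ Q

variable {S} {Q Q' : Set ℂ}

theorem exists_halfBall (i : ι) {t : ℝ} (ht : t ∈ Ioo (0 : ℝ) 1) : ∃ δ > 0,
    IsPreconnected (S.pt i '' (Metric.ball (t : ℂ) δ ∩ {ζ | 0 < ζ.im})) ∧
      S.pt i '' (Metric.ball (t : ℂ) δ ∩ {ζ | 0 < ζ.im}) ⊆ S.carrierᶜ := by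
  obtain ⟨δ, hδ, h⟩ := Metric.eventually_nhds_iff_ball.mp (S.eventually_pt_notMem i ht)
  refine ⟨δ, hδ, ?_, ?_⟩
  · refine IsPreconnected.image ?_ _ (S.continuous_pt i).continuousOn
    exact ((convex_ball _ _).inter (convex_halfSpace_im_gt 0)).isPreconnected
  · rintro _ ⟨ζ, ⟨h1, h2⟩, rfl⟩
    exact h ζ h1 h2

/-- A small half-disc on the left of an interior point is connected and free of segments, so `Q`
contains all of it or none. The alternative is locally constant along the open segment, hence one
interior point decides for all. -/
theorem Saturated.left_of_frequently (hQ : S.Saturated Q) {i : ι} {t : ℝ} (ht : t ∈ Ioo (0 : ℝ) 1)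
    (h : ∃ᶠ ζ in 𝓝 (t : ℂ), 0 < ζ.im ∧ S.pt i ζ ∈ Q) : S.Left Q i := by
  have key : ∀ t ∈ Ioo (0 : ℝ) 1, (∃ᶠ ζ in 𝓝 (t : ℂ), 0 < ζ.im ∧ S.pt i ζ ∈ Q) →
      ∀ᶠ ζ in 𝓝 (t : ℂ), 0 < ζ.im → S.pt i ζ ∈ Q := by
    intro t ht h
    obtain ⟨δ, hδ, h1, h2⟩ := exists_halfBall (S := S) i ht
    obtain ⟨ζ, ⟨h3, h4⟩, h5⟩ := (h.and_eventually (Metric.ball_mem_nhds _ hδ)).exists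
    have h6 := hQ.2 _ h1 h2 ⟨_, ⟨ζ, ⟨h5, h3⟩, rfl⟩, h4⟩
    filter_upwards [Metric.ball_mem_nhds _ hδ] with ξ hξ him
    exact h6 ⟨ξ, ⟨hξ, him⟩, rfl⟩
  have hfreq : ∀ t : ℝ, ∃ᶠ ζ in 𝓝 (t : ℂ), 0 < ζ.im := by
    intro t
    have hlim : Tendsto (fun r : ℝ => (t : ℂ) + r * Complex.I) (𝓝[>] 0) (𝓝 (t : ℂ)) := by
      have : Continuous fun r : ℝ => (t : ℂ) + r * Complex.I := by fun_prop
      have := this.tendsto 0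
      simp only [Complex.ofReal_zero, zero_mul, add_zero] at this
      exact this.mono_left nhdsWithin_le_nhds
    refine hlim.frequently (Eventually.frequently ?_)
    filter_upwards [self_mem_nhdsWithin] with r hr
    simpa using hr
  intro t' ht'
  apply key t' ht'
  have := isPreconnected_Ioo.induction₂ (s := Ioo (0 : ℝ) 1)
    (fun x y => (∃ᶠ ζ in 𝓝 (x : ℂ), 0 < ζ.im ∧ S.pt i ζ ∈ Q) ↔
      (∃ᶠ ζ in 𝓝 (y : ℂ), 0 < ζ.im ∧ S.pt i ζ ∈ Q)) ?_ (fun x y z _ _ _ => Iff.trans)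
      (fun x y _ _ => Iff.symm) ht ht'
  · exact this.mp h
  · intro x hx
    obtain ⟨δ, hδ, h1, h2⟩ := exists_halfBall (S := S) i hx
    have hnear : ∀ y : ℝ, (y : ℂ) ∈ Metric.ball (x : ℂ) δ →
        ((∃ᶠ ζ in 𝓝 (y : ℂ), 0 < ζ.im ∧ S.pt i ζ ∈ Q) ↔
          S.pt i '' (Metric.ball (x : ℂ) δ ∩ {ζ | 0 < ζ.im}) ⊆ Q) := by
      intro y hy
      constructor
      · intro h
        obtain ⟨ζ, ⟨h3, h4⟩, h5⟩ :=
          (h.and_eventually (Metric.isOpen_ball.mem_nhds hy)).exists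
        exact hQ.2 _ h1 h2 ⟨_, ⟨ζ, ⟨h5, h3⟩, rfl⟩, h4⟩
      · intro h
        refine ((hfreq y).and_eventually (Metric.isOpen_ball.mem_nhds hy)).mono ?_
        rintro ζ ⟨h3, h4⟩
        exact ⟨h3, h ⟨ζ, ⟨h4, h3⟩, rfl⟩⟩
    have hc : ∀ᶠ y : ℝ in 𝓝[Ioo 0 1] x, (y : ℂ) ∈ Metric.ball (x : ℂ) δ :=
      (Complex.continuous_ofReal.tendsto x).eventually (Metric.ball_mem_nhds _ hδ) |>.filter_mono
        nhdsWithin_le_nhds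
    filter_upwards [hc] with y hy
    rw [hnear x (Metric.mem_ball_self hδ), hnear y hy]

theorem Left.inter_nonempty {i : ι} (h : S.Left Q i) (h' : S.Left Q' i) : (Q ∩ Q').Nonempty := by
  have ht : (1 / 2 : ℝ) ∈ Ioo (0 : ℝ) 1 := by norm_num
  obtain ⟨δ, hδ, h1⟩ := Metric.eventually_nhds_iff_ball.mp ((h _ ht).and (h' _ ht))
  have hmem : ((1 / 2 : ℝ) : ℂ) + (δ / 2 : ℝ) * Complex.I ∈ Metric.ball ((1 / 2 : ℝ) : ℂ) δ := by
    rw [Metric.mem_ball, dist_eq_norm, add_sub_cancel_left, norm_mul, Complex.norm_I, mul_one,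
      Complex.norm_real, Real.norm_of_nonneg (by positivity)]
    linarith
  have him : 0 < (((1 / 2 : ℝ) : ℂ) + (δ / 2 : ℝ) * Complex.I).im := by
    simp; exact hδ
  exact ⟨_, (h1 _ hmem).1 him, (h1 _ hmem).2 him⟩

variable (S) in
/-- Close to a point, the segments are those that start there. -/
theorem eventually_exists_germ (p : ℂ) : ∀ᶠ z in 𝓝 p, z ∈ S.carrier → z ≠ p →
    ∃ n, p ∈ segment ℝ (S.a n) (S.b n) ∧ p ≠ S.b n ∧ ∃ r : ℝ, 0 < r ∧ z - p = r * (S.b n - p) := by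
  filter_upwards [S.eventually_mem_segment p] with z hz hmem hne
  obtain ⟨n, hn⟩ := mem_iUnion.mp hmem
  have hp := hz n hn
  have key : ∀ n, ∀ t ∈ Icc (0 : ℝ) 1, ∀ u ∈ Icc (0 : ℝ) 1, z = S.pt n t → p = S.pt n u → u < t →
      p ≠ S.b n ∧ ∃ r : ℝ, 0 < r ∧ z - p = r * (S.b n - p) := by
    intro n t ht u hu hzt hpu hut
    have hu1 : 0 < 1 - u := by linarith [ht.2]
    have e1 : S.b n - p = ((1 - u : ℝ) : ℂ) * (S.b n - S.a n) := by
      rw [hpu, pt]; push_cast; ring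
    have hne' := sub_ne_zero.mpr (S.ne n).symm
    have hu1' : ((1 - u : ℝ) : ℂ) ≠ 0 := by exact_mod_cast hu1.ne'
    refine ⟨?_, (t - u) / (1 - u), div_pos (by linarith) hu1, ?_⟩
    · intro h
      have e2 : S.b n - p = 0 := by rw [← h, sub_self]
      rw [e2] at e1
      exact mul_ne_zero hu1' hne' e1.symm
    · rw [e1, Complex.ofReal_div, ← mul_assoc, div_mul_cancel₀ _ hu1', hzt, hpu, pt, pt]
      push_cast; ring
  obtain ⟨t, ht, hzt⟩ := (S.mem_segment_iff n z).mp hn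
  obtain ⟨u, hu, hpu⟩ := (S.mem_segment_iff n p).mp hp
  rcases lt_trichotomy u t with hut | rfl | hut
  · exact ⟨n, hp, key n t ht u hu hzt hpu hut⟩
  · exact absurd (hzt.trans hpu.symm) hne
  · refine ⟨S.rev n, ?_, key (S.rev n) (1 - t) ⟨by linarith [ht.2], by linarith [ht.1]⟩ (1 - u)
      ⟨by linarith [hu.2], by linarith [hu.1]⟩ ?_ ?_ (by linarith)⟩
    · rwa [S.a_rev, S.b_rev, segment_symm]
    · rw [S.pt_rev, hzt]; push_cast; rw [sub_sub_cancel]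
    · rw [S.pt_rev, hpu]; push_cast; rw [sub_sub_cancel]

theorem tendsto_exp_left {ψ₀ : ℝ} (c : ℝ) (z : ℂ) (s : Set ℝ) :
    Tendsto (fun ψ : ℝ => z + c * Complex.exp ((ψ - ψ₀ : ℝ) * Complex.I)) (𝓝[s] ψ₀)
      (𝓝 (z + c)) := by
  have : Continuous fun ψ : ℝ => z + c * Complex.exp ((ψ - ψ₀ : ℝ) * Complex.I) := by fun_prop
  have := this.tendsto ψ₀
  simp only [sub_self, Complex.ofReal_zero, zero_mul, Complex.exp_zero, mul_one] at this
  exact this.mono_left nhdsWithin_le_nhds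

/-- If no segment starts from `p` between the segments `i` and `j`, in counterclockwise order, then
the left side of `i` and the right side of `j` are in the same component. -/
theorem Saturated.left_turn (hQ : S.Saturated Q) {i j : ι} {p : ℂ} (hi : S.a i = p)
    (hj : S.a j = p) (hmin : ∀ n, p ∈ segment ℝ (S.a n) (S.b n) → p ≠ S.b n →
      ccwAngle (S.b i - p) (S.b j - p) ≤ ccwAngle (S.b i - p) (S.b n - p)) (h : S.Left Q i) :
    S.Left Q (S.rev j) := by
  have hu : S.b i - p ≠ 0 := by rw [← hi]; exact sub_ne_zero.mpr (S.ne i).symm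
  have hv : S.b j - p ≠ 0 := by rw [← hj]; exact sub_ne_zero.mpr (S.ne j).symm
  set u := S.b i - p with hu_def
  set v := S.b j - p with hv_def
  set β := ccwAngle u v with hβ
  have hβ0 : 0 < β := ccwAngle_pos _ _
  have hβ1 : β ≤ 2 * Real.pi := ccwAngle_le _ _
  obtain ⟨m, hm, hvm⟩ := exists_eq_exp_ccwAngle_mul hu hv
  rw [← hβ] at hvm
  obtain ⟨δ, hδ, hloc⟩ := Metric.eventually_nhds_iff_ball.mp (S.eventually_exists_germ p)
  have hun : 0 < ‖u‖ := norm_pos_iff.mpr hu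
  -- The radius is measured in units of ‖u‖: less than 1 and `m` to end inside both segments, and
  -- small enough that only segments starting at `p` can be met.
  obtain ⟨ρ, hρ0, hρ⟩ : ∃ ρ : ℝ, 0 < ρ ∧ ρ < min (min 1 m) (δ / ‖u‖) :=
    exists_between (lt_min (lt_min one_pos hm) (div_pos hδ hun))
  have hρ1 : ρ < 1 := lt_of_lt_of_le hρ ((min_le_left _ _).trans (min_le_left _ _))
  have hρm : ρ < m := lt_of_lt_of_le hρ ((min_le_left _ _).trans (min_le_right _ _))
  have hρδ : ρ * ‖u‖ < δ := by
    have := lt_of_lt_of_le hρ (min_le_right _ _)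
    rwa [lt_div_iff₀ hun] at this
  -- The circular arc about `p` from `i` to `j`. A segment met at angle ψ < β would contradict the
  -- minimality of β, so the arc joins the two sides inside the complement.
  set arc : ℝ → ℂ := fun ψ => p + ρ * Complex.exp (ψ * Complex.I) * u with harc
  have harc_mem : ∀ ψ ∈ Ioo 0 β, arc ψ ∉ S.carrier := by
    intro ψ hψ hmem
    have h1 : arc ψ - p = ρ * Complex.exp (ψ * Complex.I) * u := by simp [harc]
    have h2 : arc ψ ∈ Metric.ball p δ := by
      rw [Metric.mem_ball, dist_eq_norm, h1, norm_mul, norm_mul, Complex.norm_exp_ofReal_mul_I,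
        Complex.norm_real, Real.norm_of_nonneg hρ0.le, mul_one]
      exact hρδ
    have h3 : arc ψ ≠ p := by
      rw [← sub_ne_zero, h1]
      exact mul_ne_zero (mul_ne_zero (by exact_mod_cast hρ0.ne') (Complex.exp_ne_zero _)) hu
    obtain ⟨n, hn1, hn2, r, hr, hr'⟩ := hloc _ h2 hmem h3
    have h4 := hmin n hn1 hn2
    have h5 : S.b n - p = ((ρ / r : ℝ) : ℂ) * Complex.exp (ψ * Complex.I) * u := by
      have : (r : ℂ) ≠ 0 := by exact_mod_cast hr.ne'
      rw [h1] at hr'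
      push_cast
      field_simp
      rw [mul_comm, ← hr']
    rw [h5, ccwAngle_exp_mul hu (div_pos hρ0 hr) hψ.1 (hψ.2.le.trans hβ1)] at h4
    linarith [hψ.2]
  have harc_conn : IsPreconnected (arc '' Ioo 0 β) := by
    refine isPreconnected_Ioo.image _ (Continuous.continuousOn ?_)
    simp only [harc]
    fun_prop
  have hpi := Real.pi_pos
  have harcQ : arc '' Ioo 0 β ⊆ Q := by
    refine hQ.2 _ harc_conn (by rintro _ ⟨ψ, hψ, rfl⟩; exact harc_mem ψ hψ) ?_
    have h1 := (tendsto_exp_left (ψ₀ := 0) ρ 0 (Ioi 0)).eventually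
      (by rw [zero_add]; exact h ρ ⟨hρ0, hρ1⟩)
    obtain ⟨ψ, hψ, hψ2⟩ := (h1.and (Ioo_mem_nhdsGT (lt_min hβ0 hpi))).exists
    refine ⟨arc ψ, ⟨ψ, ⟨hψ2.1, hψ2.2.trans_le (min_le_left _ _)⟩, rfl⟩, ?_⟩
    rw [sub_zero, zero_add] at hψ
    have h2 := hψ (by
      simp only [Complex.im_ofReal_mul, Complex.exp_ofReal_mul_I_im]
      exact mul_pos hρ0
        (Real.sin_pos_of_pos_of_lt_pi hψ2.1 (hψ2.2.trans_le (min_le_right _ _))))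
    rw [pt, hi] at h2
    exact h2
  -- The arc ends at parameter ρ / m of `j`, hence at 1 - ρ / m of its reverse, and it arrives from
  -- the left of this reverse.
  have hlim : ∃ᶠ ζ in 𝓝 ((1 - ρ / m : ℝ) : ℂ), 0 < ζ.im ∧ S.pt (S.rev j) ζ ∈ Q := by
    have h1 := tendsto_exp_left (ψ₀ := β) (-(ρ / m)) 1 (Iio β)
    rw [show (1 : ℂ) + ((-(ρ / m) : ℝ) : ℂ) = ((1 - ρ / m : ℝ) : ℂ) by push_cast; ring] at h1
    refine h1.frequently (Eventually.frequently ?_)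
    filter_upwards [Ioo_mem_nhdsLT (max_lt hβ0 (by linarith : β - Real.pi < β))] with ψ hψ
    have hψ0 : 0 < ψ := (le_max_left _ _).trans_lt hψ.1
    have hψ1 : β - Real.pi < ψ := (le_max_right _ _).trans_lt hψ.1
    constructor
    · have : Real.sin (ψ - β) < 0 := Real.sin_neg_of_neg_of_neg_pi_lt (by linarith [hψ.2])
        (by linarith)
      have h3 : 0 < ρ / m := div_pos hρ0 hm
      simp only [Complex.add_im, Complex.one_im, Complex.im_ofReal_mul, Complex.exp_ofReal_mul_I_im]
      nlinarith
    · have h2 : S.pt (S.rev j) (1 + ((-(ρ / m) : ℝ) : ℂ) *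
          Complex.exp (((ψ - β : ℝ) : ℂ) * Complex.I)) = arc ψ := by
        have hm' : (m : ℂ) ≠ 0 := by exact_mod_cast hm.ne'
        rw [S.pt_rev, pt, hj, ← hv_def, hvm]
        simp only [harc]
        have he : Complex.exp (((ψ - β : ℝ) : ℂ) * Complex.I) * Complex.exp (β * Complex.I) =
            Complex.exp (ψ * Complex.I) := by
          rw [← Complex.exp_add]; congr 1; push_cast; ring
        rw [← he]
        generalize Complex.exp (((ψ - β : ℝ) : ℂ) * Complex.I) = a
        push_cast
        field_simp
        ring
      rw [h2]
      exact harcQ ⟨ψ, ⟨hψ0, hψ.2⟩, rfl⟩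
  refine hQ.left_of_frequently ⟨?_, ?_⟩ hlim
  · have : ρ / m < 1 := (div_lt_one hm).mpr hρm
    linarith
  · have : 0 < ρ / m := div_pos hρ0 hm
    linarith

/-- A component of the complement is on the left of some segment. -/
theorem Saturated.exists_left (hQ : S.Saturated Q) (ho : IsOpen Q) (hne : Q.Nonempty)
    (huniv : Q ≠ univ) : ∃ i, S.Left Q i := by
  -- The plane is connected, so `Q` has a frontier point, which lies on some segment. The segment
  -- wanted is found around this point.
  obtain ⟨p, hp⟩ : (frontier Q).Nonempty := by
    rw [nonempty_iff_ne_empty]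
    intro h
    rcases isClopen_iff.mp (isClopen_iff_frontier_eq_empty.mpr h) with h | h
    · exact hne.ne_empty h
    · exact huniv h
  have hpQ : p ∉ Q := by
    rw [ho.frontier_eq] at hp
    exact hp.2
  have hpcl : p ∈ closure Q := frontier_subset_closure hp
  have hpS : p ∈ S.carrier := by
    by_contra hpS
    obtain ⟨δ, hδ, h⟩ := Metric.isOpen_iff.mp S.isClosed_carrier.isOpen_compl p hpS
    obtain ⟨z, hz⟩ := Metric.mem_closure_iff.mp hpcl δ hδ
    exact hpQ (hQ.2 _ (convex_ball p δ).isPreconnected h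
      ⟨z, by rw [Metric.mem_ball, dist_comm]; exact hz.2, hz.1⟩ (Metric.mem_ball_self hδ))
  set A : Set ι := {n | p ∈ segment ℝ (S.a n) (S.b n) ∧ p ≠ S.b n} with hA
  have hAfin : A.Finite := (S.locallyFinite.point_finite p).subset fun n hn => hn.1
  have hAne : A.Nonempty := by
    obtain ⟨n, hn⟩ := mem_iUnion.mp hpS
    by_cases h : p = S.b n
    · refine ⟨S.rev n, ?_, ?_⟩
      · rwa [S.a_rev, S.b_rev, segment_symm]
      · rw [S.b_rev, h]; exact (S.ne n).symm
    · exact ⟨n, hn, h⟩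
  obtain ⟨n₀, hn₀, hmin₀⟩ := exists_min_image A (fun n => ‖S.b n - p‖) hAfin hAne
  obtain ⟨δ, hδ, hloc⟩ := Metric.eventually_nhds_iff_ball.mp (S.eventually_exists_germ p)
  have hn₀' : 0 < ‖S.b n₀ - p‖ := norm_pos_iff.mpr (sub_ne_zero.mpr hn₀.2.symm)
  obtain ⟨z, hzQ, hz⟩ := Metric.mem_closure_iff.mp hpcl _ (lt_min hδ hn₀')
  rw [dist_comm, dist_eq_norm] at hz
  have hw : z - p ≠ 0 := by
    rw [sub_ne_zero]; rintro rfl; exact hpQ hzQ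
  set w := z - p with hw_def
  -- Turning clockwise about `p` from the point `z` of `Q`, `i` is the first direction met. The arc
  -- from `i` to `z` is thus free of segments; `z` was taken closer to `p` than any segment end, so
  -- the arc starts inside `i`.
  obtain ⟨i, hiA, hmin⟩ := exists_min_image A (fun n => ccwAngle (S.b n - p) w) hAfin hAne
  have hu : S.b i - p ≠ 0 := sub_ne_zero.mpr hiA.2.symm
  set u := S.b i - p with hu_def
  set β := ccwAngle u w with hβ
  have hβ0 : 0 < β := ccwAngle_pos _ _
  have hβ1 : β ≤ 2 * Real.pi := ccwAngle_le _ _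
  obtain ⟨c, hc, hwc⟩ := exists_eq_exp_ccwAngle_mul hu hw
  rw [← hβ] at hwc
  have hc1 : c < 1 := by
    have h1 : ‖w‖ = c * ‖u‖ := by
      rw [hwc, norm_mul, norm_mul, Complex.norm_exp_ofReal_mul_I, Complex.norm_real,
        Real.norm_of_nonneg hc.le, mul_one]
    have h2 : ‖w‖ < ‖u‖ := (hz.trans_le (min_le_right _ _)).trans_le (hmin₀ i hiA)
    have h3 : 0 < ‖u‖ := norm_pos_iff.mpr hu
    nlinarith
  set arc : ℝ → ℂ := fun ψ => p + c * Complex.exp (ψ * Complex.I) * u with harc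
  have harc_mem : ∀ ψ ∈ Ioc 0 β, arc ψ ∉ S.carrier := by
    intro ψ hψ hmem
    have h1 : arc ψ - p = c * Complex.exp (ψ * Complex.I) * u := by simp [harc]
    rcases eq_or_lt_of_le hψ.2 with h0 | h0
    · have : arc ψ = z := by
        rw [← sub_eq_zero, ← sub_sub_sub_cancel_right _ _ p, h1, h0, ← hwc, sub_self]
      rw [this] at hmem
      exact hQ.1 hzQ hmem
    have h2 : arc ψ ∈ Metric.ball p δ := by
      have : ‖w‖ = ‖arc ψ - p‖ := by
        rw [h1, hwc, norm_mul, norm_mul, norm_mul, norm_mul, Complex.norm_exp_ofReal_mul_I,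
          Complex.norm_exp_ofReal_mul_I]
      rw [Metric.mem_ball, dist_eq_norm, ← this]
      exact hz.trans_le (min_le_left _ _)
    have h3 : arc ψ ≠ p := by
      rw [← sub_ne_zero, h1]
      exact mul_ne_zero (mul_ne_zero (by exact_mod_cast hc.ne') (Complex.exp_ne_zero _)) hu
    obtain ⟨n, hn1, hn2, r, hr, hr'⟩ := hloc _ h2 hmem h3
    have h4 := hmin n ⟨hn1, hn2⟩
    have h5 : w = (r : ℂ) * Complex.exp ((β - ψ : ℝ) * Complex.I) * (S.b n - p) := by
      have he : Complex.exp (ψ * Complex.I) * Complex.exp ((β - ψ : ℝ) * Complex.I) =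
          Complex.exp (β * Complex.I) := by
        rw [← Complex.exp_add]; congr 1; push_cast; ring
      rw [mul_right_comm, ← hr', h1, hwc, ← he]
      ring
    have h6 := ccwAngle_exp_mul (sub_ne_zero.mpr hn2.symm) hr (sub_pos.mpr h0)
      (by linarith [hψ.1] : β - ψ ≤ 2 * Real.pi)
    rw [← h5] at h6
    linarith [hψ.1]
  have harc_conn : IsPreconnected (arc '' Ioc 0 β) := by
    refine isPreconnected_Ioc.image _ (Continuous.continuousOn ?_)
    simp only [harc]
    fun_prop
  have harcQ : arc '' Ioc 0 β ⊆ Q := by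
    refine hQ.2 _ harc_conn (by rintro _ ⟨ψ, hψ, rfl⟩; exact harc_mem ψ hψ) ?_
    refine ⟨z, ⟨β, ⟨hβ0, le_rfl⟩, ?_⟩, hzQ⟩
    simp only [harc]
    rw [← hwc, hw_def]; ring
  obtain ⟨τ, hτ, hpτ⟩ := (S.mem_segment_iff i p).mp hiA.1
  have hτ1 : τ < 1 := by
    rcases eq_or_lt_of_le hτ.2 with h | h
    · exact absurd (by rw [hpτ, h, pt]; push_cast; ring) hiA.2
    · exact h
  -- The frontier point has parameter τ on `i`, possibly in the interior; this is the parameter of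
  -- the start of the arc.
  refine ⟨i, hQ.left_of_frequently (t := τ + c * (1 - τ)) ⟨?_, ?_⟩ ?_⟩
  · have := mul_pos hc (sub_pos.mpr hτ1)
    linarith [hτ.1]
  · nlinarith
  · have h1 := tendsto_exp_left (ψ₀ := 0) (c * (1 - τ)) τ (Ioi 0)
    rw [show (τ : ℂ) + ((c * (1 - τ) : ℝ) : ℂ) = ((τ + c * (1 - τ) : ℝ) : ℂ) by push_cast; ring]
      at h1
    refine h1.frequently (Eventually.frequently ?_)
    filter_upwards [Ioo_mem_nhdsGT (lt_min hβ0 Real.pi_pos)] with ψ hψ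
    rw [sub_zero]
    constructor
    · have h2 : 0 < Real.sin ψ := Real.sin_pos_of_pos_of_lt_pi hψ.1 (hψ.2.trans_le (min_le_right _ _))
      simp only [Complex.add_im, Complex.ofReal_im, Complex.im_ofReal_mul,
        Complex.exp_ofReal_mul_I_im, zero_add]
      exact mul_pos (mul_pos hc (sub_pos.mpr hτ1)) h2
    · have h2 : S.pt i (τ + ((c * (1 - τ) : ℝ) : ℂ) * Complex.exp ((ψ : ℂ) * Complex.I)) = arc ψ := by
        simp only [harc, hu_def]
        rw [hpτ, pt, pt]
        push_cast
        ring
      rw [h2]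
      exact harcQ ⟨ψ, ⟨hψ.1, hψ.2.le.trans (min_le_left _ _)⟩, rfl⟩

end SegmentSystem

/-! ### Lifts of the graph and of its faces to the plane -/

section Lattice

variable (Λ : Submodule ℤ ℂ)

theorem isCoveringMap_mkQ [DiscreteTopology Λ] : IsCoveringMap Λ.mkQ :=
  (AddSubgroup.isAddQuotientCoveringMap_of_comm Λ.toAddSubgroup
    (isDiscrete_iff_discreteTopology.mpr inferInstance)).isCoveringMap

theorem mkQ_eq_mkQ_iff {z w : ℂ} : Λ.mkQ z = Λ.mkQ w ↔ ∃ c : Λ, z = w + c := by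
  rw [Submodule.mkQ_apply, Submodule.mkQ_apply, Submodule.Quotient.eq]
  constructor
  · intro h; exact ⟨⟨_, h⟩, by simp⟩
  · rintro ⟨c, rfl⟩; simp

theorem mkQ_add_coe (z : ℂ) (c : Λ) : Λ.mkQ (z + c) = Λ.mkQ z :=
  (mkQ_eq_mkQ_iff Λ).mpr ⟨c, rfl⟩

open Pointwise in
/-- The translates of finitely many bounded sets by a lattice are locally finite. -/
theorem locallyFinite_translates [DiscreteTopology Λ] {κ ι : Type*} [Finite κ] (K : κ → Set ℂ)
    (hK : ∀ k, Bornology.IsBounded (K k)) (f : ι → κ × Λ) (hf : Function.Injective f)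
    (T : ι → Set ℂ) (hT : ∀ i, ∀ z ∈ T i, z - (f i).2 ∈ K (f i).1) : LocallyFinite T := by
  have hclosed : IsClosed (Λ : Set ℂ) :=
    AddSubgroup.isClosed_of_discrete (H := Λ.toAddSubgroup)
  have hdisc : IsDiscrete (Λ : Set ℂ) := isDiscrete_iff_discreteTopology.mpr inferInstance
  intro p
  refine ⟨Metric.ball p 1, Metric.ball_mem_nhds _ one_pos, ?_⟩
  have hfin : ∀ k, {c : Λ | (c : ℂ) ∈ Metric.ball p 1 - K k}.Finite := by
    intro k
    refine Finite.preimage (f := ((↑) : Λ → ℂ)) Subtype.coe_injective.injOn (Finite.subset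
      (Metric.finite_isBounded_inter_isClosed hdisc (Metric.isBounded_ball.sub (hK k)) hclosed)
        (s := ((Metric.ball p 1 - K k) ∩ Λ)) subset_rfl) |>.subset ?_
    intro c hc
    exact ⟨hc, c.2⟩
  have : (⋃ k, ({k} : Set κ) ×ˢ {c : Λ | (c : ℂ) ∈ Metric.ball p 1 - K k}).Finite :=
    finite_iUnion fun k => (finite_singleton k).prod (hfin k)
  refine (this.preimage hf.injOn).subset ?_
  rintro i ⟨z, hz, hzp⟩
  refine mem_iUnion.mpr ⟨(f i).1, rfl, ?_⟩
  exact ⟨z, hzp, _, hT i z hz, by simp⟩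

end Lattice

namespace TorusGraph

variable {Λ : Submodule ℤ ℂ} {V F E : Type*} (G : TorusGraph Λ V E)

/-- The indices of the lifts of the oriented segments of a graph to the universal cover. -/
abbrev LiftIndex : Type _ := (Σ d : ODart E, Fin (G.len d.1)) × Λ

theorem dartCorner_rev_fin {d : ODart E} (k : Fin (G.len d.1)) :
    G.dartCorner d.rev (G.len d.1 - 1 - k) = G.dartCorner d (k + 1) ∧
      G.dartCorner d.rev (G.len d.1 - 1 - k + 1) = G.dartCorner d k := by
  have := k.2
  constructor
  · rw [G.dartCorner_rev d (by omega)]; congr 1; omega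
  · rw [G.dartCorner_rev d (by omega)]; congr 1; omega

theorem exists_dartPath_of_mem_segment {d : ODart E} {k : ℕ} (c z : ℂ)
    (h : z ∈ segment ℝ (G.dartCorner d k + c) (G.dartCorner d (k + 1) + c)) :
    ∃ t ∈ Icc (0 : ℝ) 1, z = G.dartPath d (k + t) + c := by
  rw [segment_eq_image_lineMap] at h
  obtain ⟨t, ht, rfl⟩ := h
  refine ⟨t, ht, ?_⟩
  rw [G.dartPath_add d k ht, AffineMap.lineMap_apply_module', AffineMap.lineMap_apply_module']
  simp; ring

theorem dartPath_mem_segment {d : ODart E} {k : ℕ} (c : ℂ) {t : ℝ} (ht : t ∈ Icc (0 : ℝ) 1) :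
    G.dartPath d (k + t) + c ∈ segment ℝ (G.dartCorner d k + c) (G.dartCorner d (k + 1) + c) := by
  rw [segment_eq_image_lineMap]
  refine ⟨t, ht, ?_⟩
  rw [G.dartPath_add d k ht, AffineMap.lineMap_apply_module', AffineMap.lineMap_apply_module']
  simp; ring

/-- The lifts of an interior point of an edge lie on the corresponding lift of the edge only. -/
theorem eq_or_eq_rev_of_dartPath_eq {d d' : ODart E} {s s' : ℝ} (hs : s ∈ Ioo (0 : ℝ) (G.len d.1))
    (hs' : s' ∈ Icc (0 : ℝ) (G.len d'.1)) {c c' : Λ}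
    (h : G.dartPath d s + c = G.dartPath d' s' + c') :
    c = c' ∧ ((d' = d ∧ s = s') ∨ (d' = d.rev ∧ s + s' = G.len d.1)) := by
  have hm : Λ.mkQ (G.dartPath d s) = Λ.mkQ (G.dartPath d' s') := by
    rw [← mkQ_add_coe Λ _ c, h, mkQ_add_coe]
  have h0 : s' ≠ 0 := by
    rintro rfl
    rw [mkQ_dartPath_zero] at hm
    exact G.mkQ_dartPath_ne_pos d hs _ hm
  have h1 : s' ≠ G.len d'.1 := by
    rintro rfl
    rw [mkQ_dartPath_len] at hm
    exact G.mkQ_dartPath_ne_pos d hs _ hm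
  have hs'' : s' ∈ Ioo (0 : ℝ) (G.len d'.1) :=
    ⟨lt_of_le_of_ne hs'.1 h0.symm, lt_of_le_of_ne hs'.2 h1⟩
  have hfst := G.dartPath_inj_fst hs hs'' hm
  rcases ODart.eq_or_eq_rev hfst.symm with rfl | rfl
  · obtain rfl := G.dartPath_inj hs hs'' hm
    exact ⟨Subtype.ext (add_left_cancel h), Or.inl ⟨rfl, rfl⟩⟩
  · have h2 := G.dartPath_rev_inj hs hs'' hm
    refine ⟨Subtype.ext ?_, Or.inr ⟨rfl, h2⟩⟩
    rw [G.dartPath_rev d hs', show (G.len d.1 : ℝ) - s' = s by linarith] at h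
    exact add_left_cancel h

/-- The segments of the lift of a graph to the universal cover. -/
noncomputable def segmentSystem [DiscreteTopology Λ] [Finite E] : SegmentSystem G.LiftIndex where
  a i := G.dartCorner i.1.1 i.1.2 + i.2
  b i := G.dartCorner i.1.1 (i.1.2 + 1) + i.2
  ne i h := G.dartCorner_ne i.1.1 i.1.2.2 (add_right_cancel h)
  rev i := ⟨⟨i.1.1.rev, ⟨G.len i.1.1.1 - 1 - i.1.2, by
    have := i.1.2.2; rw [ODart.rev_fst]; omega⟩⟩, i.2⟩
  a_rev i := by rw [(G.dartCorner_rev_fin i.1.2).1]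
  b_rev i := by rw [(G.dartCorner_rev_fin i.1.2).2]
  locallyFinite := by
    refine locallyFinite_translates Λ (fun i : Σ d : ODart E, Fin (G.len d.1) =>
      segment ℝ (G.dartCorner i.1 i.2) (G.dartCorner i.1 (i.2 + 1))) (fun i => ?_) id
      Function.injective_id _ (fun i z hz => ?_)
    · rw [segment_eq_image_lineMap]
      exact (isCompact_Icc.image AffineMap.lineMap_continuous).isBounded
    · obtain ⟨t, ht, rfl⟩ := G.exists_dartPath_of_mem_segment _ _ hz
      have := G.dartPath_mem_segment (d := i.1.1) (k := i.1.2) 0 ht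
      simpa using this
  interior := by
    rintro ⟨⟨d, k, hk⟩, c⟩ ⟨⟨d', k', hk'⟩, c'⟩ t ht h
    have e : (AffineMap.lineMap (G.dartCorner d k + (c : ℂ)) (G.dartCorner d (k + 1) + c)) t =
        G.dartPath d (k + t) + c := by
      rw [G.dartPath_add d k (Ioo_subset_Icc_self ht), AffineMap.lineMap_apply_module',
        AffineMap.lineMap_apply_module']
      simp; ring
    simp only [e] at h
    obtain ⟨t', ht', h'⟩ := G.exists_dartPath_of_mem_segment _ _ h
    have hk1 : (k' : ℝ) + 1 ≤ G.len d'.1 := by exact_mod_cast hk'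
    obtain ⟨rfl, ⟨rfl, hst⟩ | ⟨rfl, hst⟩⟩ := G.eq_or_eq_rev_of_dartPath_eq
      (natCast_add_mem_Ioo hk ht) ⟨by linarith [ht'.1, Nat.cast_nonneg (α := ℝ) k'],
        by linarith [ht'.2]⟩ h'
    · left
      have h1 : (k' : ℝ) < k + 1 := by linarith [ht.2, ht'.1]
      have h2 : (k : ℝ) < k' + 1 := by linarith [ht.1, ht'.2]
      norm_cast at h1 h2
      obtain rfl : k = k' := by omega
      exact ⟨rfl, rfl⟩
    · right
      have h1 : (k + k' : ℝ) < G.len d.1 := by linarith [ht.1, ht'.1]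
      have h2 : (G.len d.1 : ℝ) < k + k' + 2 := by linarith [ht.2, ht'.2]
      norm_cast at h1 h2
      obtain rfl : k' = G.len d.1 - 1 - k := by omega
      have h3 := G.dartCorner_rev_fin ⟨k, hk⟩
      simp only at h3
      simp only [h3]
      exact ⟨trivial, trivial⟩

theorem mkQ_mem_edgeSet_iff {z : ℂ} {e : E} : Λ.mkQ z ∈ G.edgeSet e ↔
    ∃ k < G.len e, ∃ t ∈ Icc (0 : ℝ) 1, ∃ c : Λ, z = G.dartPath (e, true) (k + t) + c := by
  constructor
  · rintro ⟨k, hk, t, ht, h⟩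
    rw [← G.dartPath_true e ht, mkQ_eq_mkQ_iff] at h
    exact ⟨k, hk, t, ht, h⟩
  · rintro ⟨k, hk, t, ht, c, rfl⟩
    rw [mkQ_add_coe]
    exact ⟨k, hk, t, ht, G.dartPath_true e ht⟩

theorem mkQ_dartCorner_add (d : ODart E) (c : Λ) :
    Λ.mkQ (G.dartCorner d 0 + c) = G.pos (G.origin d) := by
  rw [mkQ_add_coe, ← dartPath_zero, mkQ_dartPath_zero]

section Lift

variable [DiscreteTopology Λ]

theorem segmentSystem_a [Finite E] (d : ODart E) (k : Fin (G.len d.1)) (c : Λ) :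
    G.segmentSystem.a ⟨⟨d, k⟩, c⟩ = G.dartCorner d k + c := rfl

theorem segmentSystem_b [Finite E] (d : ODart E) (k : Fin (G.len d.1)) (c : Λ) :
    G.segmentSystem.b ⟨⟨d, k⟩, c⟩ = G.dartCorner d (k + 1) + c := rfl

theorem mem_carrier_iff [Finite E] {z : ℂ} :
    z ∈ G.segmentSystem.carrier ↔ ∃ e, Λ.mkQ z ∈ G.edgeSet e := by
  constructor
  · intro h
    obtain ⟨⟨⟨d, k⟩, c⟩, hi⟩ := mem_iUnion.mp h
    obtain ⟨t, ht, rfl⟩ := G.exists_dartPath_of_mem_segment _ _ hi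
    refine ⟨d.1, ?_⟩
    rw [mkQ_add_coe]
    have hk : (k : ℝ) + 1 ≤ G.len d.1 := by exact_mod_cast k.2
    exact G.mkQ_dartPath_mem_edgeSet d ⟨by linarith [ht.1, Nat.cast_nonneg (α := ℝ) (k : ℕ)],
      by linarith [ht.2]⟩
  · rintro ⟨e, h⟩
    obtain ⟨k, hk, t, ht, c, rfl⟩ := G.mkQ_mem_edgeSet_iff.mp h
    exact mem_iUnion.mpr ⟨⟨⟨(e, true), ⟨k, hk⟩⟩, c⟩, G.dartPath_mem_segment _ ht⟩

/-- The segments miss only isolated vertices, which surjectivity of the origin map excludes. -/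
theorem mkQ_mem_support_iff [Finite E] (ho : Function.Surjective G.origin) {z : ℂ} :
    Λ.mkQ z ∈ G.support ↔ z ∈ G.segmentSystem.carrier := by
  rw [mem_carrier_iff, support, mem_union, mem_iUnion, or_iff_right_of_imp]
  rintro ⟨v, hv⟩
  obtain ⟨d, rfl⟩ := ho v
  refine ⟨d.1, ?_⟩
  rw [← hv, ← mkQ_dartPath_zero]
  exact G.mkQ_dartPath_mem_edgeSet d ⟨le_rfl, Nat.cast_nonneg _⟩

/-- A face which is a disc lifts to the universal cover. -/
theorem IsCellular.exists_section {G : TorusGraph Λ V E} (hG : G.IsCellular) {p : ℂ ⧸ Λ}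
    (hp : p ∈ G.supportᶜ) : ∃ s : ℂ ⧸ Λ → ℂ, ContinuousOn s (G.face p) ∧
      ∀ u ∈ G.face p, Λ.mkQ (s u) = u := by
  classical
  obtain ⟨h⟩ := hG p hp
  have : ContractibleSpace (Metric.ball (0 : ℂ) 1) :=
    (convex_ball _ _).contractibleSpace ⟨0, Metric.mem_ball_self one_pos⟩
  have : LocallyPathConnectedSpace (Metric.ball (0 : ℂ) 1) :=
    Metric.isOpen_ball.locallyPathConnectedSpace
  have : ContractibleSpace (G.face p) := h.contractibleSpace
  have : LocallyPathConnectedSpace (G.face p) := h.isOpenEmbedding.locallyPathConnectedSpace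
  obtain ⟨z, hz⟩ := Λ.mkQ_surjective p
  obtain ⟨f, ⟨-, hf⟩, -⟩ := (isCoveringMap_mkQ Λ).existsUnique_continuousMap_lifts
    (⟨Subtype.val, continuous_subtype_val⟩ : C(G.face p, ℂ ⧸ Λ))
    ⟨p, mem_connectedComponentIn hp⟩ z hz
  refine ⟨fun x => if h : x ∈ G.face p then f ⟨x, h⟩ else 0, ?_, ?_⟩
  · rw [continuousOn_iff_continuous_domRestrict]
    have : (G.face p).domRestrict (fun x => if h : x ∈ G.face p then f ⟨x, h⟩ else 0) = f := by
      ext x; simp [Set.domRestrict]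
    rw [this]
    exact f.continuous
  · intro x hx
    simp only [hx, dif_pos]
    exact congrFun hf ⟨x, hx⟩

/-- The difference between the section and the identity is continuous with values in the discrete
lattice, so it is constant on a connected set. -/
theorem exists_section_eq_add {f : ℂ ⧸ Λ → ℂ} {U : Set (ℂ ⧸ Λ)} (hf : ContinuousOn f U)
    (hfs : ∀ u ∈ U, Λ.mkQ (f u) = u) {T : Set ℂ} (hT : IsPreconnected T)
    (hTU : MapsTo Λ.mkQ T U) : ∃ c : Λ, ∀ z ∈ T, f (Λ.mkQ z) = z + c := by
  have hdisc : IsDiscrete (Λ : Set ℂ) := isDiscrete_iff_discreteTopology.mpr inferInstance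
  obtain ⟨c, hc, h⟩ := hT.eqOn_const_of_mapsTo hdisc (f := fun z => f (Λ.mkQ z) - z)
    ((hf.comp (isCoveringMap_mkQ Λ).continuous.continuousOn hTU).sub continuousOn_id)
    (fun z hz => by
      have := hfs _ (hTU hz)
      rw [mkQ_eq_mkQ_iff] at this
      obtain ⟨c, hc⟩ := this
      simp only [hc, add_sub_cancel_left]
      exact c.2) ⟨0, Λ.zero_mem⟩
  exact ⟨⟨c, hc⟩, fun z hz => by have := h hz; simp only [Function.const_apply] at this; simp [← this]⟩

/-- A connected subset of the universal cover that lies over a face injects into it. -/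
theorem IsCellular.eq_of_mkQ_eq {G : TorusGraph Λ V E} (hG : G.IsCellular) {p : ℂ ⧸ Λ}
    (hp : p ∈ G.supportᶜ) {T : Set ℂ} (hT : IsPreconnected T) (hTp : MapsTo Λ.mkQ T (G.face p))
    {z w : ℂ} (hz : z ∈ T) (hw : w ∈ T) (h : Λ.mkQ z = Λ.mkQ w) : z = w := by
  obtain ⟨f, hf, hfs⟩ := hG.exists_section hp
  obtain ⟨c, hc⟩ := exists_section_eq_add hf hfs hT hTp
  have := hc z hz
  rw [h, hc w hw] at this
  exact (add_right_cancel this).symm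

theorem mapsTo_face {T : Set ℂ} (hT : IsPreconnected T) {z : ℂ} (hz : z ∈ T)
    (hTs : ∀ w ∈ T, Λ.mkQ w ∉ G.support) : MapsTo Λ.mkQ T (G.face (Λ.mkQ z)) := by
  have h := (hT.image _ (isCoveringMap_mkQ Λ).continuous.continuousOn).subset_connectedComponentIn
    (F := G.supportᶜ) ⟨z, hz, rfl⟩ (by rintro _ ⟨w, hw, rfl⟩; exact hTs w hw)
  exact fun w hw => h ⟨w, hw, rfl⟩

/-- Close to an isolated vertex, there are no other points of the graph. -/
theorem eventually_mkQ_notMem_support [Finite E] [Finite V] {v : V} (hv : ∀ d, G.origin d ≠ v) {p : ℂ}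
    (hp : Λ.mkQ p = G.pos v) : ∀ᶠ z in 𝓝 p, z ≠ p → Λ.mkQ z ∉ G.support := by
  choose w hw using fun v => Λ.mkQ_surjective (G.pos v)
  have hlf : LocallyFinite fun i : V × Λ => ({w i.1 + i.2} : Set ℂ) :=
    locallyFinite_translates Λ (fun v => {w v}) (fun _ => Bornology.isBounded_singleton) id
      Function.injective_id _ (by rintro i z rfl; simp)
  have hpc : p ∉ G.segmentSystem.carrier := by
    intro h
    obtain ⟨⟨⟨d, k⟩, c⟩, hi⟩ := mem_iUnion.mp h
    obtain ⟨t, ht, rfl⟩ := G.exists_dartPath_of_mem_segment _ _ hi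
    rw [mkQ_add_coe] at hp
    have hk : (k : ℝ) + 1 ≤ G.len d.1 := by exact_mod_cast k.2
    have hs : (k : ℝ) + t ∈ Icc (0 : ℝ) (G.len d.1) :=
      ⟨by linarith [ht.1, Nat.cast_nonneg (α := ℝ) (k : ℕ)], by linarith [ht.2]⟩
    rcases eq_or_lt_of_le hs.1 with h0 | h0
    · rw [← h0, mkQ_dartPath_zero] at hp
      exact hv d (G.pos_injective hp)
    rcases eq_or_lt_of_le hs.2 with h1 | h1
    · rw [h1, mkQ_dartPath_len] at hp
      exact hv d.rev (by rw [origin_rev]; exact G.pos_injective hp)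
    · exact G.mkQ_dartPath_ne_pos d ⟨h0, h1⟩ _ hp
  filter_upwards [G.segmentSystem.isClosed_carrier.isOpen_compl.mem_nhds hpc,
    hlf.eventually_subset (fun _ => isClosed_singleton) p] with z hz1 hz2 hne hmem
  rcases hmem with ⟨v', hv'⟩ | h
  · rw [← hw, eq_comm, mkQ_eq_mkQ_iff] at hv'
    obtain ⟨c, hc⟩ := hv'
    have : p = w v' + c := hz2 (show (v', c) ∈ _ from hc)
    exact hne (hc.trans this.symm)
  · exact hz1 (G.mem_carrier_iff.mpr (mem_iUnion.mp h))

/-- In a graph whose faces are discs, no vertex is isolated. -/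
theorem IsCellular.origin_surjective [Finite E] [Finite V] {G : TorusGraph Λ V E} (hG : G.IsCellular) :
    Function.Surjective G.origin := by
  intro v
  by_contra! hv
  obtain ⟨p, hp⟩ := Λ.mkQ_surjective (G.pos v)
  obtain ⟨δ, hδ, hloc⟩ :=
    Metric.eventually_nhds_iff_ball.mp (G.eventually_mkQ_notMem_support hv hp)
  -- A small circle around an isolated vertex lies in one face and lifts to a closed circle through
  -- the section. The lifted face avoids the lifted vertex and is simply connected, so the argument
  -- about that vertex is continuous on it; but it would grow by 2π along the circle.
  set circ : ℝ → ℂ := fun t => p + (δ / 2 : ℝ) * Complex.exp (t * Complex.I) with hcirc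
  have hcont : Continuous circ := by simp only [hcirc]; fun_prop
  have hne : ∀ t, circ t ≠ p := by
    intro t h
    have : ((δ / 2 : ℝ) : ℂ) * Complex.exp (t * Complex.I) = 0 := by
      simpa only [hcirc, add_eq_left] using h
    refine mul_ne_zero ?_ (Complex.exp_ne_zero _) this
    exact_mod_cast (half_pos hδ).ne'
  have hns : ∀ t, Λ.mkQ (circ t) ∈ G.supportᶜ := by
    intro t
    refine hloc _ ?_ (hne t)
    rw [Metric.mem_ball, dist_eq_norm]
    simp only [hcirc, add_sub_cancel_left, norm_mul, Complex.norm_exp_ofReal_mul_I, mul_one,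
      Complex.norm_real, Real.norm_of_nonneg (half_pos hδ).le]
    linarith
  have hpre : IsPreconnected (range circ) := isPreconnected_range hcont
  have hmaps : MapsTo Λ.mkQ (range circ) (G.face (Λ.mkQ (circ 0))) :=
    G.mapsTo_face hpre (mem_range_self 0) (by rintro _ ⟨t, rfl⟩; exact hns t)
  obtain ⟨f, hf, hfs⟩ := hG.exists_section (hns 0)
  obtain ⟨c, hc⟩ := exists_section_eq_add hf hfs hpre hmaps
  obtain ⟨h⟩ := hG _ (hns 0)
  have : ContractibleSpace (Metric.ball (0 : ℂ) 1) :=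
    (convex_ball _ _).contractibleSpace ⟨0, Metric.mem_ball_self one_pos⟩
  have : LocallyPathConnectedSpace (Metric.ball (0 : ℂ) 1) :=
    Metric.isOpen_ball.locallyPathConnectedSpace
  have : ContractibleSpace (G.face (Λ.mkQ (circ 0))) := h.contractibleSpace
  have : LocallyPathConnectedSpace (G.face (Λ.mkQ (circ 0))) :=
    h.isOpenEmbedding.locallyPathConnectedSpace
  obtain ⟨θ, hθ, hθf⟩ := exists_continuousOn_angle (s := G.face (Λ.mkQ (circ 0)))
    (f := fun u => f u - (c + p)) (hf.sub continuousOn_const) (by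
      intro u hu h
      have h1 := hfs u hu
      rw [sub_eq_zero.mp h, add_comm, mkQ_add_coe, hp] at h1
      exact connectedComponentIn_subset _ _ hu (Or.inl ⟨v, h1⟩))
  have hang : ∀ t : ℝ, ((θ (Λ.mkQ (circ t)) - t : ℝ) : Real.Angle) = 0 := by
    intro t
    rw [Real.Angle.coe_sub, hθf _ (hmaps (mem_range_self t)), hc _ (mem_range_self t)]
    simp only [hcirc]
    rw [show p + ((δ / 2 : ℝ) : ℂ) * Complex.exp (t * Complex.I) + c - (c + p) =
      ((δ / 2 : ℝ) : ℂ) * Complex.exp (t * Complex.I) by ring, Complex.arg_real_mul _ (half_pos hδ),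
      Complex.arg_exp_mul_I, Real.Angle.coe_toIocMod, sub_self]
  have hθc : Continuous fun t => θ (Λ.mkQ (circ t)) - t := by
    refine Continuous.sub ?_ continuous_id
    exact hθ.comp_continuous ((isCoveringMap_mkQ Λ).continuous.comp hcont)
      fun t => hmaps (mem_range_self t)
  have := isPreconnected_univ.eq_of_coe_angle_eq hθc.continuousOn
    (fun a _ b _ => (hang a).trans (hang b).symm) (mem_univ 0) (mem_univ (2 * Real.pi))
  have h0 : circ (2 * Real.pi) = circ 0 := by
    simp only [hcirc]
    push_cast
    rw [Complex.exp_two_pi_mul_I, zero_mul, Complex.exp_zero]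
  rw [h0] at this
  linarith [Real.pi_pos]

end Lift

end TorusGraph

/-! ### Following the boundary of a face in the plane -/

theorem SegmentSystem.Left.congr {ι : Type*} {S : SegmentSystem ι} {Q : Set ℂ} {i j : ι}
    (h : S.Left Q i) (ha : S.a j = S.a i) (hb : S.b j = S.b i) : S.Left Q j := by
  intro t ht
  filter_upwards [h t ht] with ζ hζ him
  have := hζ him
  rwa [SegmentSystem.pt, ← ha, ← hb] at this

namespace SegmentSystem

variable {ι : Type*} (S : SegmentSystem ι)

/-- The component of a point in the complement of the segments. -/
def component (z : ℂ) : Set ℂ := connectedComponentIn S.carrierᶜ z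

variable {S} {z w : ℂ}

theorem saturated_component : S.Saturated (S.component z) := by
  refine ⟨connectedComponentIn_subset _ _, fun T hT hTS ⟨w, hwT, hw⟩ => ?_⟩
  rw [component, connectedComponentIn_eq hw]
  exact hT.subset_connectedComponentIn hwT hTS

theorem isOpen_component : IsOpen (S.component z) := S.isClosed_carrier.isOpen_compl.connectedComponentIn

theorem isPreconnected_component : IsPreconnected (S.component z) :=
  isPreconnected_connectedComponentIn

theorem mem_component (hz : z ∉ S.carrier) : z ∈ S.component z := mem_connectedComponentIn hz

theorem component_eq_of_left {i : ι} (h : S.Left (S.component z) i) (h' : S.Left (S.component w) i) :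
    S.component z = S.component w := by
  obtain ⟨q, hq, hq'⟩ := h.inter_nonempty h'
  exact (connectedComponentIn_eq hq).trans (connectedComponentIn_eq hq').symm

end SegmentSystem

namespace TorusGraph

variable {Λ : Submodule ℤ ℂ} [DiscreteTopology Λ] {V F E : Type*} [Finite E] {G : TorusGraph Λ V E}
  {H : TorusGraph Λ F E} {Q : Set ℂ}

/-- The left side of an oriented edge is connected across its corners. -/
theorem left_of_left_succ (hQ : G.segmentSystem.Saturated Q) {d : ODart E} {k : ℕ}
    (hk : k + 1 < G.len d.1) {c : Λ}
    (h : G.segmentSystem.Left Q ⟨⟨d, ⟨k + 1, hk⟩⟩, c⟩) :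
    G.segmentSystem.Left Q ⟨⟨d, ⟨k, by omega⟩⟩, c⟩ := by
  set S := G.segmentSystem
  set j : G.LiftIndex := ⟨⟨d, ⟨k, by omega⟩⟩, c⟩
  -- At an intermediate corner only two segments start: the following one and the reverse of the
  -- preceding one. The turn from the former to the latter sweeps the left side.
  refine (hQ.left_turn (i := ⟨⟨d, ⟨k + 1, hk⟩⟩, c⟩) (j := S.rev j) (p := S.b j) rfl (S.a_rev j)
    ?_ h).congr ?_ ?_
  · rintro ⟨⟨d', k', hk'⟩, c'⟩ hn hne
    obtain ⟨t, ht, hp⟩ := G.exists_dartPath_of_mem_segment _ _ hn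
    have hp' : G.dartPath d ((k + 1 : ℕ) : ℝ) + c = G.dartPath d' (k' + t) + c' := by
      rw [G.dartPath_natCast]; exact hp
    have hk1 : (k' : ℝ) + 1 ≤ G.len d'.1 := by exact_mod_cast hk'
    have hkk : ((k + 1 : ℕ) : ℝ) ∈ Ioo (0 : ℝ) (G.len d.1) :=
      ⟨by positivity, by exact_mod_cast hk⟩
    have ht1 : t ≠ 1 := by
      rintro rfl
      apply hne
      rw [hp]
      have := G.dartPath_natCast d' (k' + 1)
      push_cast at this
      rw [this]
      rfl
    have ht' : t < 1 := lt_of_le_of_ne ht.2 ht1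
    obtain ⟨rfl, ⟨rfl, hst⟩ | ⟨rfl, hst⟩⟩ := G.eq_or_eq_rev_of_dartPath_eq hkk
      ⟨by linarith [ht.1, Nat.cast_nonneg (α := ℝ) k'], by linarith [ht.2]⟩ hp'
    · have h1 : (k' : ℝ) < k + 1 + 1 := by push_cast at hst; linarith [ht.1]
      have h2 : (k + 1 : ℝ) < k' + 1 := by push_cast at hst; linarith
      norm_cast at h1 h2
      obtain rfl : k' = k + 1 := by omega
      exact (ccwAngle_le _ _).trans_eq
        (ccwAngle_self (sub_ne_zero.mpr (S.ne ⟨⟨d', ⟨k + 1, hk⟩⟩, c⟩).symm)).symm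
    · rw [ODart.rev_fst] at hk'
      have h1 : (k + k' + 1 : ℝ) ≤ G.len d.1 := by push_cast at hst; linarith [ht.1]
      have h2 : (G.len d.1 : ℝ) < k + k' + 2 := by push_cast at hst; linarith
      norm_cast at h1 h2
      obtain rfl : k' = G.len d.1 - 1 - k := by omega
      exact le_rfl
  · rw [S.a_rev, S.b_rev]
  · rw [S.b_rev, S.a_rev]

theorem left_of_left_le (hQ : G.segmentSystem.Saturated Q) {d : ODart E} {k k' : ℕ} (hkk : k' ≤ k)
    (hk : k < G.len d.1) {c : Λ} (h : G.segmentSystem.Left Q ⟨⟨d, ⟨k, hk⟩⟩, c⟩) :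
    G.segmentSystem.Left Q ⟨⟨d, ⟨k', hkk.trans_lt hk⟩⟩, c⟩ := by
  induction k with
  | zero =>
    obtain rfl : k' = 0 := by omega
    exact h
  | succ k ih =>
    rcases Nat.lt_or_ge k k' with h' | h'
    · obtain rfl : k' = k + 1 := by omega
      exact h
    · exact ih h' (by omega) (left_of_left_succ hQ hk h)

/-- The left side of an oriented edge is connected, at its origin, to the right side of the next
one. -/
theorem left_rev_of_isNext (hQ : G.segmentSystem.Saturated Q) {d d' : ODart E}
    (hn : G.IsNext d d') {c c' : Λ} (hc : G.dartCorner d 0 + c = G.dartCorner d' 0 + c')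
    (h : G.segmentSystem.Left Q ⟨⟨d, ⟨0, G.len_pos _⟩⟩, c⟩) :
    G.segmentSystem.Left Q ⟨⟨d'.rev, ⟨G.len d'.1 - 1, by
      have := G.len_pos d'.1; rw [ODart.rev_fst]; omega⟩⟩, c'⟩ := by
  set S := G.segmentSystem
  set j : G.LiftIndex := ⟨⟨d', ⟨0, G.len_pos _⟩⟩, c'⟩
  refine hQ.left_turn (i := ⟨⟨d, ⟨0, G.len_pos _⟩⟩, c⟩) (j := j) (p := G.dartCorner d 0 + c) rfl
    hc.symm ?_ h
  rintro ⟨⟨d'', k, hk⟩, c''⟩ hm hne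
  obtain ⟨t, ht, hp⟩ := G.exists_dartPath_of_mem_segment _ _ hm
  have hk1 : (k : ℝ) + 1 ≤ G.len d''.1 := by exact_mod_cast hk
  have hk0 := Nat.cast_nonneg (α := ℝ) k
  have ht1 : t ≠ 1 := by
    rintro rfl
    apply hne
    rw [hp]
    have := G.dartPath_natCast d'' (k + 1)
    push_cast at this
    rw [this]
    rfl
  have ht' : t < 1 := lt_of_le_of_ne ht.2 ht1
  have hm' : Λ.mkQ (G.dartPath d'' (k + t)) = G.pos (G.origin d) := by
    rw [← mkQ_dartPath_zero, dartPath_zero, ← mkQ_add_coe Λ _ c'', ← hp, mkQ_add_coe]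
  rcases eq_or_lt_of_le (add_nonneg hk0 ht.1) with h0 | h0
  · have hk2 : (k : ℝ) = 0 := by linarith [ht.1]
    obtain rfl : k = 0 := by exact_mod_cast hk2
    rw [← h0, mkQ_dartPath_zero] at hm'
    rw [← h0, dartPath_zero] at hp
    have := hn.2 d'' (G.pos_injective hm')
    have e1 : S.b ⟨⟨d, ⟨0, G.len_pos _⟩⟩, c⟩ - (G.dartCorner d 0 + c) = G.startDir d :=
      add_sub_add_right_eq_sub _ _ _
    have e2 : S.b j - (G.dartCorner d 0 + c) = G.startDir d' := by
      rw [hc]; exact add_sub_add_right_eq_sub _ _ _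
    have e3 : S.b ⟨⟨d'', ⟨0, hk⟩⟩, c''⟩ - (G.dartCorner d 0 + c) = G.startDir d'' := by
      rw [hp]; exact add_sub_add_right_eq_sub _ _ _
    rw [e1, e2, e3]
    exact this
  · exact absurd hm' (G.mkQ_dartPath_ne_pos d'' ⟨h0, by linarith⟩ _)

namespace CrossingData

variable (C : G.CrossingData H)

/-- The first half of a dual edge ends on the left of the edge. -/
theorem left_of_mem (hdisj : ∀ e e', e ≠ e' → Disjoint (G.edgeSet e) (H.edgeSet e'))
    (hQ : G.segmentSystem.Saturated Q) {d : ODart E} {c c' : Λ}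
    (hc : G.dartPath d (C.k d + C.t d) + c = H.dartPath d (C.l d + C.s d) + c')
    (hmem : H.dartCorner d 0 + c' ∈ Q) :
    G.segmentSystem.Left Q ⟨⟨d, ⟨C.k d, (C.isCrossing d).lt_len⟩⟩, c⟩ := by
  have hC := C.isCrossing d
  have hHmem := natCast_add_mem_Ioo hC.lt_len_dual hC.mem_dual
  set half : ℝ → ℂ := fun r => H.dartPath d r + c' with hhalf
  have hpre : IsPreconnected (half '' Ico 0 (C.l d + C.s d)) :=
    isPreconnected_Ico.image _ (((continuousOn_polyline _).mono Ico_subset_Ici_self).add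
      continuousOn_const)
  -- Before the crossing the dual edge does not meet the graph, so it stays in one component.
  have hsub : half '' Ico 0 (C.l d + C.s d) ⊆ Q := by
    refine hQ.2 _ hpre ?_ ⟨_, ⟨0, ⟨le_rfl, hHmem.1⟩, rfl⟩, by simpa [hhalf] using hmem⟩
    rintro _ ⟨r, hr, rfl⟩ hcar
    obtain ⟨e, he⟩ := G.mem_carrier_iff.mp hcar
    simp only [hhalf, mkQ_add_coe] at he
    have hr' : Λ.mkQ (H.dartPath d r) ∈ H.edgeSet d.1 :=
      H.mkQ_dartPath_mem_edgeSet d ⟨hr.1, (hr.2.trans hHmem.2).le⟩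
    by_cases hed : e = d.1
    · subst hed
      have h1 := C.inter d ⟨he, hr'⟩
      rw [mem_singleton_iff, hC.eq] at h1
      have := H.dartPath_injOn_Ico d ⟨hr.1, hr.2.trans hHmem.2⟩ ⟨hHmem.1.le, hHmem.2⟩ h1
      exact hr.2.ne this
    · exact disjoint_left.mp (hdisj _ _ hed) he hr'
  refine hQ.left_of_frequently hC.mem ?_
  set u := G.dartCorner d (C.k d + 1) - G.dartCorner d (C.k d) with hu_def
  set v := H.dartCorner d (C.l d + 1) - H.dartCorner d (C.l d) with hv_def
  have hu : u ≠ 0 := sub_ne_zero.mpr (G.dartCorner_ne d hC.lt_len).symm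
  -- In the coordinate of the crossed segment, going back along the dual by `r` subtracts `r * (v /
  -- u)`. As `v / u` has negative imaginary part, this is the left side.
  have hlim : Tendsto (fun r : ℝ => (C.t d : ℂ) - r * (v / u)) (𝓝[>] 0) (𝓝 (C.t d : ℂ)) := by
    have : Continuous fun r : ℝ => (C.t d : ℂ) - r * (v / u) := by fun_prop
    have := this.tendsto 0
    simp only [Complex.ofReal_zero, zero_mul, sub_zero] at this
    exact this.mono_left nhdsWithin_le_nhds
  refine hlim.frequently (Eventually.frequently ?_)
  filter_upwards [Ioo_mem_nhdsGT hC.mem_dual.1] with r hr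
  constructor
  · have := hC.im_neg
    rw [Complex.sub_im, Complex.ofReal_im, Complex.im_ofReal_mul]
    nlinarith [hr.1]
  · have hmem' := hsub ⟨C.l d + (C.s d - r), ⟨by
      linarith [hr.2, Nat.cast_nonneg (α := ℝ) (C.l d)], by linarith [hr.1]⟩, rfl⟩
    convert hmem' using 1
    simp only [hhalf]
    rw [G.dartPath_add d _ (Ioo_subset_Icc_self hC.mem),
      H.dartPath_add d _ (Ioo_subset_Icc_self hC.mem_dual), AffineMap.lineMap_apply_module',
      AffineMap.lineMap_apply_module', ← hu_def, ← hv_def] at hc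
    rw [H.dartPath_add d _ ⟨by linarith [hr.2], by linarith [hr.1, hC.mem_dual.2]⟩,
      AffineMap.lineMap_apply_module', ← hv_def, SegmentSystem.pt]
    simp only [segmentSystem_a, segmentSystem_b, add_sub_add_right_eq_sub, ← hu_def]
    simp only [Complex.real_smul] at hc ⊢
    have : v / u * u = v := div_mul_cancel₀ _ hu
    push_cast
    linear_combination hc - (r : ℂ) * this

end CrossingData

/-- The lift of a point to a connected component of the complement of the graph, in the universal
cover, is unique. -/
theorem IsCellular.eq_of_mem_component [Finite V] (hG : G.IsCellular) {z w w' : ℂ}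
    (hz : z ∉ G.segmentSystem.carrier) (hw : w ∈ G.segmentSystem.component z)
    (hw' : w' ∈ G.segmentSystem.component z) (h : Λ.mkQ w = Λ.mkQ w') : w = w' := by
  have hns : ∀ q ∉ G.segmentSystem.carrier, Λ.mkQ q ∉ G.support := fun q hq hq' =>
    hq ((G.mkQ_mem_support_iff hG.origin_surjective).mp hq')
  refine hG.eq_of_mkQ_eq (hns z hz) SegmentSystem.isPreconnected_component
    (G.mapsTo_face SegmentSystem.isPreconnected_component (SegmentSystem.mem_component hz)
      fun q hq => hns q (SegmentSystem.saturated_component.1 hq)) hw hw' h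

theorem IsDual.notMem_carrier (h : G.IsDual H) {z : ℂ} {f : F} (hz : Λ.mkQ z = H.pos f) :
    z ∉ G.segmentSystem.carrier := by
  intro hc
  obtain ⟨e, he⟩ := G.mem_carrier_iff.mp hc
  rw [hz] at he
  exact h.vertex_notMem f (Or.inr (mem_iUnion.mpr ⟨e, he⟩))

/-- The piece of a face of `G` between consecutive oriented edges lifts to the universal cover. -/
theorem CrossingData.shift_eq [Finite V] (C : G.CrossingData H) (hG : G.IsCellular)
    (hdual : G.IsDual H) {d d' : ODart E} (hn : G.IsNext d d') :
    C.shift d = G.disp d' + C.shift d'.rev := by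
  set S := G.segmentSystem
  obtain ⟨c₀, hc₀⟩ := (mkQ_eq_mkQ_iff Λ).mp (C.isCrossing d).eq.symm
  obtain ⟨c, hc⟩ : ∃ c : Λ, H.dartPath d (C.l d + C.s d) = G.dartPath d (C.k d + C.t d) + c :=
    ⟨c₀, hc₀⟩
  have hz₁ := H.mkQ_dartCorner_add d 0
  have hz := hdual.notMem_carrier hz₁
  have hsat := S.saturated_component (z := H.dartCorner d 0 + (0 : Λ))
  have h1 := C.left_of_mem hdual.disjoint hsat (c := c) (c' := 0) (by rw [← hc]; simp)
    (SegmentSystem.mem_component hz)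
  have h2 := left_of_left_le hsat (Nat.zero_le _) _ h1
  obtain ⟨c₁, hc₁⟩ : ∃ c₁ : Λ, G.dartCorner d 0 = G.dartCorner d' 0 + c₁ := by
    rw [← mkQ_eq_mkQ_iff, ← dartPath_zero, mkQ_dartPath_zero, ← dartPath_zero, mkQ_dartPath_zero,
      hn.1]
  have h3 := left_rev_of_isNext hsat hn (c' := c₁ + c) (by
    rw [hc₁]; push_cast; ring) h2
  have hC' := C.isCrossing d'.rev
  have h4 := left_of_left_le hsat (Nat.le_sub_one_of_lt hC'.lt_len) _ h3
  obtain ⟨c₂, hc₂⟩ := (mkQ_eq_mkQ_iff Λ).mp hC'.eq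
  have hz₂ := H.mkQ_dartCorner_add d'.rev (c₂ + (c₁ + c))
  have hz' := hdual.notMem_carrier hz₂
  have h5 := C.left_of_mem hdual.disjoint
    (S.saturated_component (z := H.dartCorner d'.rev 0 + (c₂ + (c₁ + c) : Λ)))
    (d := d'.rev) (c := c₁ + c) (by rw [hc₂]; push_cast; ring) (SegmentSystem.mem_component hz')
  -- The left side has been followed from the crossing of `d` back to its origin, then across to the
  -- right of `d'` up to its crossing. So the components of the two dual origins, lifted
  -- accordingly, share a side and coincide. Both points lie over the same vertex, hence are equal.
  have h6 := SegmentSystem.component_eq_of_left h4 h5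
  have h7 := hG.eq_of_mem_component hz (SegmentSystem.mem_component hz)
    (h6 ▸ SegmentSystem.mem_component hz')
    (by rw [hz₁, hz₂, (hdual.order d d' hn).1])
  rw [shift, shift, disp, hc, hc₂, G.dartCorner_rev d' (Nat.zero_le _), Nat.sub_zero]
  push_cast at h7
  rw [add_zero] at h7
  rw [h7, hc₁]
  ring

/-- A component injects into the torus, whereas the whole plane does not, the lattice being nonzero.
-/
theorem IsCellular.component_ne_univ [IsZLattice ℝ Λ] [Finite V] (hG : G.IsCellular) {z : ℂ}
    (hz : z ∉ G.segmentSystem.carrier) : G.segmentSystem.component z ≠ univ := by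
  intro h
  have hΛ : ∃ c ∈ Λ, c ≠ 0 := by
    by_contra! h0
    have h1 : Submodule.span ℝ (Λ : Set ℂ) = ⊤ := IsZLattice.span_top
    have h2 : (Λ : Set ℂ) ⊆ {0} := fun c hc => h0 c hc
    have h3 := Submodule.span_mono (R := ℝ) h2
    rw [h1, Submodule.span_zero_singleton, top_le_iff] at h3
    exact bot_ne_top h3
  obtain ⟨c, hc, hc0⟩ := hΛ
  refine hc0 (hG.eq_of_mem_component hz (w := c) (w' := 0) (h ▸ mem_univ _) (h ▸ mem_univ _) ?_)
  rw [mkQ_eq_mkQ_iff]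
  exact ⟨⟨c, hc⟩, by simp⟩

/-- Each face of `G` is adjacent to some edge, hence each vertex of the dual is an end of some
dual edge. -/
theorem CrossingData.origin_surjective [IsZLattice ℝ Λ] [Finite V] (C : G.CrossingData H)
    (hG : G.IsCellular) (hdual : G.IsDual H) : Function.Surjective H.origin := by
  intro f
  set S := G.segmentSystem
  obtain ⟨z, hzf⟩ := Λ.mkQ_surjective (H.pos f)
  have hz := hdual.notMem_carrier hzf
  have hsat := S.saturated_component (z := z)
  obtain ⟨⟨⟨d, k, hk⟩, c⟩, hleft⟩ := hsat.exists_left SegmentSystem.isOpen_component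
    ⟨z, SegmentSystem.mem_component hz⟩ (hG.component_ne_univ hz)
  obtain ⟨c', hc'⟩ := (mkQ_eq_mkQ_iff Λ).mp (C.isCrossing d).eq
  have hw := H.mkQ_dartCorner_add d (c' + c)
  have hw' := hdual.notMem_carrier hw
  have hsat' := S.saturated_component (z := H.dartCorner d 0 + (c' + c : Λ))
  have h1 := C.left_of_mem hdual.disjoint hsat' (c := c) (c' := c' + c)
    (by rw [hc']; push_cast; ring) (SegmentSystem.mem_component hw')
  have heq : S.component z = S.component (H.dartCorner d 0 + (c' + c : Λ)) := by
    -- Left sides propagate only towards the origin of the edge, so the later of the two segments is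
    -- moved to the earlier one.
    rcases le_total (C.k d) k with h | h
    · exact SegmentSystem.component_eq_of_left (left_of_left_le hsat h _ hleft) h1
    · exact SegmentSystem.component_eq_of_left hleft (left_of_left_le hsat' h _ h1)
  have hns : ∀ q ∉ S.carrier, Λ.mkQ q ∉ G.support := fun q hq hq' =>
    hq ((G.mkQ_mem_support_iff hG.origin_surjective).mp hq')
  have hmaps := G.mapsTo_face SegmentSystem.isPreconnected_component
    (SegmentSystem.mem_component hz) fun q hq => hns q (hsat.1 hq)
  -- Both `f` and the origin of the dual of `d` lie in this face, which contains only one dual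
  -- vertex.
  obtain ⟨f', -, hf'⟩ := hdual.existsUnique_vertex _ (hns z hz)
  refine ⟨d, (hf' _ ?_).trans (hf' _ ?_).symm⟩
  · simp only [← hw]
    exact hmaps (heq ▸ SegmentSystem.mem_component hw')
  · simp only [← hzf]
    exact hmaps (SegmentSystem.mem_component hz)

end TorusGraph

end Topology

/-! ### The duality in the torus -/

theorem corollary3p3 (Λ : Submodule ℤ ℂ) [DiscreteTopology Λ] [IsZLattice ℝ Λ]
    {V F E : Type*} [Fintype V] [Fintype F] [Fintype E] [DecidableEq E]
    (G : TorusGraph Λ V E) (hG : G.IsCellular)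
    (Gd : TorusGraph Λ F E) (hdual : G.IsDual Gd)
    (x xd : E → ℝ) (hx : ∀ e, x e ∈ Set.Ioo (0 : ℝ) 1)
    (hxd : ∀ e, x e + xd e + x e * xd e = 1)
    (χ : Multiplicative Λ →* ℂˣ)
    (φ : ODart E → ℂˣ) (hφ : G.Represents χ φ)
    (φd : ODart E → ℂˣ) (hφd : Gd.Represents χ φd) :
    (2 : ℂ) ^ Fintype.card V * (∏ e, (1 + (x e : ℂ))⁻¹) * G.kwDet φ x =
      (2 : ℂ) ^ Fintype.card F * (∏ e, (1 + (xd e : ℂ))⁻¹) * Gd.kwDet φd xd := by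
  obtain ⟨C⟩ := hdual.nonempty_crossingData
  have hshift : ∀ d d', G.IsNext d d' → C.shift d = G.disp d' + C.shift d'.rev :=
    fun _ _ hn => C.shift_eq hG hdual hn
  exact C.kwDet_dual hG.origin_surjective (C.origin_surjective hG hdual) hdual.order hshift
    (fun d d' hn => by
      obtain ⟨m, hm⟩ := C.rotation_corner hdual.disjoint hn.1 (hshift d d' hn)
      exact ⟨m, hm⟩)
    x xd (fun e => (hx e).1) hxd χ hφ hφd
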